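/- **Setting.** Concept names, role names, individual constants and variables are finite words over a binary alphabet (kept apart by kind). A *basic role* is $P$ or $P^-$ with $P$ a role name; a *basic concept* is a concept name $A$ or $\exists P$ or $\exists P^-$. A $\textit{DL-Lite}_{\mathcal R}$ *TBox* $\mathcal T$ is a finite set of inclusions $B_1\sqsubseteq B_2$, $B_1\sqsubseteq\neg B_2$, $R_1\sqsubseteq R_2$, $R_1\sqsubseteq\neg R_2$ between basic concepts $B_i$ and between basic roles $R_i$, with the usual first-order semantics; its signature is the set of concept and role names that occur in it. A *policy* $\mathcal P$ over $\mathcal T$ is a finite set of denials $\forall\vec x\,(\phi(\vec x)\to\bot)$, where $\phi$ is a finite non-empty conjunction of atoms over the signature of $\mathcal T$ whose terms are constants or variables in $\vec x$. An *ABox for* $\mathcal T$ is a finite set $\mathcal A$ of ground atoms $A(a)$, $P(a,b)$ over the signature of $\mathcal T$ such that $\mathcal T\cup\mathcal A$ is consistent; its size $|\mathcal A|$ is the number of symbols in it. Let $\mathrm{cl}^{\mathcal T}_{\mathbf{GA}}(\mathcal A)$ be the set of ground atoms over the signature of $\mathcal T\cup\mathcal A$ that are entailed by $\mathcal T\cup\mathcal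 A$. A *confidentiality-preserving (CP) censor in* $\mathbf{GA}$ (the language of ground atoms) for $\mathcal T$ and $\mathcal P$ is a function $\mathsf{cens}$ that maps each ABox $\mathcal A$ for $\mathcal T$ to a set $\mathsf{cens}(\mathcal A)\subseteq \mathrm{cl}^{\mathcal T}_{\mathbf{GA}}(\mathcal A)$ such that $\mathcal T\cup\mathcal P\cup\mathsf{cens}(\mathcal A)$ is a consistent first-order theory. It is *optimal* if there is no CP censor $\mathsf{cens}'$ in $\mathbf{GA}$ for $\mathcal T$ and $\mathcal P$ with $\mathsf{cens}(\mathcal A)\subseteq\mathsf{cens}'(\mathcal A)$ for all $\mathcal A$ and $\mathsf{cens}(\mathcal A)\subsetneq\mathsf{cens}'(\mathcal A)$ for some $\mathcal A$. The algorithm $\mathsf{OptGACensor}(\mathcal T,\mathcal P,\mathcal A)$ is the following: set $\mathcal A_{\mathcal T}:=\mathrm{cl}^{\mathcal T}_{\mathbf{GA}}(\mathcal A)$ and $\mathit{Th}:=\emptyset$; while $\mathcal A_{\mathcal T}\neq\emptyset$, remove from $\mathcal A_{\mathcal T}$ its lexicographically first element $\alpha$, and if $\mathcal T\cup\mathit{Th}\cup\{\alpha\}\cup\mathcal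 P$ is consistent, put $\mathit{Th}:=\mathit{Th}\cup\{\alpha\}$; finally return $\mathit{Th}$. Programs are those of a WHILE language on binary trees (operations $\mathsf{nil}$, $\mathsf{cons}$, $\mathsf{hd}$, $\mathsf{tl}$, conditionals and loops that test for $\mathsf{nil}$, each of unit cost), and finite sets are given as repetition-free lists. **Theorem.** There are programs that compute $(\mathcal T,\mathcal A)\mapsto\mathrm{cl}^{\mathcal T}_{\mathbf{GA}}(\mathcal A)$ (as a lexicographically sorted list) and decide the consistency of $\mathcal T\cup\mathcal P\cup\mathcal S$ for finite sets $\mathcal S$ of ground atoms, such that the algorithm $\mathsf{OptGACensor}$ that calls these programs has the following property. For every $\textit{DL-Lite}_{\mathcal R}$ TBox $\mathcal T$ and every policy $\mathcal P$ over $\mathcal T$ with $\mathcal T\cup\mathcal P$ consistent, there are an optimal CP censor $\mathsf{cens}$ in $\mathbf{GA}$ for $\mathcal T$ and $\mathcal P$ and a polynomial $p$ such that, for each ABox $\mathcal A$ for $\mathcal T$, $\mathsf{OptGACensor}(\mathcal T,\mathcal P,\mathcal A)$ (i) returns $\mathsf{cens}(\mathcal A)$ and (ii) runs in at most $p(|\mathcal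 A|)$ steps. -/

import Mathlib

namespace CQE

/-! ### DL-Lite_R: names, TBoxes, ABoxes, denials -/

/-- Names of concepts, roles, individuals and variables are finite words. The four alphabets are
kept apart by the constructors in which the names are used. -/
abbrev Name := List Bool

/-- A basic role: `P` or its inverse. -/
inductive Role
  | atomic (P : Name)
  | inv (P : Name)

/-- A basic concept: `A`, or the unqualified existential restriction `∃R`. -/
inductive Concept
  | atomic (A : Name)
  | ex (R : Role)

/-- The assertions of a DL-Lite_R TBox. -/
inductive Inclusion
  | conceptIncl (B₁ B₂ : Concept)
  | conceptDisj (B₁ B₂ : Concept)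
  | roleIncl (R₁ R₂ : Role)
  | roleDisj (R₁ R₂ : Role)

abbrev TBox := Finset Inclusion

/-- Ground atoms `A(a)` and `P(a,b)`. -/
inductive GroundAtom
  | concept (A a : Name)
  | role (P a b : Name)

inductive Term
  | var (x : Name)
  | const (c : Name)

inductive QueryAtom
  | concept (A : Name) (t : Term)
  | role (P : Name) (t u : Term)

/-- A Boolean conjunctive query: a non-empty conjunction of atoms, all of whose variables are
existentially quantified. -/
structure BCQ where
  atoms : List QueryAtom
  nonempty : atoms ≠ []

/-- The denial assertion `∀ x, φ(x) → ⊥`, given by the query `∃ x, φ(x)`. -/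
structure Denial where
  body : BCQ

abbrev Policy := Finset Denial

/-! ### Signatures -/

inductive Pred
  | concept (A : Name)
  | role (P : Name)

def Role.pred : Role → Pred
  | .atomic P => .role P
  | .inv P => .role P

def Concept.pred : Concept → Pred
  | .atomic A => .concept A
  | .ex R => R.pred

def Inclusion.sig : Inclusion → Set Pred
  | .conceptIncl B₁ B₂ => {B₁.pred, B₂.pred}
  | .conceptDisj B₁ B₂ => {B₁.pred, B₂.pred}
  | .roleIncl R₁ R₂ => {R₁.pred, R₂.pred}
  | .roleDisj R₁ R₂ => {R₁.pred, R₂.pred}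

def TBox.sig (T : TBox) : Set Pred := {p | ∃ i ∈ T, p ∈ i.sig}

def GroundAtom.pred : GroundAtom → Pred
  | .concept A _ => .concept A
  | .role P _ _ => .role P

def QueryAtom.pred : QueryAtom → Pred
  | .concept A _ => .concept A
  | .role P _ _ => .role P

/-- The policy is specified over the signature of the TBox. -/
def Policy.IsOver (P : Policy) (T : TBox) : Prop :=
  ∀ δ ∈ P, ∀ q ∈ δ.body.atoms, q.pred ∈ TBox.sig T

/-! ### First-order semantics -/

/-- First-order interpretations (without the unique name assumption). The domain is non-empty
since it interprets the constants. -/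
structure Interp where
  Dom : Type
  concept : Name → Dom → Prop
  role : Name → Dom → Dom → Prop
  const : Name → Dom

namespace Interp

variable (I : Interp)

def evalRole : Role → I.Dom → I.Dom → Prop
  | .atomic P => fun x y => I.role P x y
  | .inv P => fun x y => I.role P y x

def evalConcept : Concept → I.Dom → Prop
  | .atomic A => fun x => I.concept A x
  | .ex R => fun x => ∃ y, I.evalRole R x y

def SatInclusion : Inclusion → Prop
  | .conceptIncl B₁ B₂ => ∀ x, I.evalConcept B₁ x → I.evalConcept B₂ x
  | .conceptDisj B₁ B₂ => ∀ x, I.evalConcept B₁ x → ¬ I.evalConcept B₂ x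
  | .roleIncl R₁ R₂ => ∀ x y, I.evalRole R₁ x y → I.evalRole R₂ x y
  | .roleDisj R₁ R₂ => ∀ x y, I.evalRole R₁ x y → ¬ I.evalRole R₂ x y

def SatGround : GroundAtom → Prop
  | .concept A a => I.concept A (I.const a)
  | .role P a b => I.role P (I.const a) (I.const b)

def termVal (v : Name → I.Dom) : Term → I.Dom
  | .var x => v x
  | .const c => I.const c

def SatAtom (v : Name → I.Dom) : QueryAtom → Prop
  | .concept A t => I.concept A (I.termVal v t)
  | .role P t u => I.role P (I.termVal v t) (I.termVal v u)

def SatBCQ (q : BCQ) : Prop := ∃ v : Name → I.Dom, ∀ α ∈ q.atoms, I.SatAtom v α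

def SatDenial (δ : Denial) : Prop := ¬ I.SatBCQ δ.body

end Interp

/-- The first-order theory `T ∪ P ∪ S` is consistent. -/
def Consistent (T : TBox) (P : Policy) (S : Set GroundAtom) : Prop :=
  ∃ I : Interp, (∀ i ∈ T, I.SatInclusion i) ∧ (∀ δ ∈ P, I.SatDenial δ) ∧ ∀ α ∈ S, I.SatGround α

/-- `T ∪ S ⊨ α`. -/
def Entails (T : TBox) (S : Set GroundAtom) (α : GroundAtom) : Prop :=
  ∀ I : Interp, (∀ i ∈ T, I.SatInclusion i) → (∀ β ∈ S, I.SatGround β) → I.SatGround α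

/-- An ABox for `T`: a finite set of ground atoms over the signature of `T`, consistent
with `T`. -/
structure ABoxFor (T : TBox) where
  atoms : Finset GroundAtom
  over_sig : ∀ α ∈ atoms, α.pred ∈ TBox.sig T
  consistent : Consistent T ∅ (atoms : Set GroundAtom)

/-- The ground atoms over the signature of `T ∪ A` that are entailed by `T ∪ A`. -/
def closureGA (T : TBox) (A : ABoxFor T) : Set GroundAtom :=
  {α | (α.pred ∈ TBox.sig T ∨ ∃ β ∈ A.atoms, α.pred = β.pred) ∧
    Entails T (A.atoms : Set GroundAtom) α}

/-! ### Confidentiality-preserving censors in the language of ground atoms -/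

abbrev Censor (T : TBox) := ABoxFor T → Set GroundAtom

def IsCPCensorGA (T : TBox) (P : Policy) (cens : Censor T) : Prop :=
  ∀ A : ABoxFor T, cens A ⊆ closureGA T A ∧ Consistent T P (cens A)

/-- `cens'` is more informative than `cens`. -/
def MoreInformative {T : TBox} (cens' cens : Censor T) : Prop :=
  (∀ A, cens A ⊆ cens' A) ∧ ∃ A, cens A ⊂ cens' A

def IsOptimalCPCensorGA (T : TBox) (P : Policy) (cens : Censor T) : Prop :=
  IsCPCensorGA T P cens ∧
    ¬ ∃ cens' : Censor T, IsCPCensorGA T P cens' ∧ MoreInformative cens' cens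

/-! ### A programming language with a step count

Data are binary trees. A program maps a tree to a tree; its primitive operations are those of
Jones's WHILE language (`nil`, `cons`, `hd`, `tl`, test against `nil`, `while`), each of unit
cost, and there is no comparison of trees in one step. -/

inductive Data
  | nil
  | node (l r : Data)

def Data.hd : Data → Data
  | .nil => .nil
  | .node l _ => l

def Data.tl : Data → Data
  | .nil => .nil
  | .node _ r => r

inductive Prog
  /-- return the input -/
  | arg
  | nil
  | cons (p q : Prog)
  | hd (p : Prog)
  | tl (p : Prog)
  /-- run `p`, then run `q` on the result of `p` -/
  | call (q p : Prog)
  /-- run `p` if `c` returns a tree other than `nil`, and `q` otherwise -/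
  | ite (c p q : Prog)
  /-- while `c` returns a tree other than `nil` on the current tree, replace that tree by the
  result of `b` on it -/
  | loop (c b : Prog)

/-- `Run p x y n`: on the input `x` the program `p` halts after exactly `n` steps with the
result `y`. -/
inductive Run : Prog → Data → Data → ℕ → Prop
  | arg (x : Data) : Run .arg x x 1
  | nil (x : Data) : Run .nil x .nil 1
  | cons {p q : Prog} {x a b : Data} {m n : ℕ} :
      Run p x a m → Run q x b n → Run (.cons p q) x (.node a b) (m + n + 1)
  | hd {p : Prog} {x a : Data} {m : ℕ} : Run p x a m → Run (.hd p) x a.hd (m + 1)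
  | tl {p : Prog} {x a : Data} {m : ℕ} : Run p x a m → Run (.tl p) x a.tl (m + 1)
  | call {p q : Prog} {x a b : Data} {m n : ℕ} :
      Run p x a m → Run q a b n → Run (.call q p) x b (m + n + 1)
  | iteThen {c p q : Prog} {x u v b : Data} {m n : ℕ} :
      Run c x (.node u v) m → Run p x b n → Run (.ite c p q) x b (m + n + 1)
  | iteElse {c p q : Prog} {x b : Data} {m n : ℕ} :
      Run c x .nil m → Run q x b n → Run (.ite c p q) x b (m + n + 1)
  | loopDone {c b : Prog} {x : Data} {m : ℕ} : Run c x .nil m → Run (.loop c b) x x (m + 1)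
  | loopStep {c b : Prog} {x u v y z : Data} {m n k : ℕ} :
      Run c x (.node u v) m → Run b x y n → Run (.loop c b) y z k →
        Run (.loop c b) x z (m + n + k + 1)

/-! ### Trees as representations of the inputs and outputs -/

def encBool : Bool → Data
  | false => .nil
  | true => .node .nil .nil

def encList {α : Type} (enc : α → Data) : List α → Data
  | [] => .nil
  | a :: l => .node (enc a) (encList enc l)

def encName : Name → Data := encList encBool

def Role.enc : Role → Data
  | .atomic P => .node (encBool false) (encName P)
  | .inv P => .node (encBool true) (encName P)

def Concept.enc : Concept → Data
  | .atomic A => .node (encBool false) (encName A)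
  | .ex R => .node (encBool true) R.enc

def Inclusion.enc : Inclusion → Data
  | .conceptIncl B₁ B₂ => .node (.node (encBool false) (encBool false)) (.node B₁.enc B₂.enc)
  | .conceptDisj B₁ B₂ => .node (.node (encBool false) (encBool true)) (.node B₁.enc B₂.enc)
  | .roleIncl R₁ R₂ => .node (.node (encBool true) (encBool false)) (.node R₁.enc R₂.enc)
  | .roleDisj R₁ R₂ => .node (.node (encBool true) (encBool true)) (.node R₁.enc R₂.enc)

def Term.enc : Term → Data
  | .var x => .node (encBool false) (encName x)
  | .const c => .node (encBool true) (encName c)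

def QueryAtom.enc : QueryAtom → Data
  | .concept A t => .node (encBool false) (.node (encName A) t.enc)
  | .role P t u => .node (encBool true) (.node (encName P) (.node t.enc u.enc))

def Denial.enc (δ : Denial) : Data := encList QueryAtom.enc δ.body.atoms

/-- A ground atom written as a list of words: its kind, its predicate and its arguments. -/
def GroundAtom.key : GroundAtom → List Name
  | .concept A a => [[false], A, a]
  | .role P a b => [[true], P, a, b]

def GroundAtom.enc (α : GroundAtom) : Data := encList encName α.key

/-- The lexicographic order of ground atoms. -/
def GroundAtom.LexLT (α β : GroundAtom) : Prop := α.key < β.key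

/-- The number of symbols in a ground atom. -/
def GroundAtom.size : GroundAtom → ℕ
  | .concept A a => 1 + A.length + a.length
  | .role P a b => 1 + P.length + a.length + b.length

def ABoxFor.size {T : TBox} (A : ABoxFor T) : ℕ := ∑ α ∈ A.atoms, α.size

/-- The tree `d` represents the set `S`: it is the list of the elements of `S`, in some order
and without repetitions. -/
def Represents {α : Type} (enc : α → Data) (d : Data) (S : Set α) : Prop :=
  ∃ l : List α, l.Nodup ∧ (∀ a, a ∈ l ↔ a ∈ S) ∧ d = encList enc l

/-! ### The algorithm -/

/-- On every input `(T . A)` the program returns the lexicographically sorted list of the ground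
atoms entailed by `T ∪ A`. -/
def ComputesClosureGA (cl : Prog) : Prop :=
  ∀ (T : TBox) (A : ABoxFor T) (dT dA : Data),
    Represents Inclusion.enc dT (T : Set Inclusion) →
    Represents GroundAtom.enc dA (A.atoms : Set GroundAtom) →
    ∃ (l : List GroundAtom) (n : ℕ), l.Pairwise GroundAtom.LexLT ∧
      (∀ α, α ∈ l ↔ α ∈ closureGA T A) ∧
      Run cl (.node dT dA) (encList GroundAtom.enc l) n

/-- On every input `(T . (P . S))`, with `S` a finite set of ground atoms, the program halts; it
returns a tree other than `nil` iff `T ∪ P ∪ S` is consistent. -/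
def DecidesConsistency (con : Prog) : Prop :=
  ∀ (T : TBox) (P : Policy) (S : Finset GroundAtom) (dT dP dS : Data),
    Represents Inclusion.enc dT (T : Set Inclusion) →
    Represents Denial.enc dP (P : Set Denial) →
    Represents GroundAtom.enc dS (S : Set GroundAtom) →
    ∃ (r : Data) (n : ℕ), Run con (.node dT (.node dP dS)) r n ∧
      (r ≠ .nil ↔ Consistent T P (S : Set GroundAtom))

/-- The algorithm OptGACensor on the input `(T . (P . A))`, where `cl` is called to compute the set
of entailed ground atoms and `con` to test consistency. The loop acts on trees of the form
`((T . P) . (AT . Th))`; as `AT` is a lexicographically sorted list, its first assertion is its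
head. -/
def OptGACensor (cl con : Prog) : Prog :=
  let x := Prog.arg
  -- `AT := cl(T, A); Th := ∅`
  let init : Prog :=
    .cons (.cons (.hd x) (.hd (.tl x))) (.cons (.call cl (.cons (.hd x) (.tl (.tl x)))) .nil)
  let T : Prog := .hd (.hd x)
  let P : Prog := .tl (.hd x)
  let AT : Prog := .hd (.tl x)
  let Th : Prog := .tl (.tl x)
  let α : Prog := .hd AT
  -- `AT := AT \ {α}; if T ∪ Th ∪ {α} ∪ P is consistent then Th := Th ∪ {α}`
  let body : Prog :=
    .cons (.cons T P) (.cons (.tl AT)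
      (.ite (.call con (.cons T (.cons P (.cons α Th)))) (.cons α Th) Th))
  -- `return Th`
  .call Th (.call (.loop AT body) init)

end CQE

namespace CQE

/-! ### The Skolem chase

The chase of a set of ground facts with the positive inclusions of a TBox. Its elements are pairs
of an individual and a word of roles, the last applied Skolem function first. -/

/-! Optimality is maximality of a greedy choice. A rejected atom is inconsistent with the atoms
accepted before it, hence with the final output. If a CP censor were more informative, the output
together with some further entailed atom would be consistent for some ABox, and the greedy choice
would have accepted that atom (`mem_greedy_of_consistent`, `greedyCensor_optimal`).

The remaining task is to compute entailed ground atoms and test consistency in time polynomial in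
the ABox for fixed `T` and `P`. Both are read off the Skolem chase. It maps homomorphically into
every model (`Interp.satFact_of_derives`) and is itself a model of the positive inclusions
(`canonical`). Negative inclusions are denials in disguise, so consistency means that none of the
finitely many forbidden queries matches in the chase (`consistent_iff`), and, for a consistent ABox,
entailment of a ground atom means membership in the chase (`entails_iff`).

The chase may be infinite, but a bounded part of it decides everything. Membership of an element in
concepts spreads along a graph with at most `2 * T.length` targets, so facts of depth at most `D`
appear within `(D + 1) * (2 * T.length + 1)` rounds (`Derives.within`). A match that goes too deep
can be pumped down: some branch repeats a role at a node that the match does not hit, and the part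
of the match below it moves to the shallower occurrence (`exists_smaller_match`). Hence a number of
rounds depending only on `T` and the query suffices (`matches_iff`).

On the side of programs, `Feasible κ` means polynomial time with a degree that may depend on a bound
for the parameter `κ`. A bounded number of polynomial steps is again polynomial
(`Feasible.iterate`); this covers the rounds of the chase and the enumeration of all assignments to
the terms of a query. The censor then calls the test once for each entailed atom
(`run_censor_loop`). -/

abbrev Elem := Name × List Role

/-- The Skolem term for the `R`-successor of `x`. -/
def child (x : Elem) (R : Role) : Elem := (x.1, R :: x.2)

inductive Fact
  | concept (A : Name) (x : Elem)
  | role (P : Name) (x y : Elem)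

def Fact.elems : Fact → List Elem
  | .concept _ x => [x]
  | .role _ x y => [x, y]

def Fact.map (σ : Elem → Elem) : Fact → Fact
  | .concept A x => .concept A (σ x)
  | .role P x y => .role P (σ x) (σ y)

def Role.flip : Role → Role
  | .atomic P => .inv P
  | .inv P => .atomic P

def Role.fact : Role → Elem → Elem → Fact
  | .atomic P, x, y => .role P x y
  | .inv P, x, y => .role P y x

def Concept.fact : Concept → Elem → Fact
  | .atomic A, x => .concept A x
  | .ex R, x => R.fact x (child x R)

/-- The fact `φ` witnesses that `x` belongs to the concept. -/
def Fact.Shows (φ : Fact) : Concept → Elem → Prop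
  | .atomic A, x => φ = .concept A x
  | .ex R, x => ∃ y, φ = R.fact x y

/-- The existential rule is oblivious: it fires even if `x` already has a suitable successor, and
its witness depends only on `x` and the role. Every rule has a single premise. -/
inductive Step (T : List Inclusion) : Fact → Fact → Prop
  | concept {B₁ B₂ : Concept} {φ : Fact} {x : Elem} :
      .conceptIncl B₁ B₂ ∈ T → φ.Shows B₁ x → Step T φ (B₂.fact x)
  | role {R₁ R₂ : Role} {x y : Elem} :
      .roleIncl R₁ R₂ ∈ T → Step T (R₁.fact x y) (R₂.fact x y)

inductive Derives (T : List Inclusion) (S : List Fact) : Fact → Prop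
  | base {φ : Fact} : φ ∈ S → Derives T S φ
  | step {φ ψ : Fact} : Derives T S ψ → Step T ψ φ → Derives T S φ

/-- The facts derived in at most `n` rounds. -/
def Within (T : List Inclusion) (S : List Fact) : ℕ → Fact → Prop
  | 0, φ => φ ∈ S
  | n + 1, φ => Within T S n φ ∨ ∃ ψ, Within T S n ψ ∧ Step T ψ φ

@[simp] theorem Role.flip_flip (R : Role) : R.flip.flip = R := by cases R <;> rfl

theorem Role.fact_flip (R : Role) (x y : Elem) : R.flip.fact x y = R.fact y x := by
  cases R <;> rfl

/-- A role fact can be read forwards or, with the inverse role, backwards. The paired cases in the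
arguments about role facts below come from this. -/
theorem Role.fact_eq_iff {R Q : Role} {x y z w : Elem} :
    R.fact x y = Q.fact z w ↔ (Q = R ∧ z = x ∧ w = y) ∨ (Q = R.flip ∧ z = y ∧ w = x) := by
  cases R <;> cases Q <;> simp [Role.fact, Role.flip] <;> grind

theorem Role.fact_ne_concept {R : Role} {x y : Elem} {A : Name} {z : Elem} :
    R.fact x y ≠ .concept A z := by
  cases R <;> simp [Role.fact]

theorem Role.mem_elems_fact {R : Role} {x y z : Elem} :
    z ∈ (R.fact x y).elems ↔ z = x ∨ z = y := by
  cases R <;> simp [Role.fact, Fact.elems, or_comm]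

theorem Role.map_fact (σ : Elem → Elem) (R : Role) (x y : Elem) :
    (R.fact x y).map σ = R.fact (σ x) (σ y) := by
  cases R <;> rfl

theorem Fact.Shows.mem_elems {φ : Fact} {B : Concept} {x : Elem} (h : φ.Shows B x) :
    x ∈ φ.elems := by
  cases B with
  | atomic A => cases h; simp [Fact.elems]
  | ex R => obtain ⟨y, rfl⟩ := h; simp [Role.mem_elems_fact]

theorem Fact.Shows.map {φ : Fact} {B : Concept} {x : Elem} (σ : Elem → Elem) (h : φ.Shows B x) :
    (φ.map σ).Shows B (σ x) := by
  cases B with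
  | atomic A => cases h; rfl
  | ex R => obtain ⟨y, rfl⟩ := h; exact ⟨σ y, Role.map_fact σ R x y⟩

theorem Concept.shows_fact (B : Concept) (x : Elem) : (B.fact x).Shows B x := by
  cases B with
  | atomic A => rfl
  | ex R => exact ⟨_, rfl⟩

theorem Concept.mem_elems_fact {B : Concept} {x z : Elem} (h : z ∈ (B.fact x).elems) :
    z = x ∨ ∃ R, B = .ex R ∧ z = child x R := by
  cases B with
  | atomic A => simpa [Concept.fact, Fact.elems] using h
  | ex R =>
    rcases Role.mem_elems_fact.1 h with h | h
    · exact .inl h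
    · exact .inr ⟨R, rfl, h⟩

/-! ### Rounds -/

theorem Within.mono {T : List Inclusion} {S : List Fact} {m n : ℕ} (h : m ≤ n) {φ : Fact}
    (hφ : Within T S m φ) : Within T S n φ := by
  induction h with
  | refl => exact hφ
  | step _ ih => exact .inl ih

theorem Within.derives {T : List Inclusion} {S : List Fact} {n : ℕ} {φ : Fact}
    (h : Within T S n φ) : Derives T S φ := by
  induction n generalizing φ with
  | zero => exact .base h
  | succ n ih =>
    rcases h with h | ⟨ψ, h, hs⟩
    · exact ih h
    · exact .step (ih h) hs

/-- A path in a graph need not be longer than the number of its targets. -/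
theorem reach_bound {α : Type} (P : ℕ → α → Prop) (hP : ∀ n a, P n a → P (n + 1) a) :
    ∀ (L : List α) (r : α → α → Prop), (∀ a b, r a b → b ∈ L) →
      (∀ n a b, r a b → P n a → P (n + 1) b) →
      ∀ (m : ℕ) (a b : α), P m a → Relation.ReflTransGen r a b → P (m + L.length) b := by
  classical
  intro L
  induction hn : L.length generalizing L with
  | zero =>
    intro r hL hr m a b ha hab
    obtain rfl := List.length_eq_zero_iff.1 hn
    rcases hab.cases_tail with rfl | ⟨c, -, hc⟩
    · exact ha
    · simpa using hL _ _ hc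
  | succ n ih =>
    intro r hL hr m a b ha hab
    have hmono : ∀ k, P (m + k) a := by
      intro k
      induction k with
      | zero => exact ha
      | succ k ihk => exact hP _ _ ihk
    -- The path is cut at its first arrival in `b`. The part before that never has `b` as a target,
    -- so `b` can be erased from the list of targets.
    set r' : α → α → Prop := fun x y => r x y ∧ y ≠ b with hr'
    have key : ∀ d, Relation.ReflTransGen r a d →
        Relation.ReflTransGen r' a d ∨ ∃ c, Relation.ReflTransGen r' a c ∧ r c b := by
      intro d hd
      induction hd with
      | refl => exact .inl .refl
      | tail _ hs ihd =>
        rename_i d e _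
        rcases ihd with ihd | ihd
        · by_cases he : e = b
          · subst he; exact .inr ⟨d, ihd, hs⟩
          · exact .inl (ihd.tail ⟨hs, he⟩)
        · exact .inr ihd
    have hfin : a = b ∨ ∃ c, Relation.ReflTransGen r' a c ∧ r c b := by
      rcases key b hab with h | h
      · rcases h.cases_tail with h | ⟨c, -, hc⟩
        · exact .inl h.symm
        · exact absurd rfl hc.2
      · exact .inr h
    rcases hfin with rfl | ⟨c, hac, hcb⟩
    · exact hmono _
    · have hb : b ∈ L := hL _ _ hcb
      have := ih (L.erase b) (by rw [List.length_erase_of_mem hb]; omega) r'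
        (fun x y h => (List.mem_erase_of_ne h.2).2 (hL _ _ h.1))
        (fun n x y h => hr n x y h.1) m a c ha hac
      exact hr _ _ _ hcb this

/-! ### Propagation along inclusions and the number of rounds -/

def RoleEdge (T : List Inclusion) (R Q : Role) : Prop :=
  .roleIncl R Q ∈ T ∨ .roleIncl R.flip Q.flip ∈ T

/-- Propagation of membership at a fixed element. A role inclusion acts on `∃R` because the same
successor remains a witness. -/
def ConceptEdge (T : List Inclusion) (B C : Concept) : Prop :=
  .conceptIncl B C ∈ T ∨ ∃ R Q, B = .ex R ∧ C = .ex Q ∧ RoleEdge T R Q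

/-- Each inclusion contributes at most two targets, for a role and its inverse; this is the factor 2
in `2 * T.length`. -/
def Inclusion.roleTargets : Inclusion → List Role
  | .roleIncl _ Q => [Q, Q.flip]
  | _ => []

def Inclusion.conceptTargets : Inclusion → List Concept
  | .conceptIncl _ C => [C]
  | .roleIncl _ Q => [.ex Q, .ex Q.flip]
  | _ => []

theorem length_flatMap_le {α β : Type} (f : α → List β) (k : ℕ) (l : List α)
    (h : ∀ a, (f a).length ≤ k) : (l.flatMap f).length ≤ k * l.length := by
  induction l with
  | nil => simp
  | cons a l ih =>
    have := h a
    simp only [List.flatMap_cons, List.length_append, List.length_cons]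
    nlinarith

theorem Within.reach_role {T : List Inclusion} {S : List Fact} {n : ℕ} {R Q : Role} {x y : Elem}
    (h : Within T S n (R.fact x y)) (hr : Relation.ReflTransGen (RoleEdge T) R Q) :
    Within T S (n + 2 * T.length) (Q.fact x y) := by
  have := reach_bound (fun n R => Within T S n (R.fact x y)) (by intro n a h; exact Or.inl h)
    (T.flatMap Inclusion.roleTargets) (RoleEdge T) ?_ ?_ n R Q h hr
  · refine this.mono (Nat.add_le_add_left (length_flatMap_le _ _ _ ?_) _)
    intro i; cases i <;> simp [Inclusion.roleTargets]
  · rintro a b (h | h)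
    · exact List.mem_flatMap.2 ⟨_, h, by simp [Inclusion.roleTargets]⟩
    · exact List.mem_flatMap.2 ⟨_, h, by simp [Inclusion.roleTargets]⟩
  · rintro n a b (h | h) hn
    · exact .inr ⟨_, hn, .role h⟩
    · refine .inr ⟨_, hn, ?_⟩
      rw [← Role.flip_flip a, ← Role.flip_flip b, Role.fact_flip, Role.fact_flip b.flip]
      exact .role h

theorem Within.reach_concept {T : List Inclusion} {S : List Fact} {n : ℕ} {B C : Concept}
    {x : Elem} (h : ∃ φ, Within T S n φ ∧ φ.Shows B x)
    (hr : Relation.ReflTransGen (ConceptEdge T) B C) :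
    ∃ φ, Within T S (n + 2 * T.length) φ ∧ φ.Shows C x := by
  have := reach_bound (fun n B => ∃ φ, Within T S n φ ∧ φ.Shows B x)
    (by rintro n a ⟨φ, h, h'⟩; exact ⟨φ, .inl h, h'⟩)
    (T.flatMap Inclusion.conceptTargets) (ConceptEdge T) ?_ ?_ n B C h hr
  · obtain ⟨φ, hφ, h'⟩ := this
    refine ⟨φ, hφ.mono (Nat.add_le_add_left (length_flatMap_le _ _ _ ?_) _), h'⟩
    intro i; cases i <;> simp [Inclusion.conceptTargets]
  · rintro a b (h | ⟨R, Q, rfl, rfl, h | h⟩)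
    · exact List.mem_flatMap.2 ⟨_, h, by simp [Inclusion.conceptTargets]⟩
    · exact List.mem_flatMap.2 ⟨_, h, by simp [Inclusion.conceptTargets]⟩
    · exact List.mem_flatMap.2 ⟨_, h, by simp [Inclusion.conceptTargets]⟩
  · rintro n a b (h | ⟨R, Q, rfl, rfl, h⟩) ⟨φ, hn, hs⟩
    · exact ⟨_, .inr ⟨_, hn, .concept h hs⟩, b.shows_fact x⟩
    · obtain ⟨y, rfl⟩ := hs
      refine ⟨Q.fact x y, .inr ⟨_, hn, ?_⟩, y, rfl⟩
      rcases h with h | h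
      · exact .role h
      · rw [← Role.flip_flip R, ← Role.flip_flip Q, Role.fact_flip, Role.fact_flip Q.flip]
        exact .role h

theorem RoleEdge.flip {T : List Inclusion} {R Q : Role} (h : RoleEdge T R Q) :
    RoleEdge T R.flip Q.flip := by
  rcases h with h | h
  · exact .inr (by simpa using h)
  · exact .inl h

/-- A derivable fact of bounded depth is derived in a bounded number of rounds. -/
theorem Derives.rounds {T : List Inclusion} {S : List Fact} {φ : Fact} (h : Derives T S φ) :
    (∀ B x, φ.Shows B x → ∃ B₀, (∃ ψ, Within T S (x.2.length * (2 * T.length + 1)) ψ ∧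
      ψ.Shows B₀ x) ∧ Relation.ReflTransGen (ConceptEdge T) B₀ B) ∧
    (∀ R x y, φ = R.fact x y → ∃ R₀, Within T S
      (max x.2.length y.2.length * (2 * T.length + 1)) (R₀.fact x y) ∧
      Relation.ReflTransGen (RoleEdge T) R₀ R) := by
  induction h with
  | base h =>
    refine ⟨fun B x hs => ⟨B, ⟨_, Within.mono (Nat.zero_le _) h, hs⟩, .refl⟩, ?_⟩
    rintro R x y rfl
    exact ⟨R, Within.mono (Nat.zero_le _) h, .refl⟩
  | step hd hs ih =>
    obtain ⟨ihC, ihR⟩ := ih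
    cases hs with
    | @concept B₁ B₂ ψ x hi hs =>
      obtain ⟨B₀, hB₀, hp⟩ := ihC _ _ hs
      obtain ⟨φ', hφ', hs'⟩ := Within.reach_concept hB₀ hp
      have hgood : Relation.ReflTransGen (ConceptEdge T) B₀ B₂ := hp.tail (.inl hi)
      cases B₂ with
      | atomic A =>
        constructor
        · intro B z hz
          cases B with
          | atomic A' =>
            simp only [Fact.Shows, Concept.fact, Fact.concept.injEq] at hz
            obtain ⟨rfl, rfl⟩ := hz
            exact ⟨B₀, hB₀, hgood⟩
          | ex R =>
            obtain ⟨y, hy⟩ := hz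
            exact absurd hy.symm Role.fact_ne_concept
        · intro R z y hy
          exact absurd hy.symm Role.fact_ne_concept
      | ex Q =>
        -- One more level costs at most `2 * T.length` rounds of propagation at `x` and one round
        -- that creates the successor.
        have hnew : Within T S ((child x Q).2.length * (2 * T.length + 1))
            (Q.fact x (child x Q)) := by
          have : Within T S (x.2.length * (2 * T.length + 1) + 2 * T.length + 1)
            (Q.fact x (child x Q)) := .inr ⟨φ', hφ', .concept hi hs'⟩
          refine this.mono ?_
          simp only [child, List.length_cons]
          nlinarith
        constructor
        · intro B z hz
          cases B with
          | atomic A' => exact absurd hz Role.fact_ne_concept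
          | ex R =>
            obtain ⟨y, hy⟩ := hz
            -- At the parent the new fact extends the path that starts in `B₀`. At the child it is
            -- the creating fact and starts a path of its own.
            rcases Role.fact_eq_iff.1 hy with ⟨rfl, rfl, rfl⟩ | ⟨rfl, rfl, rfl⟩
            · exact ⟨B₀, hB₀, hgood⟩
            · exact ⟨.ex Q.flip, ⟨_, hnew, _, (Role.fact_flip Q _ _).symm⟩, .refl⟩
        · intro R z y hy
          have hle : (child x Q).2.length * (2 * T.length + 1) ≤
              max z.2.length y.2.length * (2 * T.length + 1) := by
            refine Nat.mul_le_mul_right _ ?_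
            rcases Role.fact_eq_iff.1 hy with ⟨rfl, rfl, rfl⟩ | ⟨rfl, rfl, rfl⟩ <;> simp
          have hy' : Concept.fact (.ex Q) x = R.fact z y := hy
          refine ⟨R, ?_, .refl⟩
          rw [← hy']
          exact hnew.mono hle
    | @role R₁ R₂ x y hi =>
      constructor
      · intro B z hz
        cases B with
        | atomic A' => exact absurd hz Role.fact_ne_concept
        | ex R =>
          obtain ⟨w, hw⟩ := hz
          rcases Role.fact_eq_iff.1 hw with ⟨rfl, rfl, rfl⟩ | ⟨rfl, rfl, rfl⟩
          · obtain ⟨B₀, h₀, hp⟩ := ihC (.ex R₁) z ⟨_, rfl⟩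
            exact ⟨B₀, h₀, hp.tail (.inr ⟨_, _, rfl, rfl, .inl hi⟩)⟩
          · obtain ⟨B₀, h₀, hp⟩ := ihC (.ex R₁.flip) z ⟨_, (Role.fact_flip _ _ _).symm⟩
            exact ⟨B₀, h₀, hp.tail (.inr ⟨_, _, rfl, rfl, RoleEdge.flip (.inl hi)⟩)⟩
      · intro R z w hw
        rcases Role.fact_eq_iff.1 hw with ⟨rfl, rfl, rfl⟩ | ⟨rfl, rfl, rfl⟩
        · obtain ⟨R₀, h₀, hp⟩ := ihR R₁ _ _ rfl
          exact ⟨R₀, h₀, hp.tail (.inl hi)⟩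
        · obtain ⟨R₀, h₀, hp⟩ := ihR R₁.flip _ _ (Role.fact_flip _ _ _).symm
          exact ⟨R₀, h₀, hp.tail (RoleEdge.flip (.inl hi))⟩

/-- `Derives.rounds` yields a starting concept or role after at most `D * (2 * T.length + 1)`
rounds, and one last path adds at most `2 * T.length`. -/
theorem Derives.within {T : List Inclusion} {S : List Fact} {φ : Fact} (h : Derives T S φ)
    {D : ℕ} (hD : ∀ x ∈ φ.elems, x.2.length ≤ D) :
    Within T S ((D + 1) * (2 * T.length + 1)) φ := by
  obtain ⟨hC, hR⟩ := h.rounds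
  cases φ with
  | concept A x =>
    obtain ⟨B₀, h₀, hp⟩ := hC (.atomic A) x rfl
    obtain ⟨φ, hφ, hs⟩ := Within.reach_concept h₀ hp
    simp only [Fact.Shows] at hs
    subst hs
    have := hD x (by simp [Fact.elems])
    exact hφ.mono (by nlinarith)
  | role P x y =>
    obtain ⟨R₀, h₀, hp⟩ := hR (.atomic P) x y rfl
    have h1 := hD x (by simp [Fact.elems])
    have h2 := hD y (by simp [Fact.elems])
    have h3 : max x.2.length y.2.length ≤ D := max_le h1 h2
    exact (Within.reach_role h₀ hp).mono (by nlinarith)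

/-! ### Shape of the chase -/

def Grounded (S : List Fact) : Prop := ∀ φ ∈ S, ∀ x ∈ φ.elems, x.2 = []

/-- An element other than an individual can enter the chase only as the Skolem successor of its
parent, through an inclusion with an existential right-hand side. The same applies to each of its
ancestors. -/
theorem Derives.ancestor {T : List Inclusion} {S : List Fact} (hS : Grounded S) {φ : Fact}
    (h : Derives T S φ) {a : Name} {s w : List Role} {R : Role}
    (hx : (a, s ++ R :: w) ∈ φ.elems) :
    Derives T S (R.fact (a, w) (a, R :: w)) ∧ ∃ B, .conceptIncl B (.ex R) ∈ T := by
  induction h generalizing s with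
  | base h => simpa using hS _ h _ hx
  | step hd hs ih =>
    cases hs with
    | @concept B₁ B₂ ψ x hi hs =>
      rcases Concept.mem_elems_fact hx with h | ⟨Q, rfl, h⟩
      · exact ih (h ▸ hs.mem_elems)
      · cases s with
        | nil =>
          simp only [child, List.nil_append, Prod.mk.injEq, List.cons.injEq] at h
          obtain ⟨rfl, rfl, rfl⟩ := h
          exact ⟨.step hd (.concept hi hs), B₁, hi⟩
        | cons c s =>
          simp only [child, List.cons_append, Prod.mk.injEq, List.cons.injEq] at h
          obtain ⟨rfl, rfl, h⟩ := h
          refine ih (s := s) ?_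
          rw [h]
          exact hs.mem_elems
    | @role R₁ R₂ x y hi =>
      rw [Role.mem_elems_fact] at hx
      exact ih (Role.mem_elems_fact.2 hx)

/-- Only the existential rule joins a new pair, a parent and its child; role inclusions relabel
existing pairs. The chase is thus a forest hanging from the individuals. -/
theorem Derives.adjacent {T : List Inclusion} {S : List Fact} (hS : Grounded S) {φ : Fact}
    (h : Derives T S φ) {R : Role} {x y : Elem} (hφ : φ = R.fact x y) :
    (x.2 = [] ∧ y.2 = []) ∨ (∃ Q, y = child x Q) ∨ ∃ Q, x = child y Q := by
  induction h generalizing R x y with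
  | base h =>
    subst hφ
    exact .inl ⟨hS _ h _ (Role.mem_elems_fact.2 (.inl rfl)),
      hS _ h _ (Role.mem_elems_fact.2 (.inr rfl))⟩
  | step hd hs ih =>
    cases hs with
    | @concept B₁ B₂ ψ z hi hs =>
      cases B₂ with
      | atomic A => exact absurd hφ.symm Role.fact_ne_concept
      | ex Q =>
        rcases Role.fact_eq_iff.1 hφ with ⟨rfl, rfl, rfl⟩ | ⟨rfl, rfl, rfl⟩
        · exact .inr (.inl ⟨_, rfl⟩)
        · exact .inr (.inr ⟨_, rfl⟩)
    | @role R₁ R₂ z w hi =>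
      rcases Role.fact_eq_iff.1 hφ with ⟨rfl, rfl, rfl⟩ | ⟨rfl, rfl, rfl⟩
      · exact ih (R := R₁) rfl
      · exact ih (R := R₁.flip) (Role.fact_flip _ _ _).symm

/-- Replaces the suffix `w₁` of the word of an element by `w₂`. -/
def graft (w₁ w₂ : List Role) (x : Elem) : Elem := (x.1, x.2.take (x.2.length - w₁.length) ++ w₂)

theorem graft_append (a : Name) (s w₁ w₂ : List Role) :
    graft w₁ w₂ (a, s ++ w₁) = (a, s ++ w₂) := by
  simp [graft]

/-- What holds below an element depends only on the last role of its word. -/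
theorem Derives.graft {T : List Inclusion} {S : List Fact} (hS : Grounded S) {φ : Fact}
    (h : Derives T S φ) {a : Name} {R : Role} {w₁ w₂ s : List Role}
    (h₂ : Derives T S (R.fact (a, w₂) (a, R :: w₂))) (hx : (a, s ++ R :: w₁) ∈ φ.elems) :
    Derives T S (φ.map (graft w₁ w₂)) := by
  induction h generalizing s with
  | base h => simpa using hS _ h _ hx
  | step hd hs ih =>
    cases hs with
    | @concept B₁ B₂ ψ x hi hs =>
      -- If the step applies at an element of the subtree, it can be repeated on the image of its
      -- premise. Otherwise it has just created the root of the subtree, and the image of its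
      -- conclusion is `h₂`.
      by_cases hin : ∃ s', x = (a, s' ++ R :: w₁)
      · obtain ⟨s', hs'⟩ := hin
        have h' := ih (hs' ▸ hs.mem_elems)
        have h'' := h'.step (.concept hi (hs.map (CQE.graft w₁ w₂)))
        have : (B₂.fact x).map (CQE.graft w₁ w₂) = B₂.fact (CQE.graft w₁ w₂ x) := by
          cases B₂ with
          | atomic A => rfl
          | ex Q =>
            have e1 := graft_append a (s' ++ [R]) w₁ w₂
            have e2 := graft_append a (Q :: (s' ++ [R])) w₁ w₂
            simp only [List.append_assoc, List.cons_append, List.nil_append] at e1 e2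
            simp only [Concept.fact, Role.map_fact, child, hs', e1, e2]
        rw [this]
        exact h''
      · rcases Concept.mem_elems_fact hx with h | ⟨Q, rfl, h⟩
        · exact absurd ⟨s, h.symm⟩ hin
        · cases s with
          | nil =>
            simp only [child, List.nil_append, Prod.mk.injEq, List.cons.injEq] at h
            obtain ⟨rfl, rfl, rfl⟩ := h
            have e1 := graft_append x.1 [] x.2 w₂
            have e2 := graft_append x.1 [R] x.2 w₂
            simp only [List.cons_append, List.nil_append] at e1 e2
            simp only [Concept.fact, Role.map_fact, child, e1, e2]
            exact h₂
          | cons c s =>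
            simp only [child, List.cons_append, Prod.mk.injEq, List.cons.injEq] at h
            exact absurd ⟨s, Prod.ext h.1.symm h.2.2.symm⟩ hin
    | @role R₁ R₂ x y hi =>
      have h' := ih (s := s) (by
        rw [Role.mem_elems_fact] at hx
        exact Role.mem_elems_fact.2 hx)
      rw [Role.map_fact] at h' ⊢
      exact h'.step (.role hi)

/-! ### Matches of queries -/

def Term.elem (v : Name → Elem) : Term → Elem
  | .var x => v x
  | .const c => (c, [])

def QueryAtom.fact (v : Name → Elem) : QueryAtom → Fact
  | .concept A t => .concept A (t.elem v)
  | .role P t u => .role P (t.elem v) (u.elem v)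

def QueryAtom.terms : QueryAtom → List Term
  | .concept _ t => [t]
  | .role _ t u => [t, u]

theorem QueryAtom.elems_fact (v : Name → Elem) (α : QueryAtom) :
    (α.fact v).elems = α.terms.map (Term.elem v) := by
  cases α <;> rfl

theorem QueryAtom.fact_map (v v' : Name → Elem) (τ : Elem → Elem)
    (h : ∀ t : Term, t.elem v' = τ (t.elem v)) (α : QueryAtom) :
    α.fact v' = (α.fact v).map τ := by
  cases α <;> simp [QueryAtom.fact, Fact.map, h]

/-- Pigeonhole along a branch: more than `T.length` positions avoid `V`, while at most `T.length`
roles occur as right-hand sides of existential inclusions. -/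
theorem exists_repeated_role {T : List Inclusion} {V : List Elem} {a : Name} {w : List Role}
    (hw : V.length + T.length < w.length)
    (hT : ∀ R ∈ w, ∃ B, .conceptIncl B (.ex R) ∈ T) :
    ∃ i j, i < j ∧ ∃ R, w.drop i = R :: w.drop (i + 1) ∧ w.drop j = R :: w.drop (j + 1) ∧
      (a, w.drop i) ∉ V := by
  classical
  -- On a branch the depth determines the position, so each element of `V` rules out at most one.
  let bad : Finset ℕ := V.toFinset.image fun x => w.length - x.2.length
  let good : Finset ℕ := Finset.range w.length \ bad
  let roles : Finset Role := (T.filterMap fun i => match i with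
    | .conceptIncl _ (.ex R) => some R
    | _ => none).toFinset
  have hbad : bad.card ≤ V.length := Finset.card_image_le.trans (List.toFinset_card_le _)
  have hroles : roles.card ≤ T.length :=
    (List.toFinset_card_le _).trans (List.length_filterMap_le _ _)
  have hgood : roles.card < good.card := by
    have := Finset.le_card_sdiff bad (Finset.range w.length)
    rw [Finset.card_range] at this
    show _ < (Finset.range w.length \ bad).card
    omega
  have hne : w ≠ [] := by rintro rfl; simp at hw
  obtain ⟨R₀, hR₀⟩ := List.exists_mem_of_ne_nil w hne
  have hmaps : ∀ i ∈ good, w.getD i R₀ ∈ roles := by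
    intro i hi
    have hi' : i < w.length := by
      have := (Finset.mem_sdiff.1 hi).1
      simpa using this
    rw [List.getD_eq_getElem _ _ hi']
    obtain ⟨B, hB⟩ := hT _ (List.getElem_mem hi')
    exact List.mem_toFinset.2 (List.mem_filterMap.2 ⟨_, hB, rfl⟩)
  have hdrop : ∀ i ∈ good, w.drop i = w.getD i R₀ :: w.drop (i + 1) ∧ (a, w.drop i) ∉ V := by
    intro i hi
    obtain ⟨hi1, hi2⟩ := Finset.mem_sdiff.1 hi
    have hi' : i < w.length := by simpa using hi1
    refine ⟨by rw [List.getD_eq_getElem _ _ hi', List.drop_eq_getElem_cons hi'], fun hV => hi2 ?_⟩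
    refine Finset.mem_image.2 ⟨_, List.mem_toFinset.2 hV, ?_⟩
    simp only [List.length_drop]
    omega
  obtain ⟨i, hi, j, hj, hij, he⟩ := Finset.exists_ne_map_eq_of_card_lt_of_maps_to hgood hmaps
  rcases lt_or_gt_of_ne hij with h | h
  · exact ⟨i, j, h, _, (hdrop i hi).1, he ▸ (hdrop j hj).1, (hdrop i hi).2⟩
  · exact ⟨j, i, h, _, (hdrop j hj).1, he ▸ (hdrop i hi).1, (hdrop j hj).2⟩

/-- A match that reaches too deep can be moved towards the individuals. -/
theorem exists_smaller_match {T : List Inclusion} {S : List Fact} (hS : Grounded S)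
    {q : List QueryAtom} {v : Name → Elem} (hv : ∀ α ∈ q, Derives T S (α.fact v))
    {t₀ : Term} (ht₀ : t₀ ∈ q.flatMap QueryAtom.terms)
    (hdeep : (q.flatMap QueryAtom.terms).length + T.length < (t₀.elem v).2.length) :
    ∃ v' : Name → Elem, (∀ α ∈ q, Derives T S (α.fact v')) ∧
      ((q.flatMap QueryAtom.terms).map fun t => (t.elem v').2.length).sum <
        ((q.flatMap QueryAtom.terms).map fun t => (t.elem v).2.length).sum := by
  classical
  set V := q.flatMap QueryAtom.terms with hV
  obtain ⟨α₀, hα₀, htα₀⟩ := List.mem_flatMap.1 ht₀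
  have hmem₀ : t₀.elem v ∈ (α₀.fact v).elems := by
    rw [QueryAtom.elems_fact]; exact List.mem_map_of_mem htα₀
  obtain ⟨a, w, hw⟩ : ∃ a w, t₀.elem v = (a, w) := ⟨_, _, rfl⟩
  rw [hw] at hmem₀ hdeep
  have hT : ∀ R ∈ w, ∃ B, .conceptIncl B (.ex R) ∈ T := by
    intro R hR
    obtain ⟨s, u, rfl⟩ := List.append_of_mem hR
    exact ((hv _ hα₀).ancestor hS hmem₀).2
  obtain ⟨i, j, hij, R, hi, hj, hnot⟩ := exists_repeated_role (V := V.map (Term.elem v)) (a := a)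
    (by simpa using hdeep) hT
  set w₁ := w.drop (i + 1) with hw₁
  set w₂ := w.drop (j + 1) with hw₂
  have hji : j < w.length := by
    by_contra h
    rw [List.drop_eq_nil_of_le (by omega)] at hj
    simp at hj
  have hlen : w₂.length < w₁.length := by
    simp only [hw₁, hw₂, List.length_drop]; omega
  have h₂ : Derives T S (R.fact (a, w₂) (a, R :: w₂)) := by
    refine ((hv _ hα₀).ancestor hS (s := w.take j) ?_).1
    rw [← hj, List.take_append_drop]
    exact hmem₀
  -- The subtree below the deeper occurrence of `R`, root included (dropping fewer roles leaves a
  -- longer word). The map `τ` moves it to the shallower occurrence and fixes all else, in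
  -- particular the individuals.
  let In : Elem → Prop := fun x => ∃ s, x = (a, s ++ R :: w₁)
  let τ : Elem → Elem := fun x => if In x then graft w₁ w₂ x else x
  have hτin : ∀ {x}, In x → τ x = graft w₁ w₂ x := fun h => if_pos h
  have hτout : ∀ {x}, ¬ In x → τ x = x := fun h => if_neg h
  have hval : ∀ t : Term, t.elem (fun x => τ (v x)) = τ (t.elem v) := by
    intro t
    cases t with
    | var x => rfl
    | const c =>
      refine (hτout ?_).symm
      rintro ⟨s, hs⟩
      simp [Term.elem] at hs
  have hdepth : ∀ x, (τ x).2.length ≤ x.2.length := by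
    intro x
    by_cases hx : In x
    · obtain ⟨s, rfl⟩ := hx
      rw [hτin ⟨s, rfl⟩]
      have := graft_append a (s ++ [R]) w₁ w₂
      simp only [List.append_assoc, List.cons_append, List.nil_append] at this
      rw [this]
      simp only [List.length_append, List.length_cons]
      omega
    · rw [hτout hx]
  refine ⟨fun x => τ (v x), ?_, ?_⟩
  · intro α hα
    rw [QueryAtom.fact_map v _ τ hval]
    have hd := hv α hα
    -- The match avoids the root of the moved subtree. As the chase is a forest, the only way in or
    -- out of the subtree is through its root, so no atom joins its inside with its outside.
    have hterm : ∀ x ∈ (α.fact v).elems, x ≠ (a, R :: w₁) := by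
      rintro x hx rfl
      rw [QueryAtom.elems_fact] at hx
      obtain ⟨t, ht, hxt⟩ := List.mem_map.1 hx
      refine hnot ?_
      rw [hi]
      exact List.mem_map.2 ⟨t, List.mem_flatMap.2 ⟨α, hα, ht⟩, hxt⟩
    generalize α.fact v = φ at hd hterm
    cases φ with
    | concept A x =>
      by_cases hx : In x
      · simp only [Fact.map, hτin hx]
        obtain ⟨s, rfl⟩ := hx
        exact hd.graft hS h₂ (s := s) (by simp [Fact.elems])
      · simp only [Fact.map, hτout hx]
        exact hd
    | role P x y =>
      have key : ∀ x y : Elem, x ≠ (a, R :: w₁) → In x → ¬ In y →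
          ¬ ((x.2 = [] ∧ y.2 = []) ∨ (∃ Q, y = child x Q) ∨ ∃ Q, x = child y Q) := by
        rintro x y hne ⟨s, rfl⟩ hy (h | ⟨Q, rfl⟩ | ⟨Q, h⟩)
        · simp at h
        · exact hy ⟨Q :: s, rfl⟩
        · cases s with
          | nil => exact hne rfl
          | cons c s =>
            simp only [child, List.cons_append, Prod.mk.injEq, List.cons.injEq] at h
            exact hy ⟨s, Prod.ext h.1.symm h.2.2.symm⟩
      have hadj := hd.adjacent hS (R := .atomic P) rfl
      have hnx := hterm x (by simp [Fact.elems])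
      have hny := hterm y (by simp [Fact.elems])
      by_cases hx : In x <;> by_cases hy : In y
      · simp only [Fact.map, hτin hx, hτin hy]
        obtain ⟨s, rfl⟩ := hx
        exact hd.graft hS h₂ (s := s) (by simp [Fact.elems])
      · exact absurd hadj (key x y hnx hx hy)
      · exact absurd (hadj.imp And.symm Or.symm) (key y x hny hy hx)
      · simp only [Fact.map, hτout hx, hτout hy]
        exact hd
  · refine List.sum_lt_sum _ _ (fun t _ => by rw [hval]; exact hdepth _) ⟨t₀, ht₀, ?_⟩
    have hsplit : t₀.elem v = (a, w.take i ++ R :: w₁) := by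
      rw [hw, ← hi, List.take_append_drop]
    rw [hval, hτin ⟨_, hsplit⟩, hsplit]
    have := graft_append a (w.take i ++ [R]) w₁ w₂
    simp only [List.append_assoc, List.cons_append, List.nil_append] at this
    rw [this]
    simp only [List.length_append, List.length_cons]
    omega

/-- The number of rounds after which the chase is large enough for a query with `n` atoms. -/
def rounds (T : List Inclusion) (n : ℕ) : ℕ := (2 * n + T.length + 1) * (2 * T.length + 1)

def Matches (T : List Inclusion) (S : List Fact) (q : List QueryAtom) : Prop :=
  ∃ v : Name → Elem, ∀ α ∈ q, Within T S (rounds T q.length) (α.fact v)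

/-- Descent on the total depth of the match. When it can no longer be lowered, every term has depth
at most `2 * q.length + T.length`, since an atom has at most two terms; with this as `D`,
`Derives.within` gives exactly `rounds`. -/
theorem matches_iff {T : List Inclusion} {S : List Fact} (hS : Grounded S)
    {q : List QueryAtom} :
    Matches T S q ↔ ∃ v : Name → Elem, ∀ α ∈ q, Derives T S (α.fact v) := by
  constructor
  · rintro ⟨v, hv⟩
    exact ⟨v, fun α hα => (hv α hα).derives⟩
  · rintro ⟨v, hv⟩
    induction hn : ((q.flatMap QueryAtom.terms).map fun t => (t.elem v).2.length).sum
      using Nat.strong_induction_on generalizing v with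
    | _ n ih =>
      by_cases hdeep : ∃ t₀ ∈ q.flatMap QueryAtom.terms,
          (q.flatMap QueryAtom.terms).length + T.length < (t₀.elem v).2.length
      · obtain ⟨t₀, ht₀, hlt⟩ := hdeep
        obtain ⟨v', hv', hs⟩ := exists_smaller_match hS hv ht₀ hlt
        exact ih _ (hn ▸ hs) v' hv' rfl
      · push Not at hdeep
        refine ⟨v, fun α hα => ((hv α hα).within ?_).mono (le_refl _)⟩
        intro x hx
        rw [QueryAtom.elems_fact] at hx
        obtain ⟨t, ht, rfl⟩ := List.mem_map.1 hx
        have h1 := hdeep t (List.mem_flatMap.2 ⟨α, hα, ht⟩)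
        have h2 := length_flatMap_le QueryAtom.terms 2 q
          (fun β => by cases β <;> simp [QueryAtom.terms])
        omega

/-! ### Consistency and entailment by the chase -/

def GroundAtom.fact : GroundAtom → Fact
  | .concept A a => .concept A (a, [])
  | .role P a b => .role P (a, []) (b, [])

theorem GroundAtom.grounded (S : List GroundAtom) : Grounded (S.map GroundAtom.fact) := by
  intro φ hφ x hx
  obtain ⟨α, -, rfl⟩ := List.mem_map.1 hφ
  cases α <;> simp [GroundAtom.fact, Fact.elems] at hx
  · rw [hx]
  · rcases hx with rfl | rfl <;> rfl

def Role.atom : Role → Term → Term → QueryAtom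
  | .atomic P, t, u => .role P t u
  | .inv P, t, u => .role P u t

/-- The second term names the witness of an existential concept and plays no role for a concept
name. -/
def Concept.atom : Concept → Term → Term → QueryAtom
  | .atomic A, t, _ => .concept A t
  | .ex R, t, u => R.atom t u

/-- The queries that a negative inclusion forbids. -/
def Inclusion.negQueries : Inclusion → List (List QueryAtom)
  | .conceptDisj B C => [[B.atom (.var []) (.var [false]), C.atom (.var []) (.var [true])]]
  | .roleDisj R Q => [[R.atom (.var []) (.var [false]), Q.atom (.var []) (.var [false])]]
  | _ => []

def Inclusion.Positive : Inclusion → Prop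
  | .conceptIncl _ _ => True
  | .roleIncl _ _ => True
  | _ => False

def queries (T : List Inclusion) (P : List Denial) : List (List QueryAtom) :=
  T.flatMap Inclusion.negQueries ++ P.map fun δ => δ.body.atoms

namespace Interp

variable (I : Interp)

theorem satAtom_role (v : Name → I.Dom) (R : Role) (t u : Term) :
    I.SatAtom v (R.atom t u) ↔ I.evalRole R (I.termVal v t) (I.termVal v u) := by
  cases R <;> rfl

theorem exists_satAtom_of_evalConcept (B : Concept) {x : I.Dom} (y : Name)
    (h : I.evalConcept B x) : ∃ d, ∀ v : Name → I.Dom, v [] = x → v y = d →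
      I.SatAtom v (B.atom (.var []) (.var y)) := by
  cases B with
  | atomic A =>
    refine ⟨x, fun v hx _ => ?_⟩
    show I.concept A (v [])
    rw [hx]; exact h
  | ex R =>
    obtain ⟨d, hd⟩ := h
    refine ⟨d, ?_⟩
    rintro v rfl rfl
    exact (I.satAtom_role v R _ _).2 hd

theorem evalConcept_of_satAtom (B : Concept) (v : Name → I.Dom) (u : Term)
    (h : I.SatAtom v (B.atom (.var []) u)) : I.evalConcept B (v []) := by
  cases B with
  | atomic A => exact h
  | ex R => exact ⟨_, (I.satAtom_role v R _ _).1 h⟩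

/-- A negative inclusion holds iff its queries have no match. -/
theorem satInclusion_iff_of_neg {i : Inclusion} (hi : ¬ i.Positive) :
    I.SatInclusion i ↔
      ∀ q ∈ i.negQueries, ¬ ∃ v : Name → I.Dom, ∀ α ∈ q, I.SatAtom v α := by
  cases i with
  | conceptIncl => exact absurd trivial hi
  | roleIncl => exact absurd trivial hi
  | conceptDisj B C =>
    simp only [SatInclusion, Inclusion.negQueries, List.mem_singleton, forall_eq]
    constructor
    · rintro h ⟨v, hv⟩
      exact h (v []) (I.evalConcept_of_satAtom B v _ (hv _ (.head _)))
        (I.evalConcept_of_satAtom C v _ (hv _ (.tail _ (.head _))))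
    · intro h x hB hC
      obtain ⟨d, hd⟩ := I.exists_satAtom_of_evalConcept B [false] hB
      obtain ⟨e, he⟩ := I.exists_satAtom_of_evalConcept C [true] hC
      -- The three variables are the common member and the two witnesses, which have to be
      -- independent of each other.
      refine h ⟨fun z => if z = [] then x else if z = [false] then d else e, ?_⟩
      intro α hα
      simp only [List.mem_cons, List.not_mem_nil, or_false] at hα
      rcases hα with rfl | rfl
      · exact hd _ (by simp) (by simp)
      · exact he _ (by simp) (by simp)
  | roleDisj R Q =>
    simp only [SatInclusion, Inclusion.negQueries, List.mem_singleton, forall_eq]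
    constructor
    · rintro h ⟨v, hv⟩
      exact h (v []) (v [false])
        ((I.satAtom_role v R (.var []) (.var [false])).1 (hv _ (.head _)))
        ((I.satAtom_role v Q (.var []) (.var [false])).1 (hv _ (.tail _ (.head _))))
    · intro h x y hR hQ
      refine h ⟨fun z => if z = [] then x else y, ?_⟩
      intro α hα
      simp only [List.mem_cons, List.not_mem_nil, or_false] at hα
      rcases hα with rfl | rfl
      · exact (I.satAtom_role _ R _ _).2 (by simpa [termVal] using hR)
      · exact (I.satAtom_role _ Q _ _).2 (by simpa [termVal] using hQ)

/-- The value of a Skolem term in a model. -/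
noncomputable def skolem (a : Name) : List Role → I.Dom
  | [] => I.const a
  | R :: w => open Classical in
    if h : ∃ y, I.evalRole R (skolem a w) y then h.choose else I.const a

def SatFact : Fact → Prop
  | .concept A x => I.concept A (I.skolem x.1 x.2)
  | .role P x y => I.role P (I.skolem x.1 x.2) (I.skolem y.1 y.2)

theorem satFact_role (R : Role) (x y : Elem) :
    I.SatFact (R.fact x y) ↔ I.evalRole R (I.skolem x.1 x.2) (I.skolem y.1 y.2) := by
  cases R <;> rfl

/-- Universality of the chase. When an existential rule fires, the model has a successor of the
required kind, so `skolem` takes its chosen witness and not its default. -/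
theorem satFact_of_derives {T : List Inclusion} {S : List GroundAtom}
    (hT : ∀ i ∈ T, I.SatInclusion i) (hS : ∀ α ∈ S, I.SatGround α) {φ : Fact}
    (h : Derives T (S.map GroundAtom.fact) φ) : I.SatFact φ := by
  induction h with
  | base h =>
    obtain ⟨α, hα, rfl⟩ := List.mem_map.1 h
    have := hS α hα
    cases α <;> exact this
  | step _ hs ih =>
    cases hs with
    | @concept B C ψ x hi hs =>
      have hB : I.evalConcept B (I.skolem x.1 x.2) := by
        cases B with
        | atomic A => cases hs; exact ih
        | ex R =>
          obtain ⟨y, rfl⟩ := hs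
          exact ⟨_, (I.satFact_role R x y).1 ih⟩
      have hC := hT _ hi _ hB
      cases C with
      | atomic A => exact hC
      | ex R =>
        refine (I.satFact_role R x (child x R)).2 ?_
        have hC' : ∃ y, I.evalRole R (I.skolem x.1 x.2) y := hC
        simp only [child, skolem]
        rw [dif_pos hC']
        exact hC'.choose_spec
    | @role R Q x y hi =>
      exact (I.satFact_role Q x y).2 (hT _ hi _ _ ((I.satFact_role R x y).1 ih))

theorem satAtom_of_satFact (v : Name → Elem) (α : QueryAtom) (h : I.SatFact (α.fact v)) :
    I.SatAtom (fun x => I.skolem (v x).1 (v x).2) α := by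
  have key : ∀ t : Term, I.termVal (fun x => I.skolem (v x).1 (v x).2) t =
      I.skolem (t.elem v).1 (t.elem v).2 := by
    intro t; cases t <;> rfl
  cases α with
  | concept A t => simp only [SatAtom, key]; exact h
  | role P t u => simp only [SatAtom, key]; exact h

end Interp

/-- The canonical model. -/
def canonical (T : List Inclusion) (S : List Fact) : Interp where
  Dom := Elem
  concept A x := Derives T S (.concept A x)
  role P x y := Derives T S (.role P x y)
  const a := (a, [])

theorem canonical_evalRole (T : List Inclusion) (S : List Fact) (R : Role) (x y : Elem) :
    (canonical T S).evalRole R x y ↔ Derives T S (R.fact x y) := by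
  cases R <;> rfl

theorem canonical_evalConcept (T : List Inclusion) (S : List Fact) (B : Concept) (x : Elem) :
    (canonical T S).evalConcept B x ↔ ∃ φ, Derives T S φ ∧ φ.Shows B x := by
  cases B with
  | atomic A =>
    constructor
    · intro h; exact ⟨_, h, rfl⟩
    · rintro ⟨φ, h, rfl⟩; exact h
  | ex R =>
    constructor
    · rintro ⟨y, h⟩; exact ⟨_, (canonical_evalRole T S R x y).1 h, y, rfl⟩
    · rintro ⟨φ, h, y, rfl⟩; exact ⟨y, (canonical_evalRole T S R x y).2 h⟩

theorem canonical_satAtom (T : List Inclusion) (S : List Fact) (v : Name → Elem)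
    (α : QueryAtom) : (canonical T S).SatAtom v α ↔ Derives T S (α.fact v) := by
  have key : ∀ t : Term, (canonical T S).termVal v t = t.elem v := by
    intro t; cases t <;> rfl
  cases α with
  | concept A t => simp only [Interp.SatAtom, key]; rfl
  | role P t u => simp only [Interp.SatAtom, key]; rfl

theorem canonical_satInclusion {T : List Inclusion} (S : List Fact) {i : Inclusion} (hi : i ∈ T)
    (hp : i.Positive) : (canonical T S).SatInclusion i := by
  cases i with
  | conceptDisj => exact hp.elim
  | roleDisj => exact hp.elim
  | conceptIncl B C =>
    intro x hx
    obtain ⟨φ, hφ, hs⟩ := (canonical_evalConcept T S B x).1 hx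
    exact (canonical_evalConcept T S C x).2 ⟨_, hφ.step (.concept hi hs), C.shows_fact x⟩
  | roleIncl R Q =>
    intro x y hx
    exact (canonical_evalRole T S Q x y).2
      (((canonical_evalRole T S R x y).1 hx).step (.role hi))

theorem canonical_satGround {T : List Inclusion} {S : List GroundAtom} {α : GroundAtom} :
    (canonical T (S.map GroundAtom.fact)).SatGround α ↔
      Derives T (S.map GroundAtom.fact) α.fact := by
  cases α <;> rfl

theorem not_matches_of_consistent {T : List Inclusion} {P : List Denial} {S : List GroundAtom}
    {I : Interp} (hT : ∀ i ∈ T, I.SatInclusion i) (hP : ∀ δ ∈ P, I.SatDenial δ)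
    (hS : ∀ α ∈ S, I.SatGround α) {q : List QueryAtom} (hq : q ∈ queries T P) :
    ¬ Matches T (S.map GroundAtom.fact) q := by
  rw [matches_iff (GroundAtom.grounded S)]
  rintro ⟨v, hv⟩
  have hsat : ∃ v : Name → I.Dom, ∀ α ∈ q, I.SatAtom v α :=
    ⟨_, fun α hα => I.satAtom_of_satFact v α (I.satFact_of_derives hT hS (hv α hα))⟩
  rcases List.mem_append.1 hq with h | h
  · obtain ⟨i, hi, hqi⟩ := List.mem_flatMap.1 h
    have hneg : ¬ i.Positive := by
      cases i <;> simp_all [Inclusion.negQueries, Inclusion.Positive]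
    exact (I.satInclusion_iff_of_neg hneg).1 (hT i hi) q hqi hsat
  · obtain ⟨δ, hδ, rfl⟩ := List.mem_map.1 h
    exact hP δ hδ hsat

theorem canonical_sat {T : List Inclusion} {P : List Denial} {S : List GroundAtom}
    (h : ∀ q ∈ queries T P, ¬ Matches T (S.map GroundAtom.fact) q) :
    (∀ i ∈ T, (canonical T (S.map GroundAtom.fact)).SatInclusion i) ∧
    (∀ δ ∈ P, (canonical T (S.map GroundAtom.fact)).SatDenial δ) ∧
    ∀ α ∈ S, (canonical T (S.map GroundAtom.fact)).SatGround α := by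
  have key : ∀ q ∈ queries T P, ¬ ∃ v : Name → (canonical T (S.map GroundAtom.fact)).Dom,
      ∀ α ∈ q, (canonical T (S.map GroundAtom.fact)).SatAtom v α := by
    rintro q hq ⟨v, hv⟩
    refine h q hq ((matches_iff (GroundAtom.grounded S)).2
      ⟨v, fun α hα => (canonical_satAtom T _ v α).1 (hv α hα)⟩)
  refine ⟨fun i hi => ?_, fun δ hδ => ?_, fun α hα => ?_⟩
  · by_cases hp : i.Positive
    · exact canonical_satInclusion _ hi hp
    · exact (Interp.satInclusion_iff_of_neg _ hp).2 fun q hq =>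
        key q (List.mem_append_left _ (List.mem_flatMap.2 ⟨i, hi, hq⟩))
  · exact key _ (List.mem_append_right _ (List.mem_map.2 ⟨δ, hδ, rfl⟩))
  · exact canonical_satGround.2 (.base (List.mem_map_of_mem hα))

/-- A match in the chase transfers to every model, so it excludes consistency. Without a match the
canonical model satisfies the negative inclusions and denials as well. -/
theorem consistent_iff {T : TBox} {P : Policy} {S : Set GroundAtom} {lT : List Inclusion}
    {lP : List Denial} {lS : List GroundAtom} (hT : ∀ i, i ∈ lT ↔ i ∈ T)
    (hP : ∀ δ, δ ∈ lP ↔ δ ∈ P) (hS : ∀ α, α ∈ lS ↔ α ∈ S) :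
    Consistent T P S ↔ ∀ q ∈ queries lT lP, ¬ Matches lT (lS.map GroundAtom.fact) q := by
  constructor
  · rintro ⟨I, h1, h2, h3⟩ q hq
    exact not_matches_of_consistent (fun i hi => h1 i ((hT i).1 hi))
      (fun δ hδ => h2 δ ((hP δ).1 hδ)) (fun α hα => h3 α ((hS α).1 hα)) hq
  · intro h
    obtain ⟨h1, h2, h3⟩ := canonical_sat h
    exact ⟨_, fun i hi => h1 i ((hT i).2 hi), fun δ hδ => h2 δ ((hP δ).2 hδ),
      fun α hα => h3 α ((hS α).2 hα)⟩

/-- Consistency makes the canonical model a model of all of `T`, so an entailed atom is derived.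
Ground atoms have depth 0, for which `rounds lT 0` is more than enough. -/
theorem entails_iff {T : TBox} {S : Set GroundAtom} (hc : Consistent T ∅ S)
    {lT : List Inclusion} {lS : List GroundAtom} (hT : ∀ i, i ∈ lT ↔ i ∈ T)
    (hS : ∀ α, α ∈ lS ↔ α ∈ S) (α : GroundAtom) :
    Entails T S α ↔ Within lT (lS.map GroundAtom.fact) (rounds lT 0) α.fact := by
  have hh := (consistent_iff (lP := []) hT (by simp) hS).1 hc
  obtain ⟨h1, -, h3⟩ := canonical_sat hh
  constructor
  · intro h
    have := h _ (fun i hi => h1 i ((hT i).2 hi)) (fun β hβ => h3 β ((hS β).2 hβ))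
    have hd := canonical_satGround.1 this
    have := hd.within (D := 0) (by
      intro x hx
      cases α <;> simp [GroundAtom.fact, Fact.elems] at hx
      · rw [hx]; rfl
      · rcases hx with rfl | rfl <;> rfl)
    exact this.mono (Nat.mul_le_mul_right _ (by omega))
  · intro h I hI hIS
    have := I.satFact_of_derives (fun i hi => hI i ((hT i).1 hi))
      (fun β hβ => hIS β ((hS β).1 hβ)) h.derives
    cases α <;> exact this

/-- Derived facts use only predicates of the TBox and of the given facts. -/
theorem pred_of_derives {T : List Inclusion} {S : List GroundAtom} {φ : Fact}
    (h : Derives T (S.map GroundAtom.fact) φ) {α : GroundAtom} (hα : φ = α.fact) :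
    (∃ i ∈ T, α.pred ∈ i.sig) ∨ ∃ β ∈ S, α.pred = β.pred := by
  cases h with
  | base h =>
    obtain ⟨β, hβ, h⟩ := List.mem_map.1 h
    refine .inr ⟨β, hβ, ?_⟩
    cases α <;> cases β <;> simp_all [GroundAtom.fact, GroundAtom.pred]
  | step _ hs =>
    left
    cases hs with
    | @concept B C ψ x hi hs =>
      refine ⟨_, hi, ?_⟩
      have : α.pred = C.pred := by
        cases C with
        | atomic A => cases α <;> simp_all [GroundAtom.fact, GroundAtom.pred, Concept.pred,
            Concept.fact]
        | ex R => cases R <;> cases α <;> simp_all [GroundAtom.fact, GroundAtom.pred,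
            Concept.pred, Concept.fact, Role.fact, Role.pred]
      simp [Inclusion.sig, this]
    | @role R Q x y hi =>
      refine ⟨_, hi, ?_⟩
      have : α.pred = Q.pred := by
        cases Q <;> cases α <;> simp_all [GroundAtom.fact, GroundAtom.pred, Role.fact, Role.pred]
      simp [Inclusion.sig, this]

/-- The restriction on the signature costs nothing, as derivations introduce no foreign predicates.
-/
theorem mem_closureGA_iff {T : TBox} {A : ABoxFor T} {lT : List Inclusion}
    {lA : List GroundAtom} (hT : ∀ i, i ∈ lT ↔ i ∈ T) (hA : ∀ α, α ∈ lA ↔ α ∈ A.atoms)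
    (α : GroundAtom) :
    α ∈ closureGA T A ↔ Within lT (lA.map GroundAtom.fact) (rounds lT 0) α.fact := by
  have he := entails_iff A.consistent hT hA α
  constructor
  · exact fun h => he.1 h.2
  · intro h
    refine ⟨?_, he.2 h⟩
    rcases pred_of_derives h.derives rfl with ⟨i, hi, h⟩ | ⟨β, hβ, h⟩
    · exact .inl ⟨i, (hT i).1 hi, h⟩
    · exact .inr ⟨β, (hA β).1 hβ, h⟩

/-! ### Feasible functions on trees

A function on trees is feasible with respect to a parameter `κ` if it is computed by a program
that runs, for bounded values of the parameter, in polynomial time. -/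

def Data.size : Data → ℕ
  | .nil => 0
  | .node l r => l.size + r.size + 1

def Data.toList : Data → List Data
  | .nil => []
  | .node a l => a :: l.toList

def Data.ite : Data → Data → Data → Data
  | .nil, _, b => b
  | .node _ _, a, _ => a

@[simp] theorem Data.hd_node (a b : Data) : (Data.node a b).hd = a := rfl
@[simp] theorem Data.tl_node (a b : Data) : (Data.node a b).tl = b := rfl
@[simp] theorem Data.ite_nil (a b : Data) : Data.ite .nil a b = b := rfl
@[simp] theorem Data.ite_node (c d a b : Data) : Data.ite (.node c d) a b = a := rfl
@[simp] theorem Data.size_nil : Data.nil.size = 0 := rfl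
@[simp] theorem Data.size_node (a b : Data) : (Data.node a b).size = a.size + b.size + 1 := rfl

theorem Data.size_hd_le (x : Data) : x.hd.size ≤ x.size := by
  cases x <;> simp [Data.hd]; omega

theorem Data.size_tl_le (x : Data) : x.tl.size ≤ x.size := by
  cases x <;> simp [Data.tl]; omega

theorem Data.length_toList_le (x : Data) : x.toList.length ≤ x.size := by
  induction x with
  | nil => simp [Data.toList]
  | node a l _ ih => simp [Data.toList]; omega

theorem Data.size_le_of_mem {x e : Data} (h : e ∈ x.toList) : e.size ≤ x.size := by
  induction x with
  | nil => simp [Data.toList] at h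
  | node a l _ ih =>
    simp only [Data.toList, List.mem_cons] at h
    rcases h with rfl | h
    · simp; omega
    · have := ih h; simp; omega

/-- The exponent may depend on `K`: this is data complexity. The base is at least 2, so constants,
sums and products are absorbed by a larger exponent. -/
def PolyBd (κ : Data → ℕ) (g : Data → ℕ) : Prop :=
  ∀ K, ∃ k, ∀ x, κ x ≤ K → g x ≤ (x.size + 2) ^ k

section PolyBd

variable {κ κ' : Data → ℕ} {f g : Data → ℕ}

theorem PolyBd.mono (hg : PolyBd κ g) (h : ∀ x, f x ≤ g x) : PolyBd κ f := by
  intro K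
  obtain ⟨k, hk⟩ := hg K
  exact ⟨k, fun x hx => (h x).trans (hk x hx)⟩

theorem PolyBd.const (κ : Data → ℕ) (c : ℕ) : PolyBd κ fun _ => c := by
  refine fun _ => ⟨c, fun x _ => ?_⟩
  exact Nat.lt_two_pow_self.le.trans (Nat.pow_le_pow_left (by omega) _)

theorem PolyBd.size (κ : Data → ℕ) : PolyBd κ Data.size :=
  fun _ => ⟨1, fun x _ => by simp⟩

theorem PolyBd.add (hf : PolyBd κ f) (hg : PolyBd κ g) : PolyBd κ fun x => f x + g x := by
  intro K
  obtain ⟨a, ha⟩ := hf K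
  obtain ⟨b, hb⟩ := hg K
  refine ⟨a + b + 1, fun x hx => ?_⟩
  have h1 : (x.size + 2) ^ a ≤ (x.size + 2) ^ (a + b) :=
    Nat.pow_le_pow_right (by omega) (by omega)
  have h2 : (x.size + 2) ^ b ≤ (x.size + 2) ^ (a + b) :=
    Nat.pow_le_pow_right (by omega) (by omega)
  have h3 := ha x hx
  have h4 := hb x hx
  rw [pow_succ]
  nlinarith

theorem PolyBd.mul (hf : PolyBd κ f) (hg : PolyBd κ g) : PolyBd κ fun x => f x * g x := by
  intro K
  obtain ⟨a, ha⟩ := hf K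
  obtain ⟨b, hb⟩ := hg K
  refine ⟨a + b, fun x hx => ?_⟩
  rw [pow_add]
  exact Nat.mul_le_mul (ha x hx) (hb x hx)

theorem PolyBd.pow (hf : PolyBd κ f) (d : ℕ) : PolyBd κ fun x => f x ^ d := by
  induction d with
  | zero => simpa using PolyBd.const κ 1
  | succ d ih => simpa only [pow_succ] using ih.mul hf

theorem PolyBd.size_pow (κ : Data → ℕ) (d : ℕ) : PolyBd κ fun x => (x.size + 2) ^ d :=
  ((PolyBd.size κ).add (.const _ 2)).pow d

theorem pow_add_two_pow_le (n a b : ℕ) : ((n + 2) ^ a + 2) ^ b ≤ (n + 2) ^ ((a + 2) * b) := by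
  rw [pow_mul]
  refine Nat.pow_le_pow_left ?_ _
  have h : 1 ≤ (n + 2) ^ a := Nat.one_le_pow _ _ (by omega)
  rw [pow_add]
  nlinarith [Nat.zero_le n, Nat.zero_le (n * (n + 2) ^ a)]

theorem PolyBd.comp {F : Data → Data} (hg : PolyBd κ' g) (hF : PolyBd κ fun x => (F x).size)
    (hκ : ∀ K, ∃ K', ∀ x, κ x ≤ K → κ' (F x) ≤ K') : PolyBd κ fun x => g (F x) := by
  intro K
  obtain ⟨K', hK'⟩ := hκ K
  obtain ⟨a, ha⟩ := hF K
  obtain ⟨b, hb⟩ := hg K'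
  refine ⟨(a + 2) * b, fun x hx => (hb _ (hK' x hx)).trans ?_⟩
  exact (Nat.pow_le_pow_left (Nat.add_le_add_right (ha x hx) 2) _).trans
    (pow_add_two_pow_le _ a b)

end PolyBd

/-- The program halts on all inputs; only the growth of the bounds is conditional on `κ`. The size
of the output is bounded too because it enters the cost of a composition. -/
def Feasible (κ : Data → ℕ) (f : Data → Data) : Prop :=
  ∃ (p : Prog) (b : Data → ℕ), (∀ x, ∃ n ≤ b x, Run p x (f x) n) ∧ PolyBd κ b ∧
    PolyBd κ fun x => (f x).size

abbrev PolyTime (f : Data → Data) : Prop := Feasible (fun _ => 0) f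

namespace Feasible

variable {κ κ' : Data → ℕ} {f g h : Data → Data}

theorem id : Feasible κ fun x => x :=
  ⟨.arg, fun _ => 1, fun x => ⟨1, le_refl _, .arg x⟩, .const _ _, .size _⟩

theorem nil : Feasible κ fun _ => .nil :=
  ⟨.nil, fun _ => 1, fun x => ⟨1, le_refl _, .nil x⟩, .const _ _, .const _ _⟩

theorem node (hf : Feasible κ f) (hg : Feasible κ g) : Feasible κ fun x => .node (f x) (g x) := by
  obtain ⟨p, b, hp, hb, hs⟩ := hf
  obtain ⟨q, c, hq, hc, ht⟩ := hg
  refine ⟨.cons p q, fun x => b x + c x + 1, fun x => ?_, (hb.add hc).add (.const _ _),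
    (hs.add ht).add (.const _ _)⟩
  obtain ⟨m, hm, h1⟩ := hp x
  obtain ⟨n, hn, h2⟩ := hq x
  exact ⟨m + n + 1, by dsimp only; omega, .cons h1 h2⟩

theorem hd (hf : Feasible κ f) : Feasible κ fun x => (f x).hd := by
  obtain ⟨p, b, hp, hb, hs⟩ := hf
  refine ⟨.hd p, fun x => b x + 1, fun x => ?_, hb.add (.const _ _),
    hs.mono fun x => Data.size_hd_le _⟩
  obtain ⟨m, hm, h1⟩ := hp x
  exact ⟨m + 1, by dsimp only; omega, .hd h1⟩

theorem tl (hf : Feasible κ f) : Feasible κ fun x => (f x).tl := by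
  obtain ⟨p, b, hp, hb, hs⟩ := hf
  refine ⟨.tl p, fun x => b x + 1, fun x => ?_, hb.add (.const _ _),
    hs.mono fun x => Data.size_tl_le _⟩
  obtain ⟨m, hm, h1⟩ := hp x
  exact ⟨m + 1, by dsimp only; omega, .tl h1⟩

theorem ite (hf : Feasible κ f) (hg : Feasible κ g) (hh : Feasible κ h) :
    Feasible κ fun x => Data.ite (f x) (g x) (h x) := by
  obtain ⟨p, b, hp, hb, hs⟩ := hf
  obtain ⟨q, c, hq, hc, ht⟩ := hg
  obtain ⟨r, d, hr, hd, hu⟩ := hh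
  refine ⟨.ite p q r, fun x => b x + (c x + d x) + 1, fun x => ?_,
    (hb.add (hc.add hd)).add (.const _ _), (ht.add hu).mono fun x => ?_⟩
  · obtain ⟨m, hm, h1⟩ := hp x
    obtain ⟨n, hn, h2⟩ := hq x
    obtain ⟨k, hk, h3⟩ := hr x
    dsimp only
    cases hc : f x with
    | nil => exact ⟨m + k + 1, by omega, .iteElse (hc ▸ h1) h3⟩
    | node u v => exact ⟨m + n + 1, by omega, .iteThen (hc ▸ h1) h2⟩
  · dsimp only
    cases f x <;> simp

theorem comp (hg : Feasible κ' g) (hf : Feasible κ f)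
    (hκ : ∀ K, ∃ K', ∀ x, κ x ≤ K → κ' (f x) ≤ K') : Feasible κ fun x => g (f x) := by
  obtain ⟨p, b, hp, hb, hs⟩ := hf
  obtain ⟨q, c, hq, hc, ht⟩ := hg
  refine ⟨.call q p, fun x => b x + c (f x) + 1, fun x => ?_,
    (hb.add (hc.comp hs hκ)).add (.const _ _), ht.comp hs hκ⟩
  obtain ⟨m, hm, h1⟩ := hp x
  obtain ⟨n, hn, h2⟩ := hq (f x)
  exact ⟨m + n + 1, by dsimp only; omega, .call h1 h2⟩

end Feasible

namespace PolyTime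

variable {κ : Data → ℕ} {g h k : Data → Data}

theorem comp₁ {f : Data → Data} (hf : PolyTime f) (hg : Feasible κ g) :
    Feasible κ fun x => f (g x) :=
  Feasible.comp hf hg fun _ => ⟨0, fun _ _ => le_refl _⟩

theorem comp₂ {f : Data → Data → Data} (hf : PolyTime fun z => f z.hd z.tl) (hg : Feasible κ g)
    (hh : Feasible κ h) : Feasible κ fun x => f (g x) (h x) :=
  PolyTime.comp₁ hf (hg.node hh)

theorem comp₃ {f : Data → Data → Data → Data} (hf : PolyTime fun z => f z.hd z.tl.hd z.tl.tl)
    (hg : Feasible κ g) (hh : Feasible κ h) (hk : Feasible κ k) :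
    Feasible κ fun x => f (g x) (h x) (k x) :=
  PolyTime.comp₁ hf (hg.node (hh.node hk))

end PolyTime

/-! ### Recursion over lists -/

def Data.ofList : List Data → Data
  | [] => .nil
  | a :: l => .node a (Data.ofList l)

theorem Data.ofList_toList (x : Data) : Data.ofList x.toList = x := by
  induction x with
  | nil => rfl
  | node a l _ ih => simp [Data.toList, Data.ofList, ih]

/-- A fold from the right needs the last entry first, while a list can be read only from the front.
-/
def Prog.reverse : Prog :=
  .call (.tl .arg) (.call
    (.loop (.hd .arg) (.cons (.tl (.hd .arg)) (.cons (.hd (.hd .arg)) (.tl .arg))))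
    (.cons .arg .nil))

theorem run_reverse_loop (l : List Data) (r : Data) : ∃ n ≤ 14 * l.length + 3,
    Run (.loop (.hd .arg) (.cons (.tl (.hd .arg)) (.cons (.hd (.hd .arg)) (.tl .arg))))
      (.node (.ofList l) r) (.node .nil (.ofList (l.reverse ++ r.toList))) n := by
  induction l generalizing r with
  | nil =>
    have : Run (.hd .arg) (.node .nil r) .nil 2 := .hd (.arg _)
    refine ⟨3, by simp, ?_⟩
    simp only [List.reverse_nil, List.nil_append, Data.ofList_toList]
    exact .loopDone this
  | cons a l ih =>
    obtain ⟨n, hn, h⟩ := ih (.node a r)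
    have hc : Run (.hd .arg) (.node (.ofList (a :: l)) r) (.ofList (a :: l)) 2 := .hd (.arg _)
    have hb : Run (.cons (.tl (.hd .arg)) (.cons (.hd (.hd .arg)) (.tl .arg)))
        (.node (.ofList (a :: l)) r) (.node (.ofList l) (.node a r)) (3 + (3 + 2 + 1) + 1) :=
      .cons (.tl (.hd (.arg _))) (.cons (.hd (.hd (.arg _))) (.tl (.arg _)))
    rw [show l.reverse ++ (Data.node a r).toList = (a :: l).reverse ++ r.toList by
      simp [Data.toList]] at h
    exact ⟨_, by simp only [List.length_cons]; omega, .loopStep hc hb h⟩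

theorem run_reverse (x : Data) : ∃ n ≤ 14 * x.size + 20,
    Run .reverse x (.ofList x.toList.reverse) n := by
  obtain ⟨n, hn, h⟩ := run_reverse_loop x.toList .nil
  rw [Data.ofList_toList, Data.toList, List.append_nil] at h
  have h0 : Run (.cons .arg .nil) x (.node x .nil) (1 + 1 + 1) := .cons (.arg _) (.nil _)
  refine ⟨_, ?_, .call (.call h0 h) (.tl (.arg _))⟩
  have := x.length_toList_le
  omega

/-- The loop that folds the program `B` over a reversed list. -/
def Prog.foldLoop (B : Prog) : Prog :=
  .loop (.hd .arg) (.cons (.tl (.hd .arg))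
    (.cons (.call B (.cons (.hd (.hd .arg)) (.tl .arg))) (.tl (.tl .arg))))

def Prog.fold (L I B : Prog) : Prog :=
  .call (.hd (.tl .arg)) (.call (.foldLoop B) (.cons (.call .reverse L) (.cons I .arg)))

def foldCost (b : Data → ℕ) (f : Data → Data → Data) (z x : Data) : List Data → ℕ
  | [] => 0
  | e :: l => foldCost b f z x l + b (.node e (.node (l.foldr f z) x)) + 20

/-- The run is extended backwards: from a run that starts once `l` has been processed, with `r`
still to be read, to one that starts before `l`. Each induction step prepends one iteration. -/
theorem run_foldLoop {B : Prog} {b : Data → ℕ} {f : Data → Data → Data} {x : Data}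
    (hB : ∀ e acc, ∃ n ≤ b (.node e (.node acc x)), Run B (.node e (.node acc x)) (f e acc) n)
    (z : Data) (l : List Data) (r : List Data) (y : Data) (n : ℕ)
    (h : Run (.foldLoop B) (.node (.ofList r) (.node (l.foldr f z) x)) y n) :
    ∃ m ≤ n + foldCost b f z x l,
      Run (.foldLoop B) (.node (.ofList (l.reverse ++ r)) (.node z x)) y m := by
  induction l generalizing r n with
  | nil => exact ⟨n, by simp [foldCost], h⟩
  | cons e l ih =>
    obtain ⟨k, hk, hr⟩ := hB e (l.foldr f z)
    set s : Data := .node (.ofList (e :: r)) (.node (l.foldr f z) x) with hs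
    have hc : Run (.hd .arg) s (.ofList (e :: r)) 2 := .hd (.arg _)
    have ha : Run (.cons (.hd (.hd .arg)) (.tl .arg)) s (.node e (.node (l.foldr f z) x))
        _ := .cons (.hd (.hd (.arg _))) (.tl (.arg _))
    have hb : Run (.cons (.tl (.hd .arg))
        (.cons (.call B (.cons (.hd (.hd .arg)) (.tl .arg))) (.tl (.tl .arg)))) s
        (.node (.ofList r) (.node (f e (l.foldr f z)) x)) _ :=
      .cons (.tl (.hd (.arg _))) (.cons (.call ha hr) (.tl (.tl (.arg _))))
    obtain ⟨m, hm, hfin⟩ := ih (e :: r) _ (.loopStep hc hb h)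
    refine ⟨m, ?_, by simpa using hfin⟩
    simp only [foldCost]
    omega

theorem foldCost_le {b : Data → ℕ} {f : Data → Data → Data} {z x : Data} {M : ℕ}
    {l : List Data} (h : ∀ e l', e :: l' <:+ l → b (.node e (.node (l'.foldr f z) x)) ≤ M) :
    foldCost b f z x l ≤ l.length * (M + 20) := by
  induction l with
  | nil => simp [foldCost]
  | cons e l ih =>
    have h1 := h e l (List.suffix_refl _)
    have h2 := ih fun e' l' hl => h e' l' (hl.trans (List.suffix_cons e l))
    simp only [foldCost, List.length_cons]
    nlinarith

/-- The hypothesis `hacc` on the intermediate accumulators is essential, since polynomial growth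
repeated along the input need not stay polynomial. `Feasible.iterate` and
`Feasible.foldr_of_additive` are two ways to guarantee it. -/
theorem Feasible.foldr {κ κ' : Data → ℕ} {L I : Data → Data} {B : Data → Data → Data → Data}
    (hL : Feasible κ L) (hI : Feasible κ I)
    (hB : Feasible κ' fun z => B z.hd z.tl.hd z.tl.tl)
    (hκ : ∀ K, ∃ K', ∀ x, κ x ≤ K → ∀ e ∈ (L x).toList, ∀ acc, κ' (.node e (.node acc x)) ≤ K')
    (hacc : ∀ K, ∃ k, ∀ x, κ x ≤ K → ∀ l, l <:+ (L x).toList →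
      (l.foldr (fun e acc => B e acc x) (I x)).size ≤ (x.size + 2) ^ k) :
    Feasible κ fun x => (L x).toList.foldr (fun e acc => B e acc x) (I x) := by
  obtain ⟨pL, bL, hpL, hbL, hsL⟩ := hL
  obtain ⟨pI, bI, hpI, hbI, hsI⟩ := hI
  obtain ⟨pB, bB, hpB, hbB, hsB⟩ := hB
  have hcost : PolyBd κ fun x =>
      foldCost bB (fun e acc => B e acc x) (I x) x (L x).toList := by
    intro K
    obtain ⟨K', hK'⟩ := hκ K
    obtain ⟨a, ha⟩ := hacc K
    obtain ⟨c, hc⟩ := hsL K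
    obtain ⟨d, hd⟩ := hbB K'
    have hbound : PolyBd κ fun x => (x.size + 2) ^ c *
        ((((x.size + 2) ^ c + ((x.size + 2) ^ a + x.size + 1) + 1) + 2) ^ d + 20) := by
      have hn := PolyBd.size_pow κ
      exact (hn c).mul ((((((hn c).add (((hn a).add (.size _)).add (.const _ _))).add
        (.const _ _)).add (.const _ _)).pow d).add (.const _ _))
    obtain ⟨k, hk⟩ := hbound K
    refine ⟨k, fun x hx => le_trans ?_ (hk x hx)⟩
    have hLs : (L x).size ≤ _ := hc x hx
    refine (foldCost_le (M := (((x.size + 2) ^ c + ((x.size + 2) ^ a + x.size + 1) + 1) + 2) ^ d)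
      fun e l' hl => ?_).trans ?_
    · have he : e ∈ (L x).toList := hl.subset (by simp)
      have h1 := Data.size_le_of_mem he
      have h2 := ha x hx l' ((List.suffix_cons e l').trans hl)
      refine (hd _ (hK' x hx e he _)).trans (Nat.pow_le_pow_left ?_ _)
      simp only [Data.size_node]
      omega
    · exact Nat.mul_le_mul_right _ ((Data.length_toList_le _).trans hLs)
  refine ⟨.fold pL pI pB, fun x => bL x + bI x + 14 * (L x).size +
    foldCost bB (fun e acc => B e acc x) (I x) x (L x).toList + 40, fun x => ?_,
    ((((hbL.add hbI).add ((PolyBd.const _ 14).mul hsL)).add hcost).add (.const _ _)), ?_⟩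
  · obtain ⟨n1, hn1, h1⟩ := hpL x
    obtain ⟨n2, hn2, h2⟩ := hpI x
    obtain ⟨n3, hn3, h3⟩ := run_reverse (L x)
    have hend : Run (.foldLoop pB) (.node (.ofList [])
        (.node ((L x).toList.foldr (fun e acc => B e acc x) (I x)) x))
        (.node .nil (.node ((L x).toList.foldr (fun e acc => B e acc x) (I x)) x)) 3 :=
      .loopDone (.hd (.arg _))
    obtain ⟨m, hm, hr⟩ := run_foldLoop (f := fun e acc => B e acc x) (b := bB)
      (fun e acc => hpB (.node e (.node acc x))) (I x) (L x).toList [] _ _ hend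
    rw [List.append_nil] at hr
    refine ⟨_, ?_, .call (.call (.cons (.call h1 h3) (.cons h2 (.arg x))) hr)
      (.hd (.tl (.arg _)))⟩
    dsimp only
    omega
  · intro K
    obtain ⟨k, hk⟩ := hacc K
    exact ⟨k, fun x hx => hk x hx _ (List.suffix_refl _)⟩

/-- Iteration along a list whose length is bounded in terms of the parameter. -/
theorem Feasible.iterate {κ κ' : Data → ℕ} {L I : Data → Data} {B : Data → Data → Data → Data}
    (hL : Feasible κ L) (hI : Feasible κ I)
    (hB : Feasible κ' fun z => B z.hd z.tl.hd z.tl.tl)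
    (hκ : ∀ K, ∃ K', ∀ x, κ x ≤ K → ∀ e ∈ (L x).toList, ∀ acc, κ' (.node e (.node acc x)) ≤ K')
    (hlen : ∀ K, ∃ N, ∀ x, κ x ≤ K → (L x).toList.length ≤ N) :
    Feasible κ fun x => (L x).toList.foldr (fun e acc => B e acc x) (I x) := by
  refine Feasible.foldr hL hI hB hκ fun K => ?_
  obtain ⟨N, hN⟩ := hlen K
  obtain ⟨K', hK'⟩ := hκ K
  obtain ⟨c, hc⟩ := hL.choose_spec.choose_spec.2.2 K
  obtain ⟨d, hd⟩ := hI.choose_spec.choose_spec.2.2 K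
  obtain ⟨j, hj⟩ := hB.choose_spec.choose_spec.2.2 K'
  -- The exponent grows with the number `n` of iterations, which is harmless because `n` never
  -- exceeds `N`.
  have key : ∀ n, ∃ k, ∀ x, κ x ≤ K → ∀ l, l <:+ (L x).toList → l.length ≤ n →
      (l.foldr (fun e acc => B e acc x) (I x)).size ≤ (x.size + 2) ^ k := by
    intro n
    induction n with
    | zero =>
      refine ⟨d, fun x hx l _ hl => ?_⟩
      obtain rfl := List.length_eq_zero_iff.1 (Nat.le_zero.1 hl)
      exact hd x hx
    | succ n ih =>
      obtain ⟨k, hk⟩ := ih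
      obtain ⟨r, hr⟩ : ∃ r, ∀ s : ℕ, (s + 2) ^ c + ((s + 2) ^ k + s + 1) + 1 ≤ (s + 2) ^ r := by
        have hn := PolyBd.size_pow (fun _ => 0)
        obtain ⟨r, hr⟩ := ((hn c).add (((hn k).add (.size _)).add (.const _ 1))).add
          (PolyBd.const _ 1) 0
        refine ⟨r, fun s => ?_⟩
        -- Every number is the size of a tree, so the calculus of `PolyBd` also yields inequalities
        -- between numbers.
        have hsz : ∃ x : Data, x.size = s := by
          induction s with
          | zero => exact ⟨.nil, rfl⟩
          | succ s ih => obtain ⟨x, rfl⟩ := ih; exact ⟨.node .nil x, by simp⟩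
        obtain ⟨x, rfl⟩ := hsz
        exact hr x (le_refl _)
      refine ⟨max d ((r + 2) * j), fun x hx l hl hlen => ?_⟩
      cases l with
      | nil =>
        exact (hd x hx).trans (Nat.pow_le_pow_right (by omega) (le_max_left _ _))
      | cons e l =>
        have h1 := hk x hx l ((List.suffix_cons e l).trans hl) (by simpa using hlen)
        have he : e ∈ (L x).toList := hl.subset List.mem_cons_self
        have h2 := (Data.size_le_of_mem he).trans (hc x hx)
        have h3 := hj (.node e (.node (l.foldr (fun e acc => B e acc x) (I x)) x))
          (hK' x hx e he _)
        refine le_trans h3 (le_trans (Nat.pow_le_pow_left (m := (x.size + 2) ^ r + 2) ?_ _)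
          ((pow_add_two_pow_le _ _ _).trans
            (Nat.pow_le_pow_right (by omega) (le_max_right _ _))))
        have := hr x.size
        simp only [Data.size_node]
        omega
  obtain ⟨k, hk⟩ := key N
  refine ⟨k, fun x hx l hl => hk x hx l hl ((hl.length_le).trans (hN x hx))⟩

/-- Recursion over a list in which every step adds a polynomially bounded amount. -/
theorem Feasible.foldr_of_additive {κ κ' : Data → ℕ} {L I : Data → Data}
    {B : Data → Data → Data → Data} {G : Data → Data → Data}
    (hL : Feasible κ L) (hI : Feasible κ I)
    (hB : Feasible κ' fun z => B z.hd z.tl.hd z.tl.tl)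
    (hκ : ∀ K, ∃ K', ∀ x, κ x ≤ K → ∀ e ∈ (L x).toList, ∀ acc, κ' (.node e (.node acc x)) ≤ K')
    (hG : Feasible κ' fun z => G z.hd z.tl.tl)
    (hsize : ∀ e acc x, (B e acc x).size ≤ acc.size + (G e x).size) :
    Feasible κ fun x => (L x).toList.foldr (fun e acc => B e acc x) (I x) := by
  refine Feasible.foldr hL hI hB hκ fun K => ?_
  obtain ⟨K', hK'⟩ := hκ K
  obtain ⟨c, hc⟩ := hL.choose_spec.choose_spec.2.2 K
  obtain ⟨d, hd⟩ := hI.choose_spec.choose_spec.2.2 K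
  obtain ⟨j, hj⟩ := hG.choose_spec.choose_spec.2.2 K'
  have hn := PolyBd.size_pow κ
  have hbase : PolyBd κ fun x => (((x.size + 2) ^ c + (x.size + 1) + 1) + 2) ^ j :=
    ((((hn c).add ((PolyBd.size _).add (.const _ _))).add (.const _ _)).add (.const _ _)).pow j
  obtain ⟨k, hk⟩ := ((hn d).add ((hn c).mul hbase)) K
  refine ⟨k, fun x hx l hl => le_trans ?_ (hk x hx)⟩
  have hlen : l.length ≤ (x.size + 2) ^ c :=
    hl.length_le.trans ((Data.length_toList_le _).trans (hc x hx))
  have main : ∀ l, l <:+ (L x).toList → (l.foldr (fun e acc => B e acc x) (I x)).size ≤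
      (x.size + 2) ^ d + l.length * (((x.size + 2) ^ c + (x.size + 1) + 1) + 2) ^ j := by
    intro l hl
    induction l with
    | nil => simpa using hd x hx
    | cons e l ih =>
      have h1 := ih ((List.suffix_cons e l).trans hl)
      have he : e ∈ (L x).toList := hl.subset List.mem_cons_self
      have h2 := (Data.size_le_of_mem he).trans (hc x hx)
      have h3 := hj (.node e (.node .nil x)) (hK' x hx e he _)
      have h4 : (G e x).size ≤ (((x.size + 2) ^ c + (x.size + 1) + 1) + 2) ^ j := by
        refine h3.trans (Nat.pow_le_pow_left ?_ _)
        simp only [Data.size_node, Data.size_nil]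
        omega
      have h5 := hsize e (l.foldr (fun e acc => B e acc x) (I x)) x
      simp only [List.foldr_cons, List.length_cons]
      rw [Nat.succ_mul]
      omega
  exact (main l hl).trans (Nat.add_le_add_left (Nat.mul_le_mul_right _ hlen) _)

def Data.append (a b : Data) : Data := a.toList.foldr .node b

/-- The concatenation of the lists `g e`, for the entries `e` of a list, and of `z`. -/
def Data.flatMap (g : Data → Data) (z d : Data) : Data :=
  d.toList.foldr (fun e acc => (g e).append acc) z

/-- The value of `v` at the first entry of a list that satisfies `c`, or else `z`. -/
def Data.first (c v : Data → Data) (z d : Data) : Data :=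
  d.toList.foldr (fun e acc => Data.ite (c e) (v e) acc) z

theorem Data.size_append_le (a b : Data) : (a.append b).size ≤ b.size + a.size := by
  induction a with
  | nil => simp [Data.append, Data.toList]
  | node e l _ ih =>
    simp only [Data.append, Data.toList, List.foldr_cons, Data.size_node] at ih ⊢
    omega

theorem PolyTime.append : PolyTime fun z => z.hd.append z.tl :=
  Feasible.foldr_of_additive (B := fun e acc _ => .node e acc)
    (G := fun e _ => .node e .nil) (κ' := fun _ => 0) Feasible.id.hd Feasible.id.tl
    (Feasible.id.hd.node Feasible.id.tl.hd) (fun _ => ⟨0, fun _ _ _ _ _ => le_refl _⟩)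
    (Feasible.id.hd.node .nil) (fun e acc x => by simp; omega)

theorem Feasible.flatMap {κ : Data → ℕ} {L I : Data → Data} {G : Data → Data → Data}
    (hG : PolyTime fun z => G z.hd z.tl) (hI : Feasible κ I) (hL : Feasible κ L) :
    Feasible κ fun x => Data.flatMap (fun e => G e x) (I x) (L x) :=
  have hG' : PolyTime fun z => G z.hd z.tl.tl := PolyTime.comp₂ hG Feasible.id.hd Feasible.id.tl.tl
  Feasible.foldr_of_additive (B := fun e acc x => (G e x).append acc) hL hI
    (PolyTime.comp₂ PolyTime.append hG' Feasible.id.tl.hd)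
    (fun _ => ⟨0, fun _ _ _ _ _ => le_refl _⟩) hG' (fun _ _ _ => Data.size_append_le _ _)

theorem Feasible.first {κ κ' : Data → ℕ} {L I : Data → Data} {C G : Data → Data → Data}
    (hC : Feasible κ' fun z => C z.hd z.tl) (hG : Feasible κ' fun z => G z.hd z.tl)
    (hI : Feasible κ I) (hL : Feasible κ L)
    (hκ : ∀ K, ∃ K', ∀ x, κ x ≤ K → ∀ e ∈ (L x).toList, κ' (.node e x) ≤ K') :
    Feasible κ fun x => Data.first (fun e => C e x) (fun e => G e x) (I x) (L x) := by
  have hz : ∀ K, ∃ K', ∀ z : Data, κ' (.node z.hd z.tl.tl) ≤ K →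
      κ' (Data.node z.hd z.tl.tl) ≤ K' := fun K => ⟨K, fun _ h => h⟩
  have hC' : Feasible (fun z => κ' (.node z.hd z.tl.tl)) fun z => C z.hd z.tl.tl :=
    Feasible.comp (f := fun z => .node z.hd z.tl.tl) hC
      (Feasible.id.hd.node Feasible.id.tl.tl) hz
  have hG' : Feasible (fun z => κ' (.node z.hd z.tl.tl)) fun z => G z.hd z.tl.tl :=
    Feasible.comp (f := fun z => .node z.hd z.tl.tl) hG
      (Feasible.id.hd.node Feasible.id.tl.tl) hz
  refine Feasible.foldr_of_additive (B := fun e acc x => Data.ite (C e x) (G e x) acc) hL hI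
    (hC'.ite hG' Feasible.id.tl.hd) (fun K => ?_) hG' (fun e acc x => ?_)
  · obtain ⟨K', hK'⟩ := hκ K
    exact ⟨K', fun x hx e he acc => hK' x hx e he⟩
  · cases C e x <;> simp

theorem PolyTime.first {κ : Data → ℕ} {L I : Data → Data} {C G : Data → Data → Data}
    (hC : PolyTime fun z => C z.hd z.tl) (hG : PolyTime fun z => G z.hd z.tl)
    (hI : Feasible κ I) (hL : Feasible κ L) :
    Feasible κ fun x => Data.first (fun e => C e x) (fun e => G e x) (I x) (L x) :=
  Feasible.first hC hG hI hL fun _ => ⟨0, fun _ _ _ _ => le_refl _⟩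

/-! ### Comparison of trees -/

/-- `nil` if the trees are equal, and otherwise a tree whose head is `nil` iff the first one comes
first in the lexicographic order. -/
def Data.cmp : Data → Data → Data
  | .nil, .nil => .nil
  | .nil, .node _ _ => .node .nil .nil
  | .node _ _, .nil => .node (.node .nil .nil) .nil
  | .node a b, .node c d => Data.ite (Data.cmp a c) (Data.cmp a c) (Data.cmp b d)

/-- The recursion becomes a stack of pairs still to be compared, held in the head of the state. The
first difference empties the stack and leaves the verdict in the tail. -/
def Prog.cmpBody : Prog :=
  let x : Prog := .hd (.hd (.hd .arg))
  let y : Prog := .tl (.hd (.hd .arg))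
  let rest : Prog := .tl (.hd .arg)
  .ite x
    (.ite y
      (.cons (.cons (.cons (.hd x) (.hd y)) (.cons (.cons (.tl x) (.tl y)) rest)) .nil)
      (.cons .nil (.cons (.cons .nil .nil) .nil)))
    (.ite y (.cons .nil (.cons .nil .nil)) (.cons rest .nil))

def Prog.cmp : Prog :=
  .call (.tl .arg) (.call (.loop (.hd .arg) .cmpBody) (.cons (.cons .arg .nil) .nil))

/-- The run on `rest` is a continuation, used only when the two trees agree. Here `2 * x.size + 1`
counts the inner nodes and leaves of `x`, each compared at most once. -/
theorem run_cmp_loop (x y rest z : Data) (n : ℕ)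
    (h : Run (.loop (.hd .arg) .cmpBody) (.node rest .nil) z n) :
    ∃ m ≤ n + 50 * (2 * x.size + 1), Run (.loop (.hd .arg) .cmpBody)
      (.node (.node (.node x y) rest) .nil)
      (Data.ite (x.cmp y) (.node .nil (x.cmp y)) z) m := by
  have halted : ∀ r, Run (.loop (.hd .arg) .cmpBody) (.node .nil r) (.node .nil r) 3 :=
    fun r => .loopDone (.hd (.arg _))
  induction x generalizing y rest z n with
  | nil =>
    set s : Data := .node (.node (.node .nil y) rest) .nil with hs
    have hc : Run (.hd .arg) s (.node (.node .nil y) rest) 2 := .hd (.arg _)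
    have hx : Run (.hd (.hd (.hd .arg))) s .nil 4 := .hd (.hd (.hd (.arg _)))
    have hy : Run (.tl (.hd (.hd .arg))) s y 4 := .tl (.hd (.hd (.arg _)))
    have hr : Run (.tl (.hd .arg)) s rest 3 := .tl (.hd (.arg _))
    cases y with
    | nil =>
      exact ⟨_, by simp only [Data.size_nil]; omega, .loopStep hc
        (.iteElse hx (.iteElse hy (.cons hr (.nil _)))) h⟩
    | node u v =>
      exact ⟨_, by simp only [Data.size_nil]; omega, .loopStep hc (.iteElse hx (.iteThen hy
        (.cons (.nil _) (.cons (.nil _) (.nil _))))) (halted _)⟩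
  | node a b iha ihb =>
    set s : Data := .node (.node (.node (.node a b) y) rest) .nil with hs
    have hc : Run (.hd .arg) s (.node (.node (.node a b) y) rest) 2 := .hd (.arg _)
    have hx : Run (.hd (.hd (.hd .arg))) s (.node a b) 4 := .hd (.hd (.hd (.arg _)))
    have hy : Run (.tl (.hd (.hd .arg))) s y 4 := .tl (.hd (.hd (.arg _)))
    have hr : Run (.tl (.hd .arg)) s rest 3 := .tl (.hd (.arg _))
    cases y with
    | nil =>
      exact ⟨_, by simp only [Data.size_node]; omega, .loopStep hc (.iteThen hx (.iteElse hy
        (.cons (.nil _) (.cons (.cons (.nil _) (.nil _)) (.nil _))))) (halted _)⟩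
    | node u v =>
      obtain ⟨m1, hm1, h1⟩ := ihb v rest z n h
      obtain ⟨m2, hm2, h2⟩ := iha u (.node (.node b v) rest) _ m1 h1
      have hres : Data.ite (a.cmp u) (.node .nil (a.cmp u))
          (Data.ite (b.cmp v) (.node .nil (b.cmp v)) z) =
          Data.ite ((Data.node a b).cmp (.node u v))
            (.node .nil ((Data.node a b).cmp (.node u v))) z := by
        simp only [Data.cmp]
        cases a.cmp u <;> simp
      rw [hres] at h2
      refine ⟨_, ?_, .loopStep hc (.iteThen hx (.iteThen hy (.cons (.cons
        (.cons (.hd hx) (.hd hy)) (.cons (.cons (.tl hx) (.tl hy)) hr)) (.nil _)))) h2⟩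
      simp only [Data.size_node]
      omega

theorem Data.size_cmp_le (x y : Data) : (x.cmp y).size ≤ 2 := by
  induction x generalizing y with
  | nil => cases y <;> simp [Data.cmp]
  | node a b iha ihb =>
    cases y with
    | nil => simp [Data.cmp]
    | node c d =>
      simp only [Data.cmp]
      have h1 := iha c
      have h2 := ihb d
      cases h : a.cmp c with
      | nil => simpa using h2
      | node u v => rw [h] at h1; simpa using h1

theorem PolyTime.cmp : PolyTime fun z => z.hd.cmp z.tl := by
  refine ⟨.call .cmp (.cons (.hd .arg) (.tl .arg)), fun z => 100 * z.size + 100, fun z => ?_,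
    ((PolyBd.const _ _).mul (.size _)).add (.const _ _),
    (PolyBd.const _ 2).mono fun z => Data.size_cmp_le _ _⟩
  have hend : Run (.loop (.hd .arg) .cmpBody) (.node .nil .nil) (.node .nil .nil) 3 :=
    .loopDone (.hd (.arg _))
  obtain ⟨m, hm, h⟩ := run_cmp_loop z.hd z.tl .nil _ 3 hend
  have hres : z.hd.cmp z.tl = (Data.ite (z.hd.cmp z.tl) (.node .nil (z.hd.cmp z.tl))
      (.node .nil .nil)).tl := by
    cases z.hd.cmp z.tl <;> rfl
  have h0 : Run (.cons (.cons .arg .nil) .nil) (.node z.hd z.tl)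
    (.node (.node (.node z.hd z.tl) .nil) .nil) _ :=
    .cons (.cons (.arg _) (.nil _)) (.nil _)
  have h1 : Run (.cons (.hd .arg) (.tl .arg)) z (.node z.hd z.tl) (2 + 2 + 1) :=
    .cons (.hd (.arg _)) (.tl (.arg _))
  dsimp only
  rw [hres]
  refine ⟨_, ?_, .call h1 (.call (.call h0 h) (.tl (.arg _)))⟩
  have := z.size_hd_le
  omega

theorem Data.cmp_eq_nil_iff (x y : Data) : x.cmp y = .nil ↔ x = y := by
  induction x generalizing y with
  | nil => cases y <;> simp [Data.cmp]
  | node a b iha ihb =>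
    cases y with
    | nil => simp [Data.cmp]
    | node c d =>
      simp only [Data.cmp, Data.node.injEq, ← iha c, ← ihb d]
      cases h : a.cmp c <;> simp

/-- `node nil nil` if the trees are equal, and `nil` otherwise. -/
def Data.eq (x y : Data) : Data := Data.ite (x.cmp y) .nil (.node .nil .nil)

theorem Data.eq_self (x : Data) : Data.eq x x = .node .nil .nil := by
  rw [Data.eq, (Data.cmp_eq_nil_iff x x).2 rfl]; rfl

theorem Data.eq_of_ne {x y : Data} (h : x ≠ y) : Data.eq x y = .nil := by
  rw [Data.eq]
  cases hc : x.cmp y with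
  | nil => exact absurd ((Data.cmp_eq_nil_iff x y).1 hc) h
  | node => rfl

theorem PolyTime.eq : PolyTime fun z => Data.eq z.hd z.tl :=
  Feasible.ite PolyTime.cmp .nil (Feasible.nil.node .nil)

/-! ### Encodings -/

def Elem.enc (x : Elem) : Data := .node (encName x.1) (encList Role.enc x.2)

def Fact.enc : Fact → Data
  | .concept A x => .node (encBool false) (.node (encName A) (Elem.enc x))
  | .role P x y => .node (encBool true) (.node (encName P) (.node (Elem.enc x) (Elem.enc y)))

theorem encList_injective {α : Type} {enc : α → Data} (h : Function.Injective enc) :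
    Function.Injective (encList enc) := by
  intro l
  induction l with
  | nil => intro m hm; cases m <;> simp_all [encList]
  | cons a l ih =>
    intro m hm
    cases m with
    | nil => simp [encList] at hm
    | cons b m =>
      simp only [encList, Data.node.injEq] at hm
      rw [h hm.1, ih hm.2]

theorem encBool_injective : Function.Injective encBool := by
  intro a b; cases a <;> cases b <;> simp [encBool]

theorem encName_injective : Function.Injective encName := encList_injective encBool_injective

theorem encName_inj {a b : Name} : encName a = encName b ↔ a = b := encName_injective.eq_iff

theorem Role.enc_injective : Function.Injective Role.enc := by
  intro R Q; cases R <;> cases Q <;> simp [Role.enc, encBool, encName_inj]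

theorem Elem.enc_injective : Function.Injective Elem.enc := by
  intro x y h
  simp only [Elem.enc, Data.node.injEq] at h
  exact Prod.ext (encName_injective h.1) (encList_injective Role.enc_injective h.2)

theorem Fact.enc_injective : Function.Injective Fact.enc := by
  intro φ ψ
  cases φ <;> cases ψ <;>
    simp [Fact.enc, encBool, encName_inj, Elem.enc_injective.eq_iff]

theorem Term.enc_injective : Function.Injective Term.enc := by
  intro t u; cases t <;> cases u <;> simp [Term.enc, encBool, encName_inj]

theorem toList_encList {α : Type} (enc : α → Data) (l : List α) :
    (encList enc l).toList = l.map enc := by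
  induction l with
  | nil => rfl
  | cons a l ih => simp [encList, Data.toList, ih]

/-- The tree `d` is a list of the elements that satisfy `Q`. -/
def Lists {α : Type} (enc : α → Data) (d : Data) (Q : α → Prop) : Prop :=
  ∃ l : List α, d = encList enc l ∧ ∀ a, a ∈ l ↔ Q a

namespace Lists

variable {α β : Type} {enc : α → Data} {enc' : β → Data} {d z : Data} {Q Q' : α → Prop}

theorem congr (h : Lists enc d Q) (hQ : ∀ a, Q a ↔ Q' a) : Lists enc d Q' := by
  obtain ⟨l, hl, hm⟩ := h
  exact ⟨l, hl, fun a => (hm a).trans (hQ a)⟩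

theorem of_list (l : List α) : Lists enc (encList enc l) (· ∈ l) := ⟨l, rfl, fun _ => Iff.rfl⟩

theorem nil : Lists enc .nil fun _ => False := ⟨[], rfl, by simp⟩

theorem cons (a : α) (h : Lists enc d Q) : Lists enc (.node (enc a) d) fun b => b = a ∨ Q b := by
  obtain ⟨l, rfl, hm⟩ := h
  exact ⟨a :: l, rfl, fun b => by simp [hm]⟩

theorem single (a : α) : Lists enc (.node (enc a) .nil) (· = a) :=
  (nil.cons a).congr fun b => by simp

theorem append {Q₂ : α → Prop} (h : Lists enc d Q) (h₂ : Lists enc z Q₂) :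
    Lists enc (d.append z) fun a => Q a ∨ Q₂ a := by
  obtain ⟨l, rfl, hm⟩ := h
  obtain ⟨m, rfl, hm'⟩ := h₂
  refine ⟨l ++ m, ?_, fun a => by simp [hm, hm']⟩
  rw [Data.append, toList_encList]
  clear hm
  induction l with
  | nil => rfl
  | cons a l ih => simp [encList, ih]

theorem flatMap {g : Data → Data} {G : α → β → Prop} {Z : β → Prop} (hd : Lists enc d Q)
    (hz : Lists enc' z Z) (hg : ∀ a, Q a → Lists enc' (g (enc a)) (G a)) :
    Lists enc' (Data.flatMap g z d) fun b => (∃ a, Q a ∧ G a b) ∨ Z b := by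
  obtain ⟨l, rfl, hm⟩ := hd
  rw [Data.flatMap, toList_encList]
  have hg' : ∀ a ∈ l, Lists enc' (g (enc a)) (G a) := fun a ha => hg a ((hm a).1 ha)
  simp only [← hm]
  clear hm hg
  induction l with
  | nil => exact hz.congr fun b => by simp
  | cons a l ih =>
    have h1 := ih fun b hb => hg' b (List.mem_cons_of_mem _ hb)
    refine ((hg' a List.mem_cons_self).append h1).congr fun b => ?_
    simp [or_assoc]

theorem toList (h : Lists enc d Q) (e : Data) : e ∈ d.toList ↔ ∃ a, Q a ∧ enc a = e := by
  obtain ⟨l, rfl, hm⟩ := h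
  simp [toList_encList, hm]

end Lists

def Data.true : Data := .node .nil .nil

theorem Data.first_true_ne_nil (c : Data → Data) (d : Data) :
    Data.first c (fun _ => Data.true) .nil d ≠ .nil ↔ ∃ e ∈ d.toList, c e ≠ .nil := by
  rw [Data.first]
  induction d.toList with
  | nil => simp
  | cons e l ih =>
    simp only [List.foldr_cons, List.exists_mem_cons_iff, ← ih]
    cases c e <;> simp [Data.true]

theorem Data.first_nil_ne_nil (c : Data → Data) (d : Data) :
    Data.first c (fun _ => .nil) Data.true d ≠ .nil ↔ ∀ e ∈ d.toList, c e = .nil := by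
  rw [Data.first]
  induction d.toList with
  | nil => simp [Data.true]
  | cons e l ih =>
    simp only [List.foldr_cons, List.forall_mem_cons, ← ih]
    cases c e <;> simp

/-! ### Chase steps on trees -/

def matchRoleD (R φ : Data) : Data :=
  Data.ite φ.hd (Data.ite (Data.eq φ.tl.hd R.tl)
    (Data.ite R.hd (.node φ.tl.tl.tl φ.tl.tl.hd) φ.tl.tl) .nil) .nil

def matchConceptD (B φ : Data) : Data :=
  Data.ite B.hd (matchRoleD B.tl φ).hd
    (Data.ite φ.hd .nil (Data.ite (Data.eq φ.tl.hd B.tl) φ.tl.tl .nil))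

/-- Both facts and query atoms have this form. -/
def roleAtomD (R x y : Data) : Data :=
  .node Data.true (.node R.tl (Data.ite R.hd (.node y x) (.node x y)))

def conceptAtomD (B x y : Data) : Data :=
  Data.ite B.hd (roleAtomD B.tl x y) (.node .nil (.node B.tl x))

def applyD (i φ : Data) : Data :=
  Data.ite i.hd.tl .nil (Data.ite i.hd.hd
    (Data.ite (matchRoleD i.tl.hd φ)
      (.node (roleAtomD i.tl.tl (matchRoleD i.tl.hd φ).hd (matchRoleD i.tl.hd φ).tl) .nil) .nil)
    (Data.ite (matchConceptD i.tl.hd φ)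
      (.node (conceptAtomD i.tl.tl (matchConceptD i.tl.hd φ)
        (.node (matchConceptD i.tl.hd φ).hd
          (.node i.tl.tl.tl (matchConceptD i.tl.hd φ).tl))) .nil) .nil))

def roundD (T F : Data) : Data := Data.flatMap (fun φ => Data.flatMap (fun i => applyD i φ) .nil T) F F

/-- The entries of the list only serve as a counter: two rounds for each and one more make `2 *
T.length + 1`. In the same way `chaseD` performs `2 * q.length + T.length + 1` saturations, hence
the number of rounds given by `rounds`. -/
def saturateD (T F : Data) : Data :=
  roundD T (T.toList.foldr (fun _ F => roundD T (roundD T F)) F)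

def chaseD (T q F : Data) : Data :=
  saturateD T (T.toList.foldr (fun _ F => saturateD T F)
    (q.toList.foldr (fun _ F => saturateD T (saturateD T F)) F))

/-! ### Correctness of the chase on trees -/

theorem matchRoleD_fact (R : Role) (x y : Elem) :
    matchRoleD R.enc (R.fact x y).enc = .node (Elem.enc x) (Elem.enc y) := by
  cases R <;> simp [matchRoleD, Role.fact, Fact.enc, Role.enc, encBool, Data.eq_self]

theorem matchRoleD_cases (R : Role) (φ : Fact) :
    (∃ x y, φ = R.fact x y) ∨ (matchRoleD R.enc φ.enc = .nil ∧ ∀ x y, φ ≠ R.fact x y) := by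
  cases φ with
  | concept A x =>
    exact .inr ⟨by simp [matchRoleD, Fact.enc, encBool],
      fun _ _ h => Role.fact_ne_concept h.symm⟩
  | role P x y =>
    cases R with
    | atomic Q =>
      by_cases h : P = Q
      · subst h; exact .inl ⟨x, y, rfl⟩
      · refine .inr ⟨?_, fun _ _ h' => ?_⟩
        · simp [matchRoleD, Fact.enc, encBool, Role.enc,
            Data.eq_of_ne (fun h' => h (encName_injective h'))]
        · simp only [Role.fact, Fact.role.injEq] at h'; exact h h'.1
    | inv Q =>
      by_cases h : P = Q
      · subst h; exact .inl ⟨y, x, rfl⟩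
      · refine .inr ⟨?_, fun _ _ h' => ?_⟩
        · simp [matchRoleD, Fact.enc, encBool, Role.enc,
            Data.eq_of_ne (fun h' => h (encName_injective h'))]
        · simp only [Role.fact, Fact.role.injEq] at h'; exact h h'.1

theorem matchConceptD_of_shows {B : Concept} {φ : Fact} {x : Elem} (h : φ.Shows B x) :
    matchConceptD B.enc φ.enc = Elem.enc x := by
  cases B with
  | atomic A => cases h; simp [matchConceptD, Concept.enc, Fact.enc, encBool, Data.eq_self]
  | ex R => obtain ⟨y, rfl⟩ := h; simp [matchConceptD, Concept.enc, encBool, matchRoleD_fact]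

theorem matchConceptD_cases (B : Concept) (φ : Fact) :
    (∃ x, φ.Shows B x) ∨ (matchConceptD B.enc φ.enc = .nil ∧ ∀ x, ¬ φ.Shows B x) := by
  cases B with
  | atomic A =>
    cases φ with
    | concept A' x =>
      by_cases h : A' = A
      · subst h; exact .inl ⟨x, rfl⟩
      · refine .inr ⟨?_, fun y h' => ?_⟩
        · simp [matchConceptD, Fact.enc, encBool, Concept.enc,
            Data.eq_of_ne (fun h' => h (encName_injective h'))]
        · simp only [Fact.Shows, Fact.concept.injEq] at h'; exact h h'.1
    | role P x y =>
      exact .inr ⟨by simp [matchConceptD, Fact.enc, encBool, Concept.enc],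
        fun y h => by simp [Fact.Shows] at h⟩
  | ex R =>
    rcases matchRoleD_cases R φ with ⟨x, y, h⟩ | ⟨h, h'⟩
    · exact .inl ⟨x, y, h⟩
    · refine .inr ⟨by simp [matchConceptD, Concept.enc, encBool, h, Data.hd], ?_⟩
      rintro x ⟨y, hy⟩
      exact h' x y hy

theorem roleAtomD_fact (R : Role) (x y : Elem) :
    roleAtomD R.enc (Elem.enc x) (Elem.enc y) = (R.fact x y).enc := by
  cases R <;> rfl

theorem conceptAtomD_fact (B : Concept) (x : Elem) :
    conceptAtomD B.enc (Elem.enc x)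
      (.node (Elem.enc x).hd (.node B.enc.tl (Elem.enc x).tl)) = (B.fact x).enc := by
  cases B with
  | atomic A => rfl
  | ex R => exact roleAtomD_fact R x (child x R)

theorem Fact.Shows.unique {φ : Fact} {B : Concept} {x y : Elem} (hx : φ.Shows B x)
    (hy : φ.Shows B y) : x = y :=
  Elem.enc_injective ((matchConceptD_of_shows hx).symm.trans (matchConceptD_of_shows hy))

/-- A fact determines the element or pair to which a given inclusion applies, so there is at most
one consequence. -/
theorem lists_applyD (i : Inclusion) (φ : Fact) :
    Lists Fact.enc (applyD i.enc φ.enc) (Step [i] φ) := by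
  cases i with
  | conceptDisj B C =>
    refine Lists.nil.congr fun ψ => ⟨False.elim, fun h => ?_⟩
    cases h <;> simp_all
  | roleDisj R Q =>
    refine Lists.nil.congr fun ψ => ⟨False.elim, fun h => ?_⟩
    cases h <;> simp_all
  | conceptIncl B C =>
    rcases matchConceptD_cases B φ with ⟨x, hx⟩ | ⟨h, hn⟩
    · have := matchConceptD_of_shows hx
      have h2 : applyD (Inclusion.conceptIncl B C).enc φ.enc = .node (C.fact x).enc .nil := by
        rw [← conceptAtomD_fact]
        simp only [applyD, Inclusion.enc, encBool, Data.hd_node, Data.tl_node, Data.ite_nil, this]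
        simp [Elem.enc]
      rw [h2]
      refine (Lists.single _).congr fun ψ => ⟨?_, fun h => ?_⟩
      · rintro rfl; exact .concept (by simp) hx
      · cases h with
        | @concept B' C' _ y hm hs =>
          simp only [List.mem_singleton, Inclusion.conceptIncl.injEq] at hm
          obtain ⟨rfl, rfl⟩ := hm
          rw [hx.unique hs]
        | role hm => simp at hm
    · have h2 : applyD (Inclusion.conceptIncl B C).enc φ.enc = .nil := by
        simp [applyD, Inclusion.enc, encBool, h]
      rw [h2]
      refine Lists.nil.congr fun ψ => ⟨False.elim, fun h => ?_⟩
      cases h with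
      | @concept B' C' _ y hm hs =>
        simp only [List.mem_singleton, Inclusion.conceptIncl.injEq] at hm
        obtain ⟨rfl, rfl⟩ := hm
        exact hn _ hs
      | role hm => simp at hm
  | roleIncl R Q =>
    rcases matchRoleD_cases R φ with ⟨x, y, rfl⟩ | ⟨h, hn⟩
    · have := matchRoleD_fact R x y
      have h2 : applyD (Inclusion.roleIncl R Q).enc (R.fact x y).enc =
          .node (Q.fact x y).enc .nil := by
        rw [← roleAtomD_fact Q]
        simp [applyD, Inclusion.enc, encBool, this]
      rw [h2]
      refine (Lists.single _).congr fun ψ => ⟨?_, fun h => ?_⟩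
      · rintro rfl; exact .role (by simp)
      · generalize hφ : R.fact x y = φ at h
        cases h with
        | concept hm => simp at hm
        | @role R' Q' z w hm =>
          simp only [List.mem_singleton, Inclusion.roleIncl.injEq] at hm
          obtain ⟨rfl, rfl⟩ := hm
          have h1 := this
          rw [hφ, matchRoleD_fact] at h1
          simp only [Data.node.injEq] at h1
          rw [Elem.enc_injective h1.1, Elem.enc_injective h1.2]
    · have h2 : applyD (Inclusion.roleIncl R Q).enc φ.enc = .nil := by
        simp [applyD, Inclusion.enc, encBool, h]
      rw [h2]
      refine Lists.nil.congr fun ψ => ⟨False.elim, fun h => ?_⟩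
      cases h with
      | concept hm => simp at hm
      | @role R' Q' z w hm =>
        simp only [List.mem_singleton, Inclusion.roleIncl.injEq] at hm
        obtain ⟨rfl, rfl⟩ := hm
        exact hn _ _ rfl

theorem step_iff_exists {T : List Inclusion} {φ ψ : Fact} :
    Step T φ ψ ↔ ∃ i ∈ T, Step [i] φ ψ := by
  constructor
  · intro h
    cases h with
    | concept hi hs => exact ⟨_, hi, .concept (by simp) hs⟩
    | role hi => exact ⟨_, hi, .role (by simp)⟩
  · rintro ⟨i, hi, h⟩
    cases h with
    | concept hm hs =>
      obtain rfl := List.mem_singleton.1 hm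
      exact .concept hi hs
    | role hm =>
      obtain rfl := List.mem_singleton.1 hm
      exact .role hi

section

variable {T : List Inclusion} {S : List Fact} {F : Data} {n : ℕ}

theorem lists_roundD (hF : Lists Fact.enc F (Within T S n)) :
    Lists Fact.enc (roundD (encList Inclusion.enc T) F) (Within T S (n + 1)) := by
  refine (hF.flatMap (G := Step T) hF fun φ _ => ?_).congr fun ψ => ?_
  · refine ((Lists.of_list T).flatMap (G := fun i => Step [i] φ) Lists.nil
      fun i _ => lists_applyD i φ).congr fun ψ => ?_
    rw [or_false, step_iff_exists]
  · rw [or_comm]; rfl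

theorem lists_iterate {f : Data → Data} {k : ℕ}
    (hf : ∀ n F, Lists Fact.enc F (Within T S n) → Lists Fact.enc (f F) (Within T S (n + k)))
    (hF : Lists Fact.enc F (Within T S n)) (l : List Data) :
    Lists Fact.enc (l.foldr (fun _ F => f F) F) (Within T S (n + k * l.length)) := by
  induction l with
  | nil => exact hF
  | cons e l ih =>
    rw [List.length_cons, Nat.mul_succ, ← Nat.add_assoc]
    exact hf _ _ ih

theorem lists_saturateD (hF : Lists Fact.enc F (Within T S n)) :
    Lists Fact.enc (saturateD (encList Inclusion.enc T) F)
      (Within T S (n + (2 * T.length + 1))) := by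
  have := lists_iterate (k := 2)
    (f := fun F => roundD (encList Inclusion.enc T) (roundD (encList Inclusion.enc T) F))
    (fun n F h => lists_roundD (lists_roundD h)) hF (encList Inclusion.enc T).toList
  rw [toList_encList, List.length_map] at this
  rw [saturateD, toList_encList]
  exact lists_roundD this

theorem lists_chaseD {α : Type} (enc : α → Data) (q : List α)
    (hF : Lists Fact.enc F (· ∈ S)) :
    Lists Fact.enc (chaseD (encList Inclusion.enc T) (encList enc q) F)
      (Within T S (rounds T q.length)) := by
  have h1 := lists_iterate (T := T) (k := 2 * (2 * T.length + 1)) (n := 0)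
    (f := fun F => saturateD (encList Inclusion.enc T) (saturateD (encList Inclusion.enc T) F))
    (fun n F h => (lists_saturateD (lists_saturateD h)).congr fun φ => by
      rw [two_mul (2 * T.length + 1), Nat.add_assoc n]) hF (encList enc q).toList
  have h2 := lists_iterate (k := 2 * T.length + 1)
    (f := fun F => saturateD (encList Inclusion.enc T) F)
    (fun n F h => lists_saturateD h) h1 (encList Inclusion.enc T).toList
  refine (lists_saturateD h2).congr fun φ => ?_
  rw [toList_encList, toList_encList, List.length_map, List.length_map, rounds]
  have : 0 + 2 * (2 * T.length + 1) * q.length + (2 * T.length + 1) * T.length +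
      (2 * T.length + 1) = (2 * q.length + T.length + 1) * (2 * T.length + 1) := by ring
  rw [this]

end

/-! ### Feasibility of the chase -/

section

variable {κ : Data → ℕ} {f g h : Data → Data}

theorem Feasible.const (d : Data) : Feasible κ fun _ => d := by
  induction d with
  | nil => exact .nil
  | node a b iha ihb => exact iha.node ihb

theorem Feasible.eq (hf : Feasible κ f) (hg : Feasible κ g) :
    Feasible κ fun x => Data.eq (f x) (g x) :=
  PolyTime.comp₂ (f := Data.eq) PolyTime.eq hf hg

theorem Feasible.matchRoleD (hf : Feasible κ f) (hg : Feasible κ g) :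
    Feasible κ fun x => matchRoleD (f x) (g x) :=
  hg.hd.ite ((hg.tl.hd.eq hf.tl).ite (hf.hd.ite (hg.tl.tl.tl.node hg.tl.tl.hd) hg.tl.tl) .nil) .nil

theorem Feasible.matchConceptD (hf : Feasible κ f) (hg : Feasible κ g) :
    Feasible κ fun x => matchConceptD (f x) (g x) :=
  hf.hd.ite (hf.tl.matchRoleD hg).hd (hg.hd.ite .nil ((hg.tl.hd.eq hf.tl).ite hg.tl.tl .nil))

theorem Feasible.roleAtomD (hf : Feasible κ f) (hg : Feasible κ g) (hh : Feasible κ h) :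
    Feasible κ fun x => roleAtomD (f x) (g x) (h x) :=
  (Feasible.const _).node (hf.tl.node (hf.hd.ite (hh.node hg) (hg.node hh)))

theorem Feasible.conceptAtomD (hf : Feasible κ f) (hg : Feasible κ g) (hh : Feasible κ h) :
    Feasible κ fun x => conceptAtomD (f x) (g x) (h x) :=
  hf.hd.ite (hf.tl.roleAtomD hg hh) (Feasible.nil.node (hf.tl.node hg))

theorem Feasible.applyD (hf : Feasible κ f) (hg : Feasible κ g) :
    Feasible κ fun x => applyD (f x) (g x) :=
  have hr := hf.tl.hd.matchRoleD hg
  have hc := hf.tl.hd.matchConceptD hg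
  hf.hd.tl.ite .nil (hf.hd.hd.ite
    (hr.ite ((hf.tl.tl.roleAtomD hr.hd hr.tl).node .nil) .nil)
    (hc.ite ((hf.tl.tl.conceptAtomD hc (hc.hd.node (hf.tl.tl.tl.node hc.tl))).node .nil) .nil))

theorem PolyTime.roundD : PolyTime fun z => roundD z.hd z.tl :=
  have h : PolyTime fun z => Data.flatMap (fun i => CQE.applyD i z.hd) .nil z.tl.hd :=
    Feasible.flatMap (G := fun i z => CQE.applyD i z.hd) (Feasible.id.hd.applyD Feasible.id.tl.hd)
      .nil Feasible.id.tl.hd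
  Feasible.flatMap (G := fun φ z => Data.flatMap (fun i => CQE.applyD i φ) .nil z.hd) h
    Feasible.id.tl Feasible.id.tl

theorem Feasible.roundD (hf : Feasible κ f) (hg : Feasible κ g) :
    Feasible κ fun x => roundD (f x) (g x) :=
  PolyTime.comp₂ (f := CQE.roundD) PolyTime.roundD hf hg

/-- A single round is polynomial outright; the TBox is a parameter only because it determines the
number of rounds. -/
theorem Feasible.saturateD :
    Feasible (fun z => z.hd.size) fun z => saturateD z.hd z.tl := by
  refine Feasible.roundD Feasible.id.hd ?_
  refine Feasible.iterate (κ' := fun _ => 0) (L := fun z => z.hd)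
    (B := fun _ F z => CQE.roundD z.hd (CQE.roundD z.hd F)) Feasible.id.hd Feasible.id.tl
    (Feasible.id.tl.tl.hd.roundD (Feasible.id.tl.tl.hd.roundD Feasible.id.tl.hd))
    (fun _ => ⟨0, fun _ _ _ _ _ => le_refl _⟩)
    (fun K => ⟨K, fun x hx => (Data.length_toList_le _).trans hx⟩)

theorem Feasible.saturateD_comp (hf : Feasible κ f) (hg : Feasible κ g)
    (hκ : ∀ x, (f x).size ≤ κ x) : Feasible κ fun x => CQE.saturateD (f x) (g x) :=
  Feasible.comp (f := fun x => .node (f x) (g x)) Feasible.saturateD (hf.node hg)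
    fun K => ⟨K, fun x hx => (hκ x).trans hx⟩

theorem Feasible.chaseD :
    Feasible (fun z => z.hd.size + z.tl.hd.size) fun z => chaseD z.hd z.tl.hd z.tl.tl := by
  have hq : Feasible (fun z => z.hd.size + z.tl.hd.size) fun z =>
      z.tl.hd.toList.foldr (fun _ F => CQE.saturateD z.hd (CQE.saturateD z.hd F)) z.tl.tl :=
    Feasible.iterate (κ' := fun z => z.tl.tl.hd.size) (L := fun z => z.tl.hd)
      (I := fun z => z.tl.tl)
      (B := fun _ F z => CQE.saturateD z.hd (CQE.saturateD z.hd F)) Feasible.id.tl.hd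
      Feasible.id.tl.tl
      (Feasible.id.tl.tl.hd.saturateD_comp (Feasible.id.tl.tl.hd.saturateD_comp Feasible.id.tl.hd
        fun _ => le_refl _) fun _ => le_refl _)
      (fun K => ⟨K, fun x hx _ _ _ => (Nat.le_add_right _ _).trans hx⟩)
      (fun K => ⟨K, fun x hx =>
        (Data.length_toList_le _).trans ((Nat.le_add_left _ _).trans hx)⟩)
  refine Feasible.saturateD_comp Feasible.id.hd ?_ fun _ => Nat.le_add_right _ _
  exact Feasible.iterate (κ' := fun z => z.tl.tl.hd.size) (L := fun z => z.hd)
    (B := fun _ F z => CQE.saturateD z.hd F) Feasible.id.hd hq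
    (Feasible.id.tl.tl.hd.saturateD_comp Feasible.id.tl.hd fun _ => le_refl _)
    (fun K => ⟨K, fun x hx _ _ _ => (Nat.le_add_right _ _).trans hx⟩)
    (fun K => ⟨K, fun x hx =>
      (Data.length_toList_le _).trans ((Nat.le_add_right _ _).trans hx)⟩)

end

/-! ### Query evaluation on trees -/

/-- The arguments of the atoms in a list of query atoms or facts. -/
def argsD (q : Data) : Data :=
  Data.flatMap (fun α => Data.ite α.hd (.node α.tl.tl.hd (.node α.tl.tl.tl .nil))
    (.node α.tl.tl .nil)) .nil q

/-- All assignments of entries of `E` to the entries of `ts`. -/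
def assignsD (ts E : Data) : Data :=
  ts.toList.foldr (fun t Θ => Data.flatMap (fun θ =>
    Data.flatMap (fun e => .node (.node (.node t e) θ) .nil) .nil E) .nil Θ) (.node .nil .nil)

def lookupD (θ t : Data) : Data := Data.first (fun p => Data.eq p.hd t) (fun p => p.tl) .nil θ

/-- Assignments range over all terms, but a constant is evaluated to itself, whatever the assignment
says. -/
def valueD (θ t : Data) : Data := Data.ite t.hd (.node t.tl .nil) (lookupD θ t)

def substD (θ α : Data) : Data :=
  .node α.hd (.node α.tl.hd (Data.ite α.hd
    (.node (valueD θ α.tl.tl.hd) (valueD θ α.tl.tl.tl)) (valueD θ α.tl.tl)))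

def memD (x l : Data) : Data := Data.first (fun e => Data.eq e x) (fun _ => Data.true) .nil l

def holdsD (θ q F : Data) : Data :=
  Data.first (fun α => Data.ite (memD (substD θ α) F) .nil Data.true) (fun _ => .nil) Data.true q

def matchD (q F : Data) : Data :=
  Data.first (fun θ => holdsD θ q F) (fun _ => Data.true) .nil (assignsD (argsD q) (argsD F))

/-! ### Correctness of query evaluation -/

theorem argsD_query (q : List QueryAtom) :
    argsD (encList QueryAtom.enc q) = encList Term.enc (q.flatMap QueryAtom.terms) := by
  rw [argsD, Data.flatMap, toList_encList]
  induction q with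
  | nil => rfl
  | cons α q ih =>
    simp only [List.map_cons, List.foldr_cons, ih, List.flatMap_cons]
    cases α <;>
      simp [QueryAtom.enc, QueryAtom.terms, encBool, Data.append, Data.toList, encList]

theorem lists_argsD_fact {F : Data} {Q : Fact → Prop} (hF : Lists Fact.enc F Q) :
    Lists Elem.enc (argsD F) fun x => ∃ φ, Q φ ∧ x ∈ φ.elems := by
  refine (hF.flatMap (G := fun φ x => x ∈ φ.elems) Lists.nil fun φ _ => ?_).congr
    fun x => by rw [or_false]
  cases φ with
  | concept A x => exact (Lists.single x).congr fun y => by simp [Fact.elems]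
  | role P x y => exact ((Lists.single y).cons x).congr fun z => by simp [Fact.elems]

def encAssign : List (Term × Elem) → Data := encList fun p => .node p.1.enc (Elem.enc p.2)

theorem lists_assignsD (ts : List Term) {E : Data} {Q : Elem → Prop}
    (hE : Lists Elem.enc E Q) :
    Lists encAssign (assignsD (encList Term.enc ts) E) fun θ =>
      θ.map Prod.fst = ts ∧ ∀ p ∈ θ, Q p.2 := by
  rw [assignsD, toList_encList]
  induction ts with
  | nil =>
    refine (Lists.single (enc := encAssign) []).congr fun θ => ?_
    constructor
    · rintro rfl; simp
    · rintro ⟨h, -⟩; simpa using h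
  | cons t ts ih =>
    refine (ih.flatMap (enc' := encAssign) (G := fun θ θ' => ∃ x, Q x ∧ θ' = (t, x) :: θ)
      Lists.nil fun θ _ => ?_).congr fun θ' => ?_
    · refine (hE.flatMap (enc' := encAssign) (G := fun x θ' => θ' = (t, x) :: θ) Lists.nil
        fun x _ => ?_).congr fun θ' => by rw [or_false]
      exact Lists.single (enc := encAssign) ((t, x) :: θ)
    · rw [or_false]
      constructor
      · rintro ⟨θ, ⟨h1, h2⟩, x, hx, rfl⟩
        refine ⟨by simp [h1], ?_⟩
        simp only [List.forall_mem_cons]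
        exact ⟨hx, h2⟩
      · rintro ⟨h1, h2⟩
        cases θ' with
        | nil => simp at h1
        | cons p θ =>
          simp only [List.map_cons, List.cons.injEq] at h1
          rw [List.forall_mem_cons] at h2
          exact ⟨θ, ⟨h1.2, h2.2⟩, p.2, h2.1, by rw [← h1.1]⟩

/-- A repeated term may be paired with different elements. Only its first entry counts, so every
assignment still defines a function on the variables. -/
theorem lookupD_of_mem (θ : List (Term × Elem)) (t : Term) (h : t ∈ θ.map Prod.fst) :
    ∃ x, (t, x) ∈ θ ∧ lookupD (encAssign θ) t.enc = Elem.enc x := by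
  induction θ with
  | nil => simp at h
  | cons p θ ih =>
    simp only [lookupD, Data.first, encAssign, toList_encList, List.map_cons,
      List.foldr_cons, Data.hd_node, Data.tl_node] at ih ⊢
    by_cases hp : p.1 = t
    · refine ⟨p.2, by simp [← hp], ?_⟩
      rw [hp, Data.eq_self]; rfl
    · rw [Data.eq_of_ne (fun h' => hp (Term.enc_injective h'))]
      have : t ∈ θ.map Prod.fst := by
        simp only [List.map_cons, List.mem_cons] at h
        exact h.resolve_left fun h' => hp h'.symm
      obtain ⟨x, hx, he⟩ := ih this
      exact ⟨x, List.mem_cons_of_mem _ hx, he⟩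

theorem holdsD_ne_nil {F θ : Data} {Q : Fact → Prop} (hF : Lists Fact.enc F Q)
    {q : List QueryAtom} {v : Name → Elem}
    (hθ : ∀ t ∈ q.flatMap QueryAtom.terms, valueD θ t.enc = Elem.enc (t.elem v)) :
    holdsD θ (encList QueryAtom.enc q) F ≠ .nil ↔ ∀ α ∈ q, Q (α.fact v) := by
  rw [holdsD, Data.first_nil_ne_nil, toList_encList, List.forall_mem_map]
  refine forall₂_congr fun α hα => ?_
  have hs : substD θ α.enc = (α.fact v).enc := by
    have h : ∀ t ∈ α.terms, valueD θ t.enc = Elem.enc (t.elem v) :=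
      fun t ht => hθ t (List.mem_flatMap.2 ⟨α, hα, ht⟩)
    cases α with
    | concept A t =>
      simp [substD, QueryAtom.enc, encBool, QueryAtom.fact, Fact.enc,
        h t (by simp [QueryAtom.terms])]
    | role P t u =>
      simp [substD, QueryAtom.enc, encBool, QueryAtom.fact, Fact.enc,
        h t (by simp [QueryAtom.terms]), h u (by simp [QueryAtom.terms])]
  have hm : memD (substD θ α.enc) F ≠ .nil ↔ Q (α.fact v) := by
    rw [hs, memD, Data.first_true_ne_nil]
    constructor
    · rintro ⟨e, he, hne⟩
      obtain ⟨φ, hφ, rfl⟩ := (hF.toList e).1 he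
      by_contra hQ
      refine hne (Data.eq_of_ne fun h => hQ ?_)
      rw [← Fact.enc_injective h]
      exact hφ
    · intro h
      exact ⟨_, (hF.toList _).2 ⟨_, h, rfl⟩, by rw [Data.eq_self]; simp⟩
  rw [← hm]
  cases memD (substD θ α.enc) F <;> simp [Data.true]

theorem matchD_ne_nil {F : Data} {Q : Fact → Prop} (hF : Lists Fact.enc F Q)
    (q : List QueryAtom) :
    matchD (encList QueryAtom.enc q) F ≠ .nil ↔ ∃ v : Name → Elem, ∀ α ∈ q, Q (α.fact v) := by
  classical
  have hΘ := lists_assignsD (q.flatMap QueryAtom.terms) (lists_argsD_fact hF)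
  rw [matchD, Data.first_true_ne_nil, argsD_query]
  constructor
  · rintro ⟨e, he, hne⟩
    obtain ⟨θ, ⟨h1, -⟩, rfl⟩ := (hΘ.toList e).1 he
    have hex : ∀ x : Name, ∃ y : Elem, Term.var x ∈ q.flatMap QueryAtom.terms →
        lookupD (encAssign θ) (Term.var x).enc = Elem.enc y := by
      intro x
      by_cases hx : Term.var x ∈ q.flatMap QueryAtom.terms
      · obtain ⟨y, -, hy⟩ := lookupD_of_mem θ (.var x) (h1 ▸ hx)
        exact ⟨y, fun _ => hy⟩
      · exact ⟨([], []), fun h => absurd h hx⟩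
    choose v hv using hex
    refine ⟨v, (holdsD_ne_nil hF fun t ht => ?_).1 hne⟩
    cases t with
    | var x => exact hv x ht
    | const c => rfl
  · rintro ⟨v, hv⟩
    refine ⟨_, (hΘ.toList _).2 ⟨(q.flatMap QueryAtom.terms).map fun t => (t, t.elem v),
      ⟨by simp [Function.comp_def], ?_⟩, rfl⟩, (holdsD_ne_nil hF fun t ht => ?_).2 hv⟩
    -- It is enough to try elements that occur in the listed facts: each term lies in an atom, and
    -- the image of that atom is one of them.
    · intro p hp
      obtain ⟨t, ht, rfl⟩ := List.mem_map.1 hp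
      obtain ⟨α, hα, htα⟩ := List.mem_flatMap.1 ht
      refine ⟨_, hv α hα, ?_⟩
      rw [QueryAtom.elems_fact]
      exact List.mem_map_of_mem htα
    · cases t with
      | const c => rfl
      | var x =>
        obtain ⟨y, hy, he⟩ := lookupD_of_mem
          ((q.flatMap QueryAtom.terms).map fun t => (t, t.elem v)) (.var x)
          (by simpa [Function.comp_def] using ht)
        obtain ⟨t, -, htx⟩ := List.mem_map.1 hy
        simp only [Prod.mk.injEq] at htx
        obtain ⟨rfl, rfl⟩ := htx
        exact he

/-! ### The consistency test -/

def negQueriesD (i : Data) : Data :=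
  let x := (Term.var []).enc
  let y := (Term.var [false]).enc
  let z := (Term.var [true]).enc
  Data.ite i.hd.tl (.node (Data.ite i.hd.hd
    (.node (roleAtomD i.tl.hd x y) (.node (roleAtomD i.tl.tl x y) .nil))
    (.node (conceptAtomD i.tl.hd x y) (.node (conceptAtomD i.tl.tl x z) .nil))) .nil) .nil

/-- The policy is appended unchanged, as a denial is encoded by the list of its query atoms. -/
def queriesD (T P : Data) : Data := Data.flatMap negQueriesD P T

def groundFactD (α : Data) : Data :=
  Data.ite α.hd.hd
    (.node Data.true (.node α.tl.hd (.node (.node α.tl.tl.hd .nil) (.node α.tl.tl.tl.hd .nil))))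
    (.node .nil (.node α.tl.hd (.node α.tl.tl.hd .nil)))

def groundFactsD (S : Data) : Data := Data.flatMap (fun α => .node (groundFactD α) .nil) .nil S

/-- The consistency test on an input `(T . (P . S))`. -/
def consistentD (x : Data) : Data :=
  Data.first (fun q => matchD q (chaseD x.hd q (groundFactsD x.tl.tl))) (fun _ => .nil) Data.true
    (queriesD x.hd x.tl.hd)

/-! ### Correctness of the consistency test -/

theorem roleAtomD_atom (R : Role) (t u : Term) :
    roleAtomD R.enc t.enc u.enc = (R.atom t u).enc := by
  cases R <;> rfl

theorem conceptAtomD_atom (B : Concept) (t u : Term) :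
    conceptAtomD B.enc t.enc u.enc = (B.atom t u).enc := by
  cases B with
  | atomic A => rfl
  | ex R => exact roleAtomD_atom R t u

theorem negQueriesD_enc (i : Inclusion) :
    negQueriesD i.enc = encList (encList QueryAtom.enc) i.negQueries := by
  cases i with
  | conceptIncl => rfl
  | roleIncl => rfl
  | conceptDisj B C =>
    simp [negQueriesD, Inclusion.enc, Inclusion.negQueries, encBool, encList, conceptAtomD_atom]
  | roleDisj R Q =>
    simp [negQueriesD, Inclusion.enc, Inclusion.negQueries, encBool, encList, roleAtomD_atom]

theorem lists_queriesD (T : List Inclusion) (P : List Denial) :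
    Lists (encList QueryAtom.enc)
      (queriesD (encList Inclusion.enc T) (encList Denial.enc P)) (· ∈ queries T P) := by
  have hP : Lists (encList QueryAtom.enc) (encList Denial.enc P)
      (· ∈ P.map fun δ => δ.body.atoms) := by
    refine ⟨_, ?_, fun _ => Iff.rfl⟩
    induction P with
    | nil => rfl
    | cons δ P ih => simp [encList, ih, Denial.enc]
  refine ((Lists.of_list T).flatMap (enc' := encList QueryAtom.enc)
    (G := fun i q => q ∈ i.negQueries) hP fun i _ => ?_).congr fun q => ?_
  · rw [negQueriesD_enc]; exact Lists.of_list _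
  · simp [queries, List.mem_flatMap]

theorem groundFactD_enc (α : GroundAtom) : groundFactD α.enc = α.fact.enc := by
  cases α <;> rfl

theorem lists_groundFactsD (S : List GroundAtom) :
    Lists Fact.enc (groundFactsD (encList GroundAtom.enc S)) (· ∈ S.map GroundAtom.fact) := by
  refine ((Lists.of_list S).flatMap (enc' := Fact.enc) (G := fun α φ => φ = α.fact) Lists.nil
    fun α _ => ?_).congr fun φ => ?_
  · rw [groundFactD_enc]; exact Lists.single _
  · simp [eq_comm]

theorem consistentD_ne_nil (T : List Inclusion) (P : List Denial) (S : List GroundAtom) :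
    consistentD (.node (encList Inclusion.enc T)
      (.node (encList Denial.enc P) (encList GroundAtom.enc S))) ≠ .nil ↔
    ∀ q ∈ queries T P, ¬ Matches T (S.map GroundAtom.fact) q := by
  rw [consistentD, Data.first_nil_ne_nil]
  simp only [Data.hd_node, Data.tl_node, (lists_queriesD T P).toList]
  have key : ∀ q, matchD (encList QueryAtom.enc q) (chaseD (encList Inclusion.enc T)
      (encList QueryAtom.enc q) (groundFactsD (encList GroundAtom.enc S))) = .nil ↔
      ¬ Matches T (S.map GroundAtom.fact) q := by
    intro q
    rw [← not_iff_not, not_not]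
    exact matchD_ne_nil (lists_chaseD QueryAtom.enc q (lists_groundFactsD S)) q
  constructor
  · intro h q hq
    exact (key q).1 (h _ ⟨q, hq, rfl⟩)
  · rintro h _ ⟨q, hq, rfl⟩
    exact (key q).2 (h q hq)

/-! ### The set of entailed ground atoms -/

/-- The fact as a ground atom, if it is one. -/
def groundAtomD (φ : Data) : Data :=
  Data.ite φ.hd
    (Data.ite φ.tl.tl.hd.tl .nil (Data.ite φ.tl.tl.tl.tl .nil
      (.node (.node (encName [true]) (.node φ.tl.hd
        (.node φ.tl.tl.hd.hd (.node φ.tl.tl.tl.hd .nil)))) .nil)))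
    (Data.ite φ.tl.tl.tl .nil
      (.node (.node (encName [false]) (.node φ.tl.hd (.node φ.tl.tl.hd .nil))) .nil))

def smallerD (a l : Data) (z : Data) : Data :=
  Data.flatMap (fun e => Data.ite (e.cmp a) (Data.ite (e.cmp a).hd .nil (.node e .nil)) .nil) z l

def largerD (a l : Data) : Data :=
  Data.flatMap (fun e => Data.ite (e.cmp a) (Data.ite (e.cmp a).hd (.node e .nil) .nil) .nil) .nil l

/-- Insertion into a sorted list. -/
def insertD (a l : Data) : Data := smallerD a l (.node a (largerD a l))

def sortD (l : Data) : Data := l.toList.foldr insertD .nil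

/-- The sorted list of entailed ground atoms, on an input `(T . A)`. -/
def closureD (x : Data) : Data :=
  sortD (Data.flatMap groundAtomD .nil (chaseD x.hd .nil (groundFactsD x.tl)))

/-! ### Correctness of the closure program and the lexicographic order -/

theorem lists_groundAtomD (φ : Fact) :
    Lists GroundAtom.enc (groundAtomD φ.enc) fun α => φ = α.fact := by
  cases φ with
  | concept A x =>
    obtain ⟨a, w⟩ := x
    cases w with
    | nil =>
      refine (Lists.single (enc := GroundAtom.enc) (.concept A a)).congr fun α => ?_
      cases α <;> simp [GroundAtom.fact, eq_comm]
    | cons R w =>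
      refine Lists.nil.congr fun α => ?_
      cases α <;> simp [GroundAtom.fact]
  | role P x y =>
    obtain ⟨a, w⟩ := x
    obtain ⟨b, u⟩ := y
    cases w with
    | cons R w =>
      refine Lists.nil.congr fun α => ?_
      cases α <;> simp [GroundAtom.fact]
    | nil =>
      cases u with
      | cons R w =>
        refine Lists.nil.congr fun α => ?_
        cases α <;> simp [GroundAtom.fact]
      | nil =>
        refine (Lists.single (enc := GroundAtom.enc) (.role P a b)).congr fun α => ?_
        cases α <;> simp [GroundAtom.fact, eq_comm]

/-- The comparison of trees decides the order `<` under the encoding. -/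
def CmpLT {α : Type} [LT α] (enc : α → Data) : Prop :=
  ∀ a b, (∃ u, (enc a).cmp (enc b) = .node .nil u) ↔ a < b

theorem cmpLT_encBool : CmpLT encBool := by
  intro a b; cases a <;> cases b <;> simp [encBool, Data.cmp]

/-- The tree `nil` precedes every node, and heads are compared before tails, just as for words. -/
theorem CmpLT.encList {α : Type} [LT α] {enc : α → Data} (h : CmpLT enc)
    (hi : Function.Injective enc) : CmpLT (encList enc) := by
  intro l
  induction l with
  | nil => intro m; cases m <;> simp [CQE.encList, Data.cmp]
  | cons a l ih =>
    intro m
    cases m with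
    | nil => simp [CQE.encList, Data.cmp]
    | cons b m =>
      rw [List.cons_lt_cons_iff, ← h a b, ← ih m]
      simp only [CQE.encList, Data.cmp]
      have hab := Data.cmp_eq_nil_iff (enc a) (enc b)
      rw [hi.eq_iff] at hab
      rw [← hab]
      cases (enc a).cmp (enc b) <;> simp

theorem GroundAtom.key_injective : Function.Injective GroundAtom.key := by
  intro α β; cases α <;> cases β <;> simp [GroundAtom.key]

theorem GroundAtom.enc_injective : Function.Injective GroundAtom.enc :=
  (encList_injective encName_injective).comp GroundAtom.key_injective

theorem GroundAtom.cmp_lt (α β : GroundAtom) :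
    (∃ u, α.enc.cmp β.enc = .node .nil u) ↔ α.LexLT β :=
  CmpLT.encList (CmpLT.encList cmpLT_encBool encBool_injective) encName_injective _ _

theorem GroundAtom.cmp_gt (α β : GroundAtom) :
    (∃ u v w, α.enc.cmp β.enc = .node (.node u v) w) ↔ β.LexLT α := by
  have h1 := GroundAtom.cmp_lt α β
  have h2 := Data.cmp_eq_nil_iff α.enc β.enc
  rw [GroundAtom.enc_injective.eq_iff] at h2
  have h3 := lt_trichotomy α.key β.key
  rw [GroundAtom.key_injective.eq_iff] at h3
  simp only [GroundAtom.LexLT] at h1 ⊢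
  constructor
  · rintro ⟨u, v, w, h⟩
    rw [h] at h1 h2
    simp only [Data.node.injEq, reduceCtorEq, false_and, exists_false, false_iff] at h1 h2
    exact (h3.resolve_left h1).resolve_left h2
  · intro h
    cases hc : α.enc.cmp β.enc with
    | nil => rw [h2.1 hc] at h; exact absurd h (lt_irrefl _)
    | node a b =>
      cases a with
      | nil => exact absurd (h1.1 ⟨b, hc⟩) h.asymm
      | node u v => exact ⟨u, v, b, rfl⟩

theorem flatMap_encList_filter {α : Type} {enc : α → Data} {p : α → Prop} [DecidablePred p]
    {g : Data → Data}
    (hg : ∀ a, g (enc a) = if p a then .node (enc a) .nil else .nil) (l z : List α) :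
    Data.flatMap g (encList enc z) (encList enc l) =
      encList enc (l.filter (fun a => p a) ++ z) := by
  rw [Data.flatMap, toList_encList]
  induction l with
  | nil => rfl
  | cons a l ih =>
    simp only [List.map_cons, List.foldr_cons, ih, hg]
    by_cases h : p a <;> simp [h, Data.append, Data.toList, encList]

-- An entry equal to `α` passes neither filter, so insertion also removes the repetitions produced
-- by the chase.
open Classical in
theorem insertD_enc (α : GroundAtom) (l : List GroundAtom) :
    insertD α.enc (encList GroundAtom.enc l) =
      encList GroundAtom.enc (l.filter (fun β => β.LexLT α) ++
        α :: l.filter (fun β => α.LexLT β)) := by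
  have hsm : ∀ β : GroundAtom, Data.ite (β.enc.cmp α.enc)
      (Data.ite (β.enc.cmp α.enc).hd .nil (.node β.enc .nil)) .nil =
      if β.LexLT α then .node β.enc .nil else .nil := by
    intro β
    have h1 := GroundAtom.cmp_lt β α
    rw [← h1]
    cases β.enc.cmp α.enc with
    | nil => simp
    | node a b => cases a <;> simp
  have hla : ∀ β : GroundAtom, Data.ite (β.enc.cmp α.enc)
      (Data.ite (β.enc.cmp α.enc).hd (.node β.enc .nil) .nil) .nil =
      if α.LexLT β then .node β.enc .nil else .nil := by
    intro β
    have h1 := GroundAtom.cmp_gt β α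
    rw [← h1]
    cases β.enc.cmp α.enc with
    | nil => simp
    | node a b => cases a <;> simp
  have e1 := flatMap_encList_filter (p := fun β => α.LexLT β) (enc := GroundAtom.enc)
    (g := fun e => Data.ite (e.cmp α.enc) (Data.ite (e.cmp α.enc).hd (.node e .nil) .nil) .nil)
    hla l []
  have e2 := flatMap_encList_filter (p := fun β => β.LexLT α) (enc := GroundAtom.enc)
    (g := fun e => Data.ite (e.cmp α.enc) (Data.ite (e.cmp α.enc).hd .nil (.node e .nil)) .nil)
    hsm l (α :: l.filter (fun β => α.LexLT β))
  rw [List.append_nil] at e1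
  rw [insertD, smallerD, largerD, ← e2]
  simp only [encList] at e1 ⊢
  rw [e1]

theorem sortD_enc (l : List GroundAtom) : ∃ m : List GroundAtom, m.Pairwise GroundAtom.LexLT ∧
    (∀ α, α ∈ m ↔ α ∈ l) ∧ sortD (encList GroundAtom.enc l) = encList GroundAtom.enc m := by
  classical
  simp only [sortD, toList_encList]
  induction l with
  | nil => exact ⟨[], .nil, fun _ => Iff.rfl, rfl⟩
  | cons α l ih =>
    obtain ⟨m, hm, hmem, he⟩ := ih
    have htrans : ∀ {α β γ : GroundAtom}, α.LexLT β → β.LexLT γ → α.LexLT γ :=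
      fun h h' => lt_trans (a := GroundAtom.key _) h h'
    refine ⟨_, ?_, ?_, by rw [List.map_cons, List.foldr_cons, he, insertD_enc]⟩
    · rw [List.pairwise_append, List.pairwise_cons]
      refine ⟨hm.filter _, ⟨?_, hm.filter _⟩, ?_⟩
      · intro β hβ; simpa using (List.mem_filter.1 hβ).2
      · intro β hβ γ hγ
        have h1 : β.LexLT α := by simpa using (List.mem_filter.1 hβ).2
        rcases List.mem_cons.1 hγ with rfl | hγ
        · exact h1
        · have h2 : α.LexLT γ := by simpa using (List.mem_filter.1 hγ).2
          exact htrans h1 h2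
    · intro β
      have h3 := lt_trichotomy β.key α.key
      rw [GroundAtom.key_injective.eq_iff] at h3
      have h3' : β.LexLT α ∨ β = α ∨ α.LexLT β := h3
      simp only [List.mem_append, List.mem_cons, List.mem_filter, hmem, decide_eq_true_eq]
      tauto

theorem closureD_enc (T : List Inclusion) (A : List GroundAtom) :
    ∃ l : List GroundAtom, l.Pairwise GroundAtom.LexLT ∧
      (∀ α, α ∈ l ↔ Within T (A.map GroundAtom.fact) (rounds T 0) α.fact) ∧
      closureD (.node (encList Inclusion.enc T) (encList GroundAtom.enc A)) =
        encList GroundAtom.enc l := by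
  -- The empty query stands for "no query": it only sets the number of rounds to `rounds T 0`.
  obtain ⟨m, hm, hmem⟩ := (lists_chaseD (T := T) QueryAtom.enc [] (lists_groundFactsD A)).flatMap
    (enc' := GroundAtom.enc) (g := groundAtomD) (G := fun φ α => φ = α.fact) Lists.nil
    fun φ _ => lists_groundAtomD φ
  obtain ⟨l, hl, hml, he⟩ := sortD_enc m
  refine ⟨l, hl, fun α => ?_, ?_⟩
  · rw [hml, hmem]; simp
  · rw [← he, ← hm]; rfl

/-! ### Feasibility of the programs -/

theorem PolyTime.size_bound {f : Data → Data} (hf : PolyTime f) :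
    ∃ k, ∀ x, (f x).size ≤ (x.size + 2) ^ k := by
  obtain ⟨k, hk⟩ := hf.choose_spec.choose_spec.2.2 0
  exact ⟨k, fun x => hk x (le_refl _)⟩

section

variable {κ : Data → ℕ} {f g h : Data → Data}

theorem PolyTime.argsD : PolyTime argsD :=
  have hi : PolyTime fun z => z.hd := Feasible.id.hd
  Feasible.flatMap (G := fun α _ => Data.ite α.hd (.node α.tl.tl.hd (.node α.tl.tl.tl .nil))
    (.node α.tl.tl .nil)) (hi.hd.ite (hi.tl.tl.hd.node (hi.tl.tl.tl.node .nil))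
      (hi.tl.tl.node .nil)) .nil Feasible.id

/-- The number of assignments is exponential in the number of terms but polynomial in the number of
elements, so the list of terms is the parameter. -/
theorem Feasible.assignsD :
    Feasible (fun z => z.hd.size) fun z => assignsD z.hd z.tl := by
  have hi : PolyTime fun z => z := Feasible.id
  have h1 : PolyTime fun z => Data.flatMap
      (fun e => .node (.node (.node z.tl.hd e) z.hd) .nil) .nil z.tl.tl.tl.tl :=
    Feasible.flatMap (G := fun e z => .node (.node (.node z.tl.hd e) z.hd) .nil)
      (((hi.tl.tl.hd.node hi.hd).node hi.tl.hd).node .nil) .nil hi.tl.tl.tl.tl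
  have h2 : PolyTime fun z => Data.flatMap (fun θ => Data.flatMap
      (fun e => .node (.node (.node z.hd e) θ) .nil) .nil z.tl.tl.tl) .nil z.tl.hd :=
    Feasible.flatMap (G := fun θ z => Data.flatMap
      (fun e => .node (.node (.node z.hd e) θ) .nil) .nil z.tl.tl.tl) h1 .nil hi.tl.hd
  exact Feasible.iterate (κ' := fun _ => 0) (L := fun z => z.hd)
    (B := fun t Θ z => Data.flatMap (fun θ => Data.flatMap
      (fun e => .node (.node (.node t e) θ) .nil) .nil z.tl) .nil Θ) Feasible.id.hd
    (Feasible.const _) h2 (fun _ => ⟨0, fun _ _ _ _ _ => le_refl _⟩)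
    (fun K => ⟨K, fun x hx => (Data.length_toList_le _).trans hx⟩)

theorem PolyTime.lookupD : PolyTime fun z => lookupD z.hd z.tl :=
  have hi : PolyTime fun z => z := Feasible.id
  PolyTime.first (C := fun p z => Data.eq p.hd z.tl) (G := fun p _ => p.tl)
    (hi.hd.hd.eq hi.tl.tl) hi.hd.tl .nil hi.hd

theorem Feasible.valueD (hf : Feasible κ f) (hg : Feasible κ g) :
    Feasible κ fun x => valueD (f x) (g x) :=
  hg.hd.ite (hg.tl.node .nil) (PolyTime.comp₂ (f := CQE.lookupD) PolyTime.lookupD hf hg)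

theorem Feasible.substD (hf : Feasible κ f) (hg : Feasible κ g) :
    Feasible κ fun x => substD (f x) (g x) :=
  hg.hd.node (hg.tl.hd.node (hg.hd.ite ((hf.valueD hg.tl.tl.hd).node (hf.valueD hg.tl.tl.tl))
    (hf.valueD hg.tl.tl)))

theorem PolyTime.memD : PolyTime fun z => memD z.hd z.tl :=
  have hi : PolyTime fun z => z := Feasible.id
  PolyTime.first (C := fun e z => Data.eq e z.hd) (G := fun _ _ => Data.true)
    (hi.hd.eq hi.tl.hd) (Feasible.const _) .nil hi.tl

theorem PolyTime.holdsD : PolyTime fun z => holdsD z.hd z.tl.hd z.tl.tl :=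
  have hi : PolyTime fun z => z := Feasible.id
  PolyTime.first (C := fun α z => Data.ite (CQE.memD (CQE.substD z.hd α) z.tl.tl) .nil Data.true)
    (G := fun _ _ => .nil)
    ((PolyTime.comp₂ (f := CQE.memD) PolyTime.memD (hi.tl.hd.substD hi.hd) hi.tl.tl.tl).ite .nil
      (Feasible.const _)) .nil (Feasible.const _) hi.tl.hd

theorem Feasible.matchD : Feasible (fun z => z.hd.size) fun z => matchD z.hd z.tl := by
  have hi : PolyTime fun z => z := Feasible.id
  have hi' : Feasible (fun z => z.hd.size) fun z => z := Feasible.id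
  refine PolyTime.first (C := fun θ z => CQE.holdsD θ z.hd z.tl) (G := fun _ _ => Data.true)
    (PolyTime.comp₃ (f := CQE.holdsD) PolyTime.holdsD hi.hd hi.tl.hd hi.tl.tl) (Feasible.const _)
    .nil ?_
  obtain ⟨k, hk⟩ := PolyTime.size_bound PolyTime.argsD
  exact Feasible.comp (f := fun z => .node (CQE.argsD z.hd) (CQE.argsD z.tl)) Feasible.assignsD
    ((PolyTime.comp₁ PolyTime.argsD hi'.hd).node (PolyTime.comp₁ PolyTime.argsD hi'.tl))
    fun K => ⟨(K + 2) ^ k, fun x hx => (hk _).trans (Nat.pow_le_pow_left (by omega) _)⟩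

theorem PolyTime.negQueriesD : PolyTime negQueriesD :=
  have hi : PolyTime fun z => z := Feasible.id
  hi.hd.tl.ite ((hi.hd.hd.ite
    ((hi.tl.hd.roleAtomD (.const _) (.const _)).node
      ((hi.tl.tl.roleAtomD (.const _) (.const _)).node .nil))
    ((hi.tl.hd.conceptAtomD (.const _) (.const _)).node
      ((hi.tl.tl.conceptAtomD (.const _) (.const _)).node .nil))).node .nil) .nil

theorem PolyTime.queriesD : PolyTime fun z => queriesD z.hd z.tl :=
  have hi : PolyTime fun z => z := Feasible.id
  Feasible.flatMap (G := fun i _ => CQE.negQueriesD i) (PolyTime.comp₁ PolyTime.negQueriesD hi.hd)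
    hi.tl hi.hd

theorem Feasible.groundFactD (hf : Feasible κ f) : Feasible κ fun x => groundFactD (f x) :=
  hf.hd.hd.ite
    ((Feasible.const _).node (hf.tl.hd.node ((hf.tl.tl.hd.node .nil).node
      (hf.tl.tl.tl.hd.node .nil))))
    (Feasible.nil.node (hf.tl.hd.node (hf.tl.tl.hd.node .nil)))

theorem PolyTime.groundFactsD : PolyTime groundFactsD :=
  have hi : PolyTime fun z => z := Feasible.id
  Feasible.flatMap (G := fun α _ => .node (CQE.groundFactD α) .nil) (hi.hd.groundFactD.node .nil)
    .nil hi

theorem Feasible.consistentD :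
    Feasible (fun z => z.hd.size + z.tl.hd.size) consistentD := by
  have hi : Feasible (fun z => z.hd.size + z.tl.hd.size) fun z => z := Feasible.id
  have hj : Feasible (fun z => z.hd.size + z.tl.hd.size) fun z => z := Feasible.id
  have hchase : Feasible (fun z => z.hd.size + z.tl.hd.size) fun z =>
      CQE.chaseD z.tl.hd z.hd (CQE.groundFactsD z.tl.tl.tl) :=
    Feasible.comp (f := fun z => .node z.tl.hd (.node z.hd (CQE.groundFactsD z.tl.tl.tl)))
      Feasible.chaseD
      (hj.tl.hd.node (hj.hd.node (PolyTime.comp₁ PolyTime.groundFactsD hj.tl.tl.tl)))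
      fun K => ⟨K, fun x hx => (Nat.add_comm _ _).trans_le hx⟩
  have hmatch : Feasible (fun z => z.hd.size + z.tl.hd.size) fun z =>
      CQE.matchD z.hd (CQE.chaseD z.tl.hd z.hd (CQE.groundFactsD z.tl.tl.tl)) :=
    Feasible.comp (f := fun z => .node z.hd
      (CQE.chaseD z.tl.hd z.hd (CQE.groundFactsD z.tl.tl.tl))) Feasible.matchD (hj.hd.node hchase)
      fun K => ⟨K, fun x hx => (Nat.le_add_right _ _).trans hx⟩
  refine Feasible.first (κ' := fun z => z.hd.size + z.tl.hd.size)
    (C := fun q x => CQE.matchD q (CQE.chaseD x.hd q (CQE.groundFactsD x.tl.tl)))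
    (G := fun _ _ => .nil) hmatch .nil (Feasible.const _)
    (PolyTime.comp₂ (f := CQE.queriesD) PolyTime.queriesD hi.hd hi.tl.hd) ?_
  -- Every tested query is an entry of the output of `queriesD`, so its size is bounded in terms of
  -- `T` and `P`. This bounds the parameter of the chase and of the matching.
  obtain ⟨k, hk⟩ := PolyTime.size_bound PolyTime.queriesD
  intro K
  refine ⟨(K + 3) ^ k + K, fun x hx e he => ?_⟩
  have h1 := (Data.size_le_of_mem he).trans (hk (.node x.hd x.tl.hd))
  have h2 : ((Data.node x.hd x.tl.hd).size + 2) ^ k ≤ (K + 3) ^ k :=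
    Nat.pow_le_pow_left (by simp only [Data.size_node]; omega) _
  simp only [Data.hd_node, Data.tl_node]
  omega

theorem PolyTime.groundAtomD : PolyTime groundAtomD :=
  have hi : PolyTime fun z => z := Feasible.id
  hi.hd.ite
    (hi.tl.tl.hd.tl.ite .nil (hi.tl.tl.tl.tl.ite .nil
      (((Feasible.const _).node (hi.tl.hd.node
        (hi.tl.tl.hd.hd.node (hi.tl.tl.tl.hd.node .nil)))).node .nil)))
    (hi.tl.tl.tl.ite .nil
      (((Feasible.const _).node (hi.tl.hd.node (hi.tl.tl.hd.node .nil))).node .nil))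

theorem Feasible.cmp (hf : Feasible κ f) (hg : Feasible κ g) :
    Feasible κ fun x => (f x).cmp (g x) :=
  PolyTime.comp₂ (f := Data.cmp) PolyTime.cmp hf hg

theorem PolyTime.insertD : PolyTime fun z => insertD z.hd z.tl := by
  have hi : PolyTime fun z => z := Feasible.id
  have hc : PolyTime fun z => z.hd.cmp z.tl.hd := hi.hd.cmp hi.tl.hd
  have hla : PolyTime fun z => largerD z.hd z.tl :=
    Feasible.flatMap (G := fun e z => Data.ite (e.cmp z.hd)
      (Data.ite (e.cmp z.hd).hd (.node e .nil) .nil) .nil)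
      (hc.ite (hc.hd.ite (hi.hd.node .nil) .nil) .nil) .nil hi.tl
  exact Feasible.flatMap (G := fun e z => Data.ite (e.cmp z.hd)
    (Data.ite (e.cmp z.hd).hd .nil (.node e .nil)) .nil)
    (hc.ite (hc.hd.ite .nil (hi.hd.node .nil)) .nil) (hi.hd.node hla) hi.tl

/-- Each entry of `l` survives in at most one of the two filters. -/
theorem size_insertD_le (a l : Data) : (insertD a l).size ≤ l.size + (Data.node a .nil).size := by
  have key : ∀ z, (smallerD a l z).size + (largerD a l).size ≤ l.size + z.size := by
    intro z
    induction l with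
    | nil => simp [smallerD, largerD, Data.flatMap, Data.toList]
    | node e l _ ih =>
      simp only [smallerD, largerD, Data.flatMap, Data.toList, List.foldr_cons] at ih ⊢
      have h1 : ∀ b, Data.append .nil b = b := fun _ => rfl
      have h2 : ∀ b, Data.append (.node e .nil) b = .node e b := fun _ => rfl
      cases e.cmp a with
      | nil => simp only [Data.ite_nil, h1, Data.size_node]; omega
      | node u v =>
        cases u <;>
          simp only [Data.ite_nil, Data.ite_node, Data.hd_node, h1, h2, Data.size_node] <;> omega
  have := key (.node a (largerD a l))
  simp only [insertD, Data.size_node, Data.size_nil] at this ⊢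
  omega

theorem PolyTime.sortD : PolyTime sortD :=
  have hi : PolyTime fun z => z := Feasible.id
  Feasible.foldr_of_additive (κ' := fun _ => 0) (L := fun x => x)
    (B := fun e acc _ => CQE.insertD e acc) (G := fun e _ => .node e .nil) hi .nil
    (PolyTime.comp₂ (f := CQE.insertD) PolyTime.insertD hi.hd hi.tl.hd)
    (fun _ => ⟨0, fun _ _ _ _ _ => le_refl _⟩) (hi.hd.node .nil)
    (fun e acc _ => size_insertD_le e acc)

theorem Feasible.closureD : Feasible (fun z => z.hd.size) closureD := by
  have hi : Feasible (fun z => z.hd.size) fun z => z := Feasible.id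
  have hchase : Feasible (fun z => z.hd.size) fun z =>
      CQE.chaseD z.hd .nil (CQE.groundFactsD z.tl) :=
    Feasible.comp (f := fun z => .node z.hd (.node .nil (CQE.groundFactsD z.tl)))
      Feasible.chaseD (hi.hd.node (Feasible.nil.node (PolyTime.comp₁ PolyTime.groundFactsD hi.tl)))
      fun K => ⟨K, fun x hx => hx⟩
  exact PolyTime.comp₁ (f := CQE.sortD) PolyTime.sortD (Feasible.flatMap (G := fun φ _ => CQE.groundAtomD φ)
    (PolyTime.comp₁ PolyTime.groundAtomD Feasible.id.hd) .nil hchase)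

end

/-! ### The greedy censor -/

open Classical in
/-- Adds the atoms of a list, in turn, as long as consistency is preserved. -/
noncomputable def greedy (T : TBox) (P : Policy) : List GroundAtom → List GroundAtom →
    List GroundAtom
  | [], Th => Th
  | α :: l, Th => if Consistent T P {β | β ∈ α :: Th} then greedy T P l (α :: Th)
      else greedy T P l Th

section

variable {T : TBox} {P : Policy}

theorem Consistent.mono {S S' : Set GroundAtom} (h : Consistent T P S') (hs : S ⊆ S') :
    Consistent T P S := by
  obtain ⟨I, h1, h2, h3⟩ := h
  exact ⟨I, h1, h2, fun α hα => h3 α (hs hα)⟩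

theorem subset_greedy (l Th : List GroundAtom) : Th ⊆ greedy T P l Th := by
  induction l generalizing Th with
  | nil => exact List.Subset.refl _
  | cons α l ih =>
    rw [greedy]
    split_ifs
    · exact List.Subset.trans (List.subset_cons_self α Th) (ih _)
    · exact ih _

/-- Keeping track of multiplicities gives both that the censor stays within the closure and that the
output has no repetitions. -/
theorem greedy_sublist (l Th : List GroundAtom) : (greedy T P l Th).Subperm (l ++ Th) := by
  induction l generalizing Th with
  | nil => exact List.Subperm.refl _
  | cons α l ih =>
    rw [greedy]
    split_ifs
    · exact (ih _).trans List.perm_middle.subperm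
    · exact (ih _).trans (List.sublist_cons_self _ _).subperm

theorem greedy_consistent (l Th : List GroundAtom) (h : Consistent T P {β | β ∈ Th}) :
    Consistent T P {β | β ∈ greedy T P l Th} := by
  induction l generalizing Th with
  | nil => exact h
  | cons α l ih =>
    rw [greedy]
    split_ifs with hc
    · exact ih _ hc
    · exact ih _ h

/-- Accepted atoms are never withdrawn and consistency passes to subsets, so a rejection remains
justified at the end. -/
theorem mem_greedy_of_consistent (l Th : List GroundAtom) {α : GroundAtom} (hα : α ∈ l)
    (h : Consistent T P (insert α {β | β ∈ greedy T P l Th})) : α ∈ greedy T P l Th := by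
  induction l generalizing Th with
  | nil => simp at hα
  | cons γ l ih =>
    rw [greedy] at h ⊢
    split_ifs at h ⊢ with hc
    · rcases List.mem_cons.1 hα with rfl | hα
      · exact subset_greedy _ _ List.mem_cons_self
      · exact ih _ hα h
    · rcases List.mem_cons.1 hα with rfl | hα
      · refine absurd (h.mono ?_) hc
        rintro β hβ
        rcases List.mem_cons.1 hβ with rfl | hβ
        · exact .inl rfl
        · exact .inr (subset_greedy _ _ hβ)
      · exact ih _ hα h

/-- Finiteness of the closure comes from the function `closureD`, which lists it. -/
theorem exists_closure_list (A : ABoxFor T) : ∃ l : List GroundAtom,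
    l.Pairwise GroundAtom.LexLT ∧ ∀ α, α ∈ l ↔ α ∈ closureGA T A := by
  obtain ⟨l, h1, h2, -⟩ := closureD_enc T.toList A.atoms.toList
  exact ⟨l, h1, fun α => (h2 α).trans
    (mem_closureGA_iff (fun i => Finset.mem_toList) (fun α => Finset.mem_toList) α).symm⟩

theorem nodup_of_pairwise_lexLT {l : List GroundAtom} (h : l.Pairwise GroundAtom.LexLT) :
    l.Nodup := by
  refine List.Pairwise.imp (fun {α β} hlt => ?_) h
  rintro rfl
  exact lt_irrefl α.key hlt

/-- This makes the result independent of the order in which the input trees list `T` and `A`, so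
that the algorithm defines a function of the ABox. -/
theorem eq_of_pairwise_lexLT {l m : List GroundAtom} (hl : l.Pairwise GroundAtom.LexLT)
    (hm : m.Pairwise GroundAtom.LexLT) (h : ∀ α, α ∈ l ↔ α ∈ m) : l = m :=
  List.Perm.eq_of_pairwise (fun α _ _ _ h1 h2 => absurd h2 (lt_asymm (a := α.key) h1)) hl hm
    ((List.perm_ext_iff_of_nodup (nodup_of_pairwise_lexLT hl) (nodup_of_pairwise_lexLT hm)).2 h)

noncomputable def closureList (A : ABoxFor T) : List GroundAtom := (exists_closure_list A).choose

/-- The censor computed by the greedy algorithm. -/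
noncomputable def greedyCensor (T : TBox) (P : Policy) : Censor T :=
  fun A => {α | α ∈ greedy T P (closureList A) []}

theorem greedyCensor_optimal (h : Consistent T P ∅) :
    IsOptimalCPCensorGA T P (greedyCensor T P) := by
  refine ⟨fun A => ⟨fun α hα => ?_, ?_⟩, ?_⟩
  · have := (greedy_sublist (T := T) (P := P) (closureList A) []).subset hα
    rw [List.append_nil] at this
    exact ((exists_closure_list A).choose_spec.2 α).1 this
  · exact greedy_consistent _ _ (h.mono (by intro β hβ; simp at hβ))
  -- The greedy output together with a further atom `α` of `cens' A` lies inside the consistent set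
  -- `cens' A`, so `α` should have been accepted.
  · rintro ⟨cens', hcp, hsub, A, hA⟩
    obtain ⟨α, hα, hn⟩ := Set.exists_of_ssubset hA
    refine hn (mem_greedy_of_consistent _ _ ?_ ((hcp A).2.mono ?_))
    · exact ((exists_closure_list A).choose_spec.2 α).2 ((hcp A).1 hα)
    · exact Set.insert_subset hα (hsub A)

end

/-! ### The run of the algorithm -/

def censorBody (con : Prog) : Prog :=
  .cons (.cons (.hd (.hd .arg)) (.tl (.hd .arg))) (.cons (.tl (.hd (.tl .arg)))
    (.ite (.call con (.cons (.hd (.hd .arg)) (.cons (.tl (.hd .arg))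
      (.cons (.hd (.hd (.tl .arg))) (.tl (.tl .arg))))))
      (.cons (.hd (.hd (.tl .arg))) (.tl (.tl .arg))) (.tl (.tl .arg))))

/-- The bound `B` is on pending and accepted atoms together. This quantity never grows, since an
atom is either moved or dropped, and so one `M` covers every call of the test. -/
theorem run_censor_loop {con : Prog} {b : Data → ℕ}
    (hcon : ∀ x, ∃ n ≤ b x, Run con x (consistentD x) n) {T : TBox} {P : Policy}
    {lT : List Inclusion} {lP : List Denial} (hT : ∀ i, i ∈ lT ↔ i ∈ T) (hP : ∀ δ, δ ∈ lP ↔ δ ∈ P)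
    {B M : ℕ} (hM : ∀ y : Data, y.size ≤ B →
      b (.node (encList Inclusion.enc lT) (.node (encList Denial.enc lP) y)) ≤ M)
    (l Th : List GroundAtom)
    (hB : (encList GroundAtom.enc l).size + (encList GroundAtom.enc Th).size ≤ B) :
    ∃ n ≤ l.length * (M + 60) + 10, Run (.loop (.hd (.tl .arg)) (censorBody con))
      (.node (.node (encList Inclusion.enc lT) (encList Denial.enc lP))
        (.node (encList GroundAtom.enc l) (encList GroundAtom.enc Th)))
      (.node (.node (encList Inclusion.enc lT) (encList Denial.enc lP))
        (.node .nil (encList GroundAtom.enc (greedy T P l Th)))) n := by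
  induction l generalizing Th with
  | nil => exact ⟨4, by omega, .loopDone (.hd (.tl (.arg _)))⟩
  | cons α l ih =>
    set dT := encList Inclusion.enc lT with hdT
    set dP := encList Denial.enc lP with hdP
    set s : Data := .node (.node dT dP) (.node (encList GroundAtom.enc (α :: l))
      (encList GroundAtom.enc Th)) with hs
    have hc : Run (.hd (.tl .arg)) s (.node α.enc (encList GroundAtom.enc l)) 3 :=
      .hd (.tl (.arg _))
    have r1 : Run (.hd (.hd .arg)) s dT 3 := .hd (.hd (.arg _))
    have r2 : Run (.tl (.hd .arg)) s dP 3 := .tl (.hd (.arg _))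
    have r3 : Run (.cons (.hd (.hd (.tl .arg))) (.tl (.tl .arg))) s
        (encList GroundAtom.enc (α :: Th)) _ := .cons (.hd (.hd (.tl (.arg _)))) (.tl (.tl (.arg _)))
    have r4 : Run (.tl (.tl .arg)) s (encList GroundAtom.enc Th) 3 := .tl (.tl (.arg _))
    have r5 : Run (.tl (.hd (.tl .arg))) s (encList GroundAtom.enc l) 4 :=
      .tl (.hd (.tl (.arg _)))
    simp only [encList, Data.size_node] at hB
    obtain ⟨k, hk, rc⟩ := hcon (.node dT (.node dP (encList GroundAtom.enc (α :: Th))))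
    have hkM : k ≤ M := hk.trans (hM _ (by simp only [encList, Data.size_node]; omega))
    have hdec : consistentD (.node dT (.node dP (encList GroundAtom.enc (α :: Th)))) ≠ .nil ↔
        Consistent T P {β | β ∈ α :: Th} :=
      (consistentD_ne_nil lT lP (α :: Th)).trans (consistent_iff hT hP fun _ => Iff.rfl).symm
    have rcall := Run.call (.cons r1 (.cons r2 r3)) rc
    cases hres : consistentD (.node dT (.node dP (encList GroundAtom.enc (α :: Th)))) with
    | nil =>
      rw [hres] at rcall hdec
      have hn : ¬ Consistent T P {β | β ∈ α :: Th} := fun h => hdec.2 h rfl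
      obtain ⟨n, hn', hr⟩ := ih Th (by omega)
      rw [greedy, if_neg hn]
      refine ⟨_, ?_, .loopStep hc (.cons (.cons r1 r2) (.cons r5 (.iteElse rcall r4))) hr⟩
      rw [List.length_cons, Nat.succ_mul]
      omega
    | node u v =>
      rw [hres] at rcall hdec
      have hy : Consistent T P {β | β ∈ α :: Th} := hdec.1 (by simp)
      obtain ⟨n, hn', hr⟩ := ih (α :: Th) (by simp only [encList, Data.size_node]; omega)
      rw [greedy, if_pos hy]
      refine ⟨_, ?_, .loopStep hc (.cons (.cons r1 r2) (.cons r5 (.iteThen rcall r3))) hr⟩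
      rw [List.length_cons, Nat.succ_mul]
      omega

theorem run_optGACensor {cl con : Prog} {bcl bcon : Data → ℕ}
    (hcl : ∀ x, ∃ n ≤ bcl x, Run cl x (closureD x) n)
    (hcon : ∀ x, ∃ n ≤ bcon x, Run con x (consistentD x) n) {T : TBox} {P : Policy}
    {A : ABoxFor T} {lT : List Inclusion} {lP : List Denial} {lA : List GroundAtom}
    (hT : ∀ i, i ∈ lT ↔ i ∈ T) (hP : ∀ δ, δ ∈ lP ↔ δ ∈ P) (hA : ∀ α, α ∈ lA ↔ α ∈ A.atoms)
    {B M : ℕ} (hB : (closureD (.node (encList Inclusion.enc lT)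
      (encList GroundAtom.enc lA))).size ≤ B)
    (hM : ∀ y : Data, y.size ≤ B →
      bcon (.node (encList Inclusion.enc lT) (.node (encList Denial.enc lP) y)) ≤ M) :
    ∃ n ≤ bcl (.node (encList Inclusion.enc lT) (encList GroundAtom.enc lA)) + B * (M + 60) + 50,
      Run (OptGACensor cl con)
        (.node (encList Inclusion.enc lT)
          (.node (encList Denial.enc lP) (encList GroundAtom.enc lA)))
        (encList GroundAtom.enc (greedy T P (closureList A) [])) n := by
  obtain ⟨l, hl, hmem, he⟩ := closureD_enc lT lA
  have hl' : l = closureList A := by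
    refine eq_of_pairwise_lexLT hl (exists_closure_list A).choose_spec.1 fun α => ?_
    rw [hmem, ← mem_closureGA_iff hT hA α]
    exact ((exists_closure_list A).choose_spec.2 α).symm
  obtain ⟨k, hk, rcl⟩ := hcl (.node (encList Inclusion.enc lT) (encList GroundAtom.enc lA))
  rw [he, hl'] at rcl
  rw [he, hl'] at hB
  obtain ⟨n, hn, hr⟩ := run_censor_loop hcon hT hP hM (closureList A) []
    (by simpa [encList] using hB)
  have hlen : (closureList A).length ≤ B := by
    have := (encList GroundAtom.enc (closureList A)).length_toList_le
    rw [toList_encList, List.length_map] at this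
    omega
  set x : Data := .node (encList Inclusion.enc lT)
    (.node (encList Denial.enc lP) (encList GroundAtom.enc lA)) with hx
  have r1 : Run (.hd .arg) x (encList Inclusion.enc lT) 2 := .hd (.arg _)
  have r2 : Run (.hd (.tl .arg)) x (encList Denial.enc lP) 3 := .hd (.tl (.arg _))
  have r3 : Run (.tl (.tl .arg)) x (encList GroundAtom.enc lA) 3 := .tl (.tl (.arg _))
  refine ⟨_, ?_, .call (.call (.cons (.cons r1 r2) (.cons (.call (.cons r1 r3) rcl) (.nil _))) hr)
    (.tl (.tl (.arg _)))⟩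
  have := Nat.mul_le_mul_right (M + 60) hlen
  omega

/-! ### Sizes of representations -/

theorem size_encList {α : Type} (enc : α → Data) (l : List α) :
    (encList enc l).size = (l.map fun a => (enc a).size + 1).sum := by
  induction l with
  | nil => rfl
  | cons a l ih => simp only [encList, Data.size_node, ih, List.map_cons, List.sum_cons]; omega

theorem Represents.size_eq {α : Type} {enc : α → Data} {d : Data} {S : Finset α}
    (h : Represents enc d (S : Set α)) : d.size = ∑ a ∈ S, ((enc a).size + 1) := by
  classical
  obtain ⟨l, hn, hm, rfl⟩ := h
  have : l.toFinset = S := by ext a; simp [hm]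
  rw [size_encList, ← this, List.sum_toFinset _ hn]

theorem size_encName_le (a : Name) : (encName a).size ≤ 2 * a.length := by
  induction a with
  | nil => simp [encName, encList]
  | cons b a ih =>
    have : (encBool b).size ≤ 1 := by cases b <;> simp [encBool]
    simp only [encName, encList, Data.size_node, List.length_cons] at ih ⊢
    omega

/-- The constant comes from role atoms: four list cells, at most 2 for the kind, and the extra 1.
Each symbol of a name costs at most 2. -/
theorem GroundAtom.size_enc_le (α : GroundAtom) : α.enc.size + 1 ≤ 7 * α.size := by
  cases α with
  | concept A a =>
    have h1 := size_encName_le A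
    have h2 := size_encName_le a
    have h3 := size_encName_le [false]
    simp only [GroundAtom.enc, GroundAtom.key, GroundAtom.size, encList, Data.size_node,
      Data.size_nil, List.length_cons, List.length_nil] at h3 ⊢
    omega
  | role P a b =>
    have h1 := size_encName_le P
    have h2 := size_encName_le a
    have h4 := size_encName_le b
    have h3 := size_encName_le [true]
    simp only [GroundAtom.enc, GroundAtom.key, GroundAtom.size, encList, Data.size_node,
      Data.size_nil, List.length_cons, List.length_nil] at h3 ⊢
    omega

end CQE

/-! ### Assembly of the polynomial bound -/

theorem mainTheorem6 :
    ∃ cl con : CQE.Prog, CQE.ComputesClosureGA cl ∧ CQE.DecidesConsistency con ∧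
      ∀ (T : CQE.TBox) (P : CQE.Policy), P.IsOver T → CQE.Consistent T P ∅ →
        ∃ cens : CQE.Censor T, CQE.IsOptimalCPCensorGA T P cens ∧
          ∃ p : Polynomial ℕ, ∀ (A : CQE.ABoxFor T) (dT dP dA : CQE.Data),
            CQE.Represents CQE.Inclusion.enc dT (T : Set CQE.Inclusion) →
            CQE.Represents CQE.Denial.enc dP (P : Set CQE.Denial) →
            CQE.Represents CQE.GroundAtom.enc dA (A.atoms : Set CQE.GroundAtom) →
            ∃ (out : CQE.Data) (n : ℕ),
              CQE.Run (CQE.OptGACensor cl con) (.node dT (.node dP dA)) out n ∧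
                n ≤ p.eval A.size ∧
                CQE.Represents CQE.GroundAtom.enc out (cens A) := by
  obtain ⟨cl, bcl, hcl, hbcl, hscl⟩ := CQE.Feasible.closureD
  obtain ⟨con, bcon, hcon, hbcon, -⟩ := CQE.Feasible.consistentD
  refine ⟨cl, con, ?_, ?_, fun T P _ hc => ⟨CQE.greedyCensor T P, CQE.greedyCensor_optimal hc, ?_⟩⟩
  · rintro T A _ _ ⟨lT, -, hT, rfl⟩ ⟨lA, -, hA, rfl⟩
    obtain ⟨l, hl, hmem, he⟩ := CQE.closureD_enc lT lA
    obtain ⟨n, -, hr⟩ := hcl (.node (CQE.encList CQE.Inclusion.enc lT)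
      (CQE.encList CQE.GroundAtom.enc lA))
    exact ⟨l, n, hl, fun α => (hmem α).trans (CQE.mem_closureGA_iff hT hA α).symm, he ▸ hr⟩
  · rintro T P S _ _ _ ⟨lT, -, hT, rfl⟩ ⟨lP, -, hP, rfl⟩ ⟨lS, -, hS, rfl⟩
    obtain ⟨n, -, hr⟩ := hcon (.node (CQE.encList CQE.Inclusion.enc lT)
      (.node (CQE.encList CQE.Denial.enc lP) (CQE.encList CQE.GroundAtom.enc lS)))
    exact ⟨_, n, hr, (CQE.consistentD_ne_nil lT lP lS).trans
      (CQE.consistent_iff hT hP hS).symm⟩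
  -- Representations have no repetitions, so the trees for `T` and `P` have total size exactly `K`
  -- in whatever order. The three exponents are therefore fixed before the ABox is given.
  · set K := ∑ i ∈ T, (i.enc.size + 1) + ∑ δ ∈ P, (δ.enc.size + 1) with hK
    obtain ⟨k₁, h₁⟩ := hbcl K
    obtain ⟨k₂, h₂⟩ := hscl K
    obtain ⟨k₃, h₃⟩ := hbcon K
    -- The 3 is one node for the pair `(T . A)` and the 2 in the base of `PolyBd`.
    let Q : Polynomial ℕ := 7 * Polynomial.X + (K : Polynomial ℕ) + 3
    -- The cost of the closure, plus at most `Q ^ k₂` iterations with one consistency test each. The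
    -- 4 is two nodes for pairing the input of the test and again the 2 of the base.
    refine ⟨Q ^ k₁ + Q ^ k₂ * ((Q ^ k₂ + (K : Polynomial ℕ) + 4) ^ k₃ + 60) + 50, ?_⟩
    intro A dT dP dA rT rP rA
    have sT := rT.size_eq
    have sP := rP.size_eq
    have sA : dA.size ≤ 7 * A.size := by
      rw [rA.size_eq, CQE.ABoxFor.size, Finset.mul_sum]
      exact Finset.sum_le_sum fun α _ => α.size_enc_le
    have hQ : Q.eval A.size = 7 * A.size + K + 3 := by simp [Q]
    obtain ⟨lT, -, hT, rfl⟩ := rT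
    obtain ⟨lP, -, hP, rfl⟩ := rP
    obtain ⟨lA, -, hA, rfl⟩ := rA
    set s := 7 * A.size + K + 3 with hs
    have hin : (CQE.Data.node (CQE.encList CQE.Inclusion.enc lT)
        (CQE.encList CQE.GroundAtom.enc lA)).size + 2 ≤ s := by
      simp only [CQE.Data.size_node]; omega
    have hκ : (CQE.encList CQE.Inclusion.enc lT).size ≤ K := by omega
    obtain ⟨n, hn, hr⟩ := CQE.run_optGACensor hcl hcon (P := P) hT hP hA
      (B := s ^ k₂) (M := (s ^ k₂ + K + 4) ^ k₃)
      ((h₂ (.node _ _) hκ).trans (Nat.pow_le_pow_left hin _))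
      (fun y hy => (h₃ (.node _ (.node _ y)) (by
        simp only [CQE.Data.hd_node, CQE.Data.tl_node]; omega)).trans
        (Nat.pow_le_pow_left (by simp only [CQE.Data.size_node]; omega) _))
    refine ⟨_, n, hr, ?_, _, ?_, fun α => Iff.rfl, rfl⟩
    · refine hn.trans ?_
      have h1 := (h₁ (.node _ _) hκ).trans (Nat.pow_le_pow_left hin k₁)
      simp only [Polynomial.eval_add, Polynomial.eval_mul, Polynomial.eval_pow, hQ,
        Polynomial.eval_natCast, Polynomial.eval_ofNat, Nat.cast_id]
      omega
    · have hnd : (CQE.closureList A ++ []).Nodup := by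
        rw [List.append_nil]
        exact CQE.nodup_of_pairwise_lexLT (CQE.exists_closure_list A).choose_spec.1
      obtain ⟨m, hm, hsub⟩ := CQE.greedy_sublist (T := T) (P := P) (CQE.closureList A) []
      exact hm.nodup_iff.1 (hnd.sublist hsub)
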